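/- Let $M$ be a smooth (Hausdorff, second countable, finite-dimensional) manifold, $\mathcal A=C^\infty(M)$ the algebra of complex-valued smooth functions with pointwise complex conjugation as involution, and $E\to M$ a smooth complex vector bundle of fibre dimension $k\ge 1$. Let $\mathcal B=\Gamma^\infty(\mathrm{End}(E))$; if $E$ carries a Hermitian fibre metric $h_0$, equip $\mathcal B$ with the involution given by the fibrewise adjoint. For $\mathcal C\in\{\mathcal A,\mathcal B\}$, a local deformation of $\mathcal C$ is an associative $\mathbb C[[\lambda]]$-bilinear product $\star$ on $\mathcal C[[\lambda]]$ of the form $a\star b=\sum_{r\ge 0}C_r(a,b)\lambda^r$ for $a,b\in\mathcal C$, where the $C_r$ are $\mathbb C$-bilinear, $C_0$ is the product of $\mathcal C$, the unit of $\mathcal C$ is a unit for $\star$, and every $C_r$ is local: $\operatorname{supp}C_r(a,b)\subseteq\operatorname{supp}a\cap\operatorname{supp}b$. It is Hermitian if $(a\star b)^*=b^*\star a^*$ for all $a,b\in\mathcal C$. Two products $\star_1,\star_2$ are (locally) equivalent if there is $T=\mathrm{id}+\sum_{r\ge1}T_r\lambda^r$ with $\mathbb C$-linear $T_r:\mathcal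 C\to\mathcal C$ that do not increase supports, such that $T(a\star_1 b)=T(a)\star_2T(b)$; in the Hermitian case $T$ is also required to satisfy $T(a^*)=T(a)^*$. Let $\mathrm{Def}(\mathcal C)$ be the set of local deformations up to equivalence, $\mathrm{Def}^*(\mathcal C)$ the set of local Hermitian deformations up to equivalence, and $[\star]$ the class of $\star$. There are an $n$, an idempotent $P_0\in M_n(\mathcal A)$ and an identification $\Gamma^\infty(E)=P_0\mathcal A^n$ of $\mathcal A$-modules; if $E$ is Hermitian, $P_0$ can be chosen to be a projection ($P_0=P_0^2=P_0^*$) and the identification to be isometric for the canonical inner product $\sum_i x_i^*y_i$. Any such identification yields $\mathcal B=P_0M_n(\mathcal A)P_0$. Given a local (Hermitian) deformation $\star$ of $\mathcal A$, write $\mathbf A=(\mathcal A[[\lambda]],\star)$. Then there is an idempotent (projection) $\mathbf P\in M_n(\mathbf A)$ with $\mathbf P\equiv P_0 \bmod \lambda$, and for every such $\mathbf P$ the map $I(L)=\mathbf P\star L\star\mathbf P$ is a bijection from $P_0M_n(\mathcal A)P_0[[\lambda]]=\mathcal B[[\lambda]]$ onto $\mathbf P\star M_n(\mathbf A)\star\mathbf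 P$. Transporting the product $\star$ along $I$ gives a local (Hermitian) associative product $\star_{\mathbf P}$ on $\mathcal B[[\lambda]]$ that deforms the product of $\mathcal B$ (the unit of $\star_{\mathbf P}$ is $I^{-1}(\mathbf P)$, which need not be $1_{\mathcal B}$), and $\star_{\mathbf P}$ is (locally, and in the Hermitian case involution-preservingly) equivalent to a local (Hermitian) deformation $\star'$ of $\mathcal B$, for which $1_{\mathcal B}$ is the unit. Proposition. The assignment $\Phi([\star])=[\star']$ is a well-defined map $\Phi:\mathrm{Def}(C^\infty(M))\to\mathrm{Def}(\Gamma^\infty(\mathrm{End}(E)))$, independent of the choices of the identification, of $\mathbf P$ and of $\star'$, and $\Phi$ is a bijection. If $E$ is Hermitian, the same construction gives a well-defined map $\Phi:\mathrm{Def}^*(C^\infty(M))\to\mathrm{Def}^*(\Gamma^\infty(\mathrm{End}(E)))$, and it is a bijection. -/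

import Mathlib

open scoped Manifold ContDiff PowerSeries
open Bundle

noncomputable section

namespace StarProd

/-! ### Formal deformations of an algebra -/

section Formal

variable {k A : Type*} [CommRing k] [Ring A] [Algebra k A]

/-- The `k⟦λ⟧`-bilinear product `(∑ aᵢ λⁱ, ∑ bⱼ λʲ) ↦ ∑ Cᵣ(aᵢ, bⱼ) λ^(r+i+j)` on `A⟦λ⟧`. -/
def formalProd (C : ℕ → A →ₗ[k] A →ₗ[k] A) (f g : A⟦X⟧) : A⟦X⟧ :=
  PowerSeries.mk fun m => ∑ p ∈ Finset.HasAntidiagonal.antidiagonal m, ∑ q ∈ Finset.HasAntidiagonal.antidiagonal p.2,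
    C p.1 (PowerSeries.coeff q.1 f) (PowerSeries.coeff q.2 g)

/-- The `k⟦λ⟧`-linear map `∑ aⱼ λʲ ↦ ∑ Tᵣ(aⱼ) λ^(r+j)` on `A⟦λ⟧` given by `T = ∑ Tᵣ λʳ`. -/
def formalMap (T : (Module.End k A)⟦X⟧) (f : A⟦X⟧) : A⟦X⟧ :=
  PowerSeries.mk fun m => ∑ p ∈ Finset.HasAntidiagonal.antidiagonal m,
    PowerSeries.coeff p.1 T (PowerSeries.coeff p.2 f)

variable (k A) in
/-- An associative `k⟦λ⟧`-bilinear product `⋆ = ∑ Cᵣ λʳ` on `A⟦λ⟧` with `C₀` the product of `A`. -/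
structure FormalProduct where
  cochain : ℕ → A →ₗ[k] A →ₗ[k] A
  cochain_zero : ∀ a b, cochain 0 a b = a * b
  assoc : ∀ f g h : A⟦X⟧,
    formalProd cochain (formalProd cochain f g) h = formalProd cochain f (formalProd cochain g h)

/-- The product `f ⋆ g` of `A⟦λ⟧`. -/
def FormalProduct.star (D : FormalProduct k A) (f g : A⟦X⟧) : A⟦X⟧ := formalProd D.cochain f g

/-- The unit of `A` is a unit for `⋆`. -/
def FormalProduct.IsUnital (D : FormalProduct k A) : Prop :=
  ∀ f : A⟦X⟧, D.star 1 f = f ∧ D.star f 1 = f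

/-- `D₁` and `D₂` are equivalent through some `T = id + ∑_{r ≥ 1} Tᵣ λʳ` with all `Tᵣ ∈ S`. -/
def EquivVia (S : Subring (Module.End k A)) (D₁ D₂ : FormalProduct k A) : Prop :=
  ∃ T : (Module.End k A)⟦X⟧, PowerSeries.coeff 0 T = 1 ∧ (∀ r, PowerSeries.coeff r T ∈ S) ∧
    ∀ f g : A⟦X⟧, formalMap T (D₁.star f g) = D₂.star (formalMap T f) (formalMap T g)

theorem formalMap_one (f : A⟦X⟧) : formalMap (1 : (Module.End k A)⟦X⟧) f = f := by
  ext m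
  rw [formalMap, PowerSeries.coeff_mk, Finset.sum_eq_single (0, m)]
  · simp
  · rintro ⟨i, j⟩ h hne
    have hi : i ≠ 0 := by
      rintro rfl
      simp at h
      exact hne (by simp [h])
    simp [PowerSeries.coeff_one, hi]
  · intro h; simp at h

theorem formalMap_mul (S T : (Module.End k A)⟦X⟧) (f : A⟦X⟧) :
    formalMap (S * T) f = formalMap S (formalMap T f) := by
  ext m
  simp only [formalMap, PowerSeries.coeff_mk, PowerSeries.coeff_mul, LinearMap.sum_apply, map_sum,
    Module.End.mul_apply]
  rw [Finset.sum_sigma', Finset.sum_sigma']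
  refine Finset.sum_nbij' (fun ⟨⟨_, l⟩, ⟨i, j⟩⟩ => ⟨(i, j + l), (j, l)⟩)
    (fun ⟨⟨i, _⟩, ⟨j, l⟩⟩ => ⟨(i + j, l), (i, j)⟩) ?_ ?_ ?_ ?_ (fun _ _ => rfl) <;>
  · rintro ⟨⟨a, b⟩, ⟨c, d⟩⟩ h
    simp only [Finset.mem_sigma, Finset.HasAntidiagonal.mem_antidiagonal] at h
    obtain ⟨h1, h2⟩ := h
    subst h2
    simp [← h1, add_assoc]

theorem EquivVia.refl (S : Subring (Module.End k A)) (D : FormalProduct k A) :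
    EquivVia S D D := by
  refine ⟨1, by simp, fun r => ?_, fun f g => by simp only [formalMap_one]⟩
  rw [PowerSeries.coeff_one]
  split_ifs
  exacts [S.one_mem, S.zero_mem]

theorem EquivVia.trans {S : Subring (Module.End k A)} {D₁ D₂ D₃ : FormalProduct k A}
    (h : EquivVia S D₁ D₂) (h' : EquivVia S D₂ D₃) : EquivVia S D₁ D₃ := by
  obtain ⟨T, hT0, hT, hm⟩ := h
  obtain ⟨T', hT0', hT', hm'⟩ := h'
  refine ⟨T' * T, ?_, fun r => ?_, fun f g => by simp only [formalMap_mul, hm, hm']⟩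
  · simp_all [PowerSeries.coeff_mul]
  · rw [PowerSeries.coeff_mul]
    exact S.sum_mem fun p _ => S.mul_mem (hT' _) (hT _)

theorem EquivVia.symm {S : Subring (Module.End k A)} {D₁ D₂ : FormalProduct k A}
    (h : EquivVia S D₁ D₂) : EquivVia S D₂ D₁ := by
  obtain ⟨T, hT0, hT, hm⟩ := h
  have hc : PowerSeries.constantCoeff T = ((1 : (Module.End k A)ˣ) : Module.End k A) := by
    simpa using hT0
  have h1 := PowerSeries.mul_invOfUnit T 1 hc
  have h2 := PowerSeries.invOfUnit_mul T 1 hc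
  refine ⟨PowerSeries.invOfUnit T 1, by simp, fun r => ?_, fun f g => ?_⟩
  · induction r using Nat.strong_induction_on with
    | _ r ih =>
      rw [PowerSeries.coeff_invOfUnit]
      split_ifs with h0
      · simp
      · simp only [inv_one, Units.val_one]
        refine S.neg_mem (S.sum_mem fun p _ => ?_)
        split_ifs with hp
        exacts [S.mul_mem (hT _) (ih _ hp), S.zero_mem]
  · have key : ∀ f : A⟦X⟧, formalMap T (formalMap (PowerSeries.invOfUnit T 1) f) = f := fun f => by
      rw [← formalMap_mul, h1, formalMap_one]
    have key' : ∀ f : A⟦X⟧, formalMap (PowerSeries.invOfUnit T 1) (formalMap T f) = f := fun f => by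
      rw [← formalMap_mul, h2, formalMap_one]
    conv_lhs => rw [← key f, ← key g, ← hm, key']

/-- The product of `⋆` extended to matrices over `A⟦λ⟧`: this is the product of `Mₙ(A⟦λ⟧, ⋆)`. -/
def FormalProduct.matStar {n : ℕ} (D : FormalProduct k A) (L S : Matrix (Fin n) (Fin n) A⟦X⟧) :
    Matrix (Fin n) (Fin n) A⟦X⟧ :=
  fun i j => ∑ l, D.star (L i l) (S l j)

end Formal

/-! ### Local and Hermitian deformations

The algebras of interest are algebras of sections over a space `M`; `ev x a` is the value of the
section `a` at `x`. -/

section Local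

variable {k A : Type*} [CommRing k] [Ring A] [Algebra k A]
variable {M : Type*} [TopologicalSpace M] {W : M → Type*} [∀ x, AddCommGroup (W x)]

/-- The support of a section. -/
def supp (ev : ∀ x, A →+ W x) (a : A) : Set M := closure {x | ev x a ≠ 0}

theorem supp_zero (ev : ∀ x, A →+ W x) : supp ev 0 = ∅ := by simp [supp]

theorem supp_neg (ev : ∀ x, A →+ W x) (a : A) : supp ev (-a) = supp ev a := by simp [supp]

theorem supp_add (ev : ∀ x, A →+ W x) (a b : A) : supp ev (a + b) ⊆ supp ev a ∪ supp ev b := by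
  rw [supp, supp, supp, ← closure_union]
  refine closure_mono fun x hx => ?_
  by_contra h
  simp only [Set.mem_union, Set.mem_ofPred_eq, not_or, not_not] at h
  exact hx (by rw [map_add, h.1, h.2, add_zero])

/-- The ring of local linear operators: those that do not increase supports. -/
def localOps (k : Type*) [CommRing k] [Algebra k A] (ev : ∀ x, A →+ W x) :
    Subring (Module.End k A) where
  carrier := {T | ∀ a, supp ev (T a) ⊆ supp ev a}
  mul_mem' := fun {S T} hS hT a => (hS (T a)).trans (hT a)
  one_mem' := fun a => subset_rfl
  zero_mem' := fun a => by simp [supp_zero]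
  add_mem' := fun {S T} hS hT a => (supp_add ev (S a) (T a)).trans (Set.union_subset (hS a) (hT a))
  neg_mem' := fun {S} hS a => by simpa [supp_neg] using hS a

/-- The ring of local linear operators that commute with the involution `st`. -/
def hermLocalOps (k : Type*) [CommRing k] [Algebra k A] (ev : ∀ x, A →+ W x) (st : A →+ A) :
    Subring (Module.End k A) where
  carrier := {T | T ∈ localOps k ev ∧ ∀ a, T (st a) = st (T a)}
  mul_mem' := fun {S T} hS hT => ⟨mul_mem hS.1 hT.1, fun a => by simp [hS.2, hT.2]⟩
  one_mem' := ⟨one_mem _, fun a => rfl⟩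
  zero_mem' := ⟨zero_mem _, fun a => by simp⟩
  add_mem' := fun {S T} hS hT => ⟨add_mem hS.1 hT.1, fun a => by simp [hS.2, hT.2]⟩
  neg_mem' := fun {S} hS => ⟨neg_mem hS.1, fun a => by simp [hS.2]⟩

/-- A product `⋆ = ∑ Cᵣ λʳ` is local if every `Cᵣ` is local in each argument. -/
def FormalProduct.IsLocal (ev : ∀ x, A →+ W x) (D : FormalProduct k A) : Prop :=
  ∀ r a b, supp ev (D.cochain r a b) ⊆ supp ev a ∩ supp ev b

/-- A product `⋆ = ∑ Cᵣ λʳ` is Hermitian if `(a ⋆ b)* = b* ⋆ a*` for `a, b ∈ A`. -/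
def FormalProduct.IsHermitian (st : A →+ A) (D : FormalProduct k A) : Prop :=
  ∀ r a b, st (D.cochain r a b) = D.cochain r (st b) (st a)

/-- A local (unit preserving) formal deformation. -/
structure LocalDef (k : Type*) [CommRing k] [Algebra k A] (ev : ∀ x, A →+ W x) extends
    FormalProduct k A where
  unital : toFormalProduct.IsUnital
  isLocal : toFormalProduct.IsLocal ev

/-- A local Hermitian (unit preserving) formal deformation. -/
structure HermLocalDef (k : Type*) [CommRing k] [Algebra k A] (ev : ∀ x, A →+ W x)
    (st : A →+ A) extends LocalDef k ev where
  hermitian : toFormalProduct.IsHermitian st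

/-- Local equivalence of local deformations. -/
instance LocalDef.setoid (ev : ∀ x, A →+ W x) : Setoid (LocalDef k ev) where
  r D₁ D₂ := EquivVia (localOps k ev) D₁.toFormalProduct D₂.toFormalProduct
  iseqv := ⟨fun _ => EquivVia.refl _ _, EquivVia.symm, EquivVia.trans⟩

/-- Involution preserving local equivalence of Hermitian local deformations. -/
instance HermLocalDef.setoid (ev : ∀ x, A →+ W x) (st : A →+ A) :
    Setoid (HermLocalDef k ev st) where
  r D₁ D₂ := EquivVia (hermLocalOps k ev st) D₁.toFormalProduct D₂.toFormalProduct
  iseqv := ⟨fun _ => EquivVia.refl _ _, EquivVia.symm, EquivVia.trans⟩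

/-- `Def`: the set of local deformations up to local equivalence. -/
def Def (k : Type*) [CommRing k] [Algebra k A] (ev : ∀ x, A →+ W x) : Type _ :=
  Quotient (LocalDef.setoid (k := k) ev)

/-- `Def*`: the set of local Hermitian deformations up to involution preserving local
equivalence. -/
def HermDef (k : Type*) [CommRing k] [Algebra k A] (ev : ∀ x, A →+ W x) (st : A →+ A) : Type _ :=
  Quotient (HermLocalDef.setoid (k := k) ev st)

/-- The class `[⋆]` in `Def`. -/
def LocalDef.cls {ev : ∀ x, A →+ W x} (D : LocalDef k ev) : Def k ev := Quotient.mk _ D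

/-- The class `[⋆]` in `Def*`. -/
def HermLocalDef.cls {ev : ∀ x, A →+ W x} {st : A →+ A} (D : HermLocalDef k ev st) :
    HermDef k ev st := Quotient.mk _ D

end Local

/-! ### Smooth functions, vector bundles and endomorphisms -/

section Geometry

variable (d : ℕ) {M : Type*} [TopologicalSpace M] [ChartedSpace (EuclideanSpace ℝ (Fin d)) M]

variable (M) in
/-- The algebra `C^∞(M)` of complex-valued smooth functions on the `d`-dimensional manifold `M`. -/
abbrev SmoothFn : Type _ := C^∞⟮𝓡 d, M; 𝓘(ℝ, ℂ), ℂ⟯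

/-- `ℂ`, seen as a real manifold, is a smooth ring. -/
instance instContMDiffRingComplex : ContMDiffRing 𝓘(ℝ, ℂ) ∞ ℂ :=
  { instNormedSpaceLieAddGroup with
    contMDiff_mul := by
      rw [← modelWithCornersSelf_prod, chartedSpaceSelf_prod]
      exact (contDiff_fst.mul contDiff_snd).contMDiff }

/-- `C^∞(M)` as an algebra over `ℂ`, through the constant functions. -/
instance SmoothFn.instAlgebra : Algebra ℂ (SmoothFn d M) :=
  RingHom.toAlgebra
    { toFun := fun c => ⟨fun _ => c, contMDiff_const⟩
      map_one' := rfl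
      map_mul' := fun _ _ => rfl
      map_zero' := rfl
      map_add' := fun _ _ => rfl }

variable (M) in
/-- Evaluation of functions at a point. -/
def SmoothFn.ev (x : M) : SmoothFn d M →+ ℂ where
  toFun f := f x
  map_zero' := rfl
  map_add' _ _ := rfl

variable (M) in
/-- Pointwise complex conjugation on `C^∞(M)`. -/
def SmoothFn.conj : SmoothFn d M →+ SmoothFn d M where
  toFun f := ⟨fun x => (starRingEnd ℂ) (f x), Complex.conjCLE.contDiff.contMDiff.comp f.contMDiff⟩
  map_zero' := by ext x; exact map_zero (starRingEnd ℂ)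
  map_add' f g := by ext x; exact map_add (starRingEnd ℂ) (f x) (g x)

-- `V` is a smooth complex vector bundle with typical fibre `F` over `M`. Its trivializations are
-- fibrewise `ℂ`-linear (hence also `ℝ`-linear), and its transition functions are smooth.
variable (F : Type*) [NormedAddCommGroup F] [NormedSpace ℂ F]
  (V : M → Type*) [TopologicalSpace (TotalSpace F V)]
  [∀ x, AddCommGroup (V x)] [∀ x, Module ℂ (V x)] [∀ x, TopologicalSpace (V x)]
  [FiberBundle F V] [VectorBundle ℂ F V]

/-- The space `Γ^∞(E)` of smooth sections. -/
abbrev Sect : Type _ := ContMDiffSection (𝓡 d) F ∞ V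

variable {d F V}

theorem smooth_smul {f : M → ℂ} {s : ∀ x, V x} {x₀ : M}
    (hf : ContMDiffAt (𝓡 d) 𝓘(ℝ, ℂ) ∞ f x₀)
    (hs : ContMDiffAt (𝓡 d) ((𝓡 d).prod 𝓘(ℝ, F)) ∞ (fun x => TotalSpace.mk' F x (s x)) x₀) :
    ContMDiffAt (𝓡 d) ((𝓡 d).prod 𝓘(ℝ, F)) ∞ (fun x => TotalSpace.mk' F x (f x • s x)) x₀ := by
  rw [contMDiffAt_section] at hs ⊢
  have hm : ContMDiff 𝓘(ℝ, ℂ × F) 𝓘(ℝ, F) ∞ (fun p : ℂ × F => p.1 • p.2) :=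
    (contDiff_fst.smul contDiff_snd).contMDiff
  refine (hm.contMDiffAt.comp x₀ (hf.prodMk_space hs)).congr_of_eventuallyEq ?_
  filter_upwards [(trivializationAt F V x₀).open_baseSet.mem_nhds
    (mem_baseSet_trivializationAt F V x₀)] with x hx
  exact ((trivializationAt F V x₀).linear ℂ hx).2 _ _

variable [VectorBundle ℝ F V]

/-- The module structure of `Γ^∞(E)` over `C^∞(M)`. -/
instance Sect.instModule : Module (SmoothFn d M) (Sect d F V) where
  smul f s := ⟨fun x => f x • s x, fun x => smooth_smul (f.contMDiff x) (s.contMDiff x)⟩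
  one_smul s := by ext x; exact one_smul ℂ (s x)
  mul_smul f g s := by ext x; exact mul_smul (f x) (g x) (s x)
  smul_zero f := by ext x; exact smul_zero (f x)
  smul_add f s t := by ext x; exact smul_add (f x) (s x) (t x)
  add_smul f g s := by ext x; exact add_smul (f x) (g x) (s x)
  zero_smul s := by ext x; exact zero_smul ℂ (s x)

variable (d F V) in
/-- The algebra `Γ^∞(End E)` of smooth sections of the endomorphism bundle: families of
`ℂ`-linear endomorphisms of the fibres that carry smooth sections to smooth sections. -/
def EndSect : Subalgebra ℂ (∀ x, Module.End ℂ (V x)) where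
  carrier := {L | ∀ s : Sect d F V,
    ContMDiff (𝓡 d) ((𝓡 d).prod 𝓘(ℝ, F)) ∞ (fun x => TotalSpace.mk' F x (L x (s x)))}
  mul_mem' := fun {_ S} hL hS s => hL ⟨fun x => S x (s x), hS s⟩
  add_mem' := fun hL hS s => (hL s).add_section (hS s)
  algebraMap_mem' := fun _ s x => smooth_smul contMDiffAt_const (s.contMDiff x)

variable (d F V) in
/-- The value of a section of the endomorphism bundle at a point. -/
def EndSect.ev (x : M) : EndSect d F V →+ Module.End ℂ (V x) where
  toFun L := L.1 x
  map_zero' := rfl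
  map_add' _ _ := rfl

/-- The `C^∞(M)`-linear endomorphism of `Γ^∞(E)` given by a section of the endomorphism bundle. -/
def EndSect.toLin (L : EndSect d F V) : Sect d F V →ₗ[SmoothFn d M] Sect d F V where
  toFun s := ⟨fun x => L.1 x (s x), L.2 s⟩
  map_add' s t := by ext x; exact map_add (L.1 x) (s x) (t x)
  map_smul' f s := by ext x; exact map_smul (L.1 x) (f x) (s x)

variable (d F V) in
/-- A Hermitian fibre metric on `E`, conjugate-linear in the first argument. -/
structure HermitianMetric where
  form : ∀ x, V x →ₗ⋆[ℂ] V x →ₗ[ℂ] ℂ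
  conj_symm : ∀ x v w, (starRingEnd ℂ) (form x v w) = form x w v
  pos : ∀ x v, v ≠ 0 → 0 < (form x v v).re
  smooth : ∀ s t : Sect d F V, ContMDiff (𝓡 d) 𝓘(ℝ, ℂ) ∞ (fun x => form x (s x) (t x))

namespace HermitianMetric

variable [FiniteDimensional ℂ F]

theorem exists_adjoint (h : HermitianMetric d F V) (x : M) (L : Module.End ℂ (V x)) :
    ∃ L' : Module.End ℂ (V x), ∀ v w, h.form x (L' v) w = h.form x v (L w) := by
  let c : InnerProductSpace.Core ℂ (V x) :=
    { inner := fun v w => h.form x v w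
      conj_inner_symm := fun v w => h.conj_symm x w v
      re_inner_nonneg := fun v => by
        by_cases hv : v = 0
        · simp [hv]
        · exact (h.pos x v hv).le
      add_left := fun u v w => by simp
      smul_left := fun v w r => by simp
      definite := fun v hv => by
        by_contra hne
        exact absurd (h.pos x v hne) (by rw [hv]; simp) }
  let _ : NormedAddCommGroup (V x) := c.toNormedAddCommGroup
  let _ : InnerProductSpace ℂ (V x) := InnerProductSpace.ofCore c.toCore
  have _ : FiniteDimensional ℂ (V x) :=
    LinearEquiv.finiteDimensional ((trivializationAt F V x).linearEquivAt (R := ℂ) x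
      (mem_baseSet_trivializationAt F V x)).symm
  exact ⟨LinearMap.adjoint L, fun v w => LinearMap.adjoint_inner_left L w v⟩

variable [IsManifold (𝓡 d) ∞ M] [T2Space M] [ContMDiffVectorBundle ∞ F V (𝓡 d)]

theorem exists_frame (x₀ : M) : ∃ (n : ℕ) (e : Fin n → Sect d F V),
    ∀ᶠ x in nhds x₀, LinearIndependent ℝ (fun i => e i x) ∧
      ⊤ ≤ Submodule.span ℝ (Set.range fun i => e i x) := by
  let t := trivializationAt F V x₀
  have _ : FiniteDimensional ℝ F := FiniteDimensional.complexToReal F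
  let b := Module.finBasis ℝ F
  have hx₀ : x₀ ∈ t.baseSet := mem_baseSet_trivializationAt F V x₀
  obtain ⟨f, -, hf⟩ := (SmoothBumpFunction.nhds_basis_tsupport (I := 𝓡 d) x₀).mem_iff.1
    (t.open_baseSet.mem_nhds hx₀)
  refine ⟨_, fun i => ⟨(f : M → ℝ) • t.localFrame b i,
    ContMDiffOn.smul_section_of_tsupport f.contMDiff.contMDiffOn t.open_baseSet hf
      (t.contMDiffOn_localFrame_baseSet (I := 𝓡 d) ∞ b i)⟩, ?_⟩
  filter_upwards [t.open_baseSet.mem_nhds hx₀, f.eventuallyEq_one] with x hx hfx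
  have hF := t.isLocalFrameOn_localFrame_baseSet (𝓡 d) ∞ b
  have he : ∀ i, ((f : M → ℝ) • t.localFrame b i) x = t.localFrame b i x := fun i => by
    simp [hfx]
  simp only [ContMDiffSection.coeFn_mk, he]
  exact ⟨hF.linearIndependent hx, hF.generating hx⟩

theorem exists_smooth_adjoint (h : HermitianMetric d F V) (L : EndSect d F V) :
    ∃ L' : EndSect d F V, ∀ x v w, h.form x (L'.1 x v) w = h.form x v (L.1 x w) := by
  choose L' hL' using fun x => h.exists_adjoint x (L.1 x)
  refine ⟨⟨L', fun t x₀ => ?_⟩, hL'⟩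
  obtain ⟨n, e, he⟩ := exists_frame (d := d) (F := F) (V := V) x₀
  let G : M → Matrix (Fin n) (Fin n) ℝ := fun x => .of fun i j => (h.form x (e i x) (e j x)).re
  let r : M → Fin n → ℝ := fun x i => (h.form x (L.1 x (e i x)) (t x)).re
  have hre : ∀ {g : M → ℂ}, ContMDiff (𝓡 d) 𝓘(ℝ, ℂ) ∞ g →
      ContMDiff (𝓡 d) 𝓘(ℝ, ℝ) ∞ (fun x => (g x).re) := fun hg =>
    Complex.reCLM.contDiff.contMDiff.comp hg
  have hG : ∀ i j, ContMDiff (𝓡 d) 𝓘(ℝ, ℝ) ∞ (fun x => G x i j) := fun i j =>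
    hre (h.smooth (e i) (e j))
  have hr : ∀ i, ContMDiff (𝓡 d) 𝓘(ℝ, ℝ) ∞ (fun x => r x i) := fun i =>
    hre (h.smooth (EndSect.toLin L (e i)) t)
  have hdet : ∀ (B : M → Matrix (Fin n) (Fin n) ℝ),
      (∀ i j, ContMDiff (𝓡 d) 𝓘(ℝ, ℝ) ∞ (fun x => B x i j)) →
      ContMDiff (𝓡 d) 𝓘(ℝ, ℝ) ∞ (fun x => (B x).det) := fun B hB => by
    have h1 : ContDiff ℝ ∞ (fun A : Fin n → Fin n → ℝ => (Matrix.of A).det) := by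
      simp only [Matrix.det_apply, Matrix.of_apply]
      fun_prop
    exact h1.contMDiff.comp (contMDiff_pi_space.2 fun i => contMDiff_pi_space.2 fun j => hB i j)
  have hsplit : ∀ x (a : Fin n → ℝ) (i : Fin n),
      (G x).mulVec a i = (h.form x (e i x) (∑ j, a j • e j x)).re := fun x a i => by
    simp [Matrix.mulVec, dotProduct, G, map_sum, mul_comm]
  have hne : ∀ᶠ x in nhds x₀, (G x).det ≠ 0 := by
    filter_upwards [he] with x hx h0
    obtain ⟨v, hv, hGv⟩ := Matrix.exists_mulVec_eq_zero_iff.2 h0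
    refine hv (funext fun i => Fintype.linearIndependent_iff.1 hx.1 v ?_ i)
    by_contra hs
    refine (h.pos x _ hs).ne' ?_
    have : ∀ i, (h.form x (e i x) (∑ j, v j • e j x)).re = 0 := fun i => by
      rw [← hsplit, hGv]; rfl
    have h2 : ∀ u, h.form x (∑ j, v j • e j x) u = ∑ j, (v j : ℂ) * h.form x (e j x) u := by
      intro u
      rw [map_sum, LinearMap.sum_apply]
      refine Finset.sum_congr rfl fun j _ => ?_
      rw [← Complex.coe_smul (v j) (e j x), LinearMap.map_smulₛₗ]
      simp
    rw [h2, Complex.re_sum]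
    exact Finset.sum_eq_zero fun j _ => by rw [Complex.re_ofReal_mul, this, mul_zero]
  have hsm : ContMDiffAt (𝓡 d) ((𝓡 d).prod 𝓘(ℝ, F)) ∞ (fun x => TotalSpace.mk' F x
      (∑ i, ((G x).det⁻¹ * ((G x).updateCol i (r x)).det) • e i x)) x₀ := by
    refine ContMDiffAt.sum_section fun i _ => ContMDiffAt.smul_section (ContMDiffAt.mul ?_ ?_)
      ((e i).contMDiff x₀)
    · exact ((contDiffAt_inv ℝ hne.self_of_nhds).contMDiffAt).comp x₀ (hdet G hG x₀)
    · refine hdet _ (fun k l => ?_) x₀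
      by_cases hl : l = i
      · subst hl; simpa using hr k
      · simpa [Matrix.updateCol_apply, hl] using hG k l
  refine hsm.congr_of_eventuallyEq ?_
  filter_upwards [he, hne] with x hx hd
  congr 1
  obtain ⟨a, ha⟩ := (Submodule.mem_span_range_iff_exists_fun ℝ).1
    (hx.2 (Submodule.mem_top (x := L' x (t x))))
  have hGa : (G x).mulVec a = r x := funext fun i => by
    rw [hsplit, ha, ← h.conj_symm, hL', ← h.conj_symm]
    simp [r]
  have hcr := Matrix.mulVec_cramer (G x) (r x)
  have ha' : a = (G x).det⁻¹ • Matrix.cramer (G x) (r x) := by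
    have hinj := Matrix.mulVec_injective_of_isUnit
      ((Matrix.isUnit_iff_isUnit_det (G x)).2 (isUnit_iff_ne_zero.2 hd))
    apply hinj
    rw [Matrix.mulVec_smul, hcr, smul_smul, inv_mul_cancel₀ hd, one_smul, hGa]
  rw [← ha, ha']
  simp [Matrix.cramer_apply]

theorem adjoint_unique (h : HermitianMetric d F V) {L L' : EndSect d F V}
    (H : ∀ x v w, h.form x (L.1 x v) w = h.form x (L'.1 x v) w) : L = L' := by
  ext x v
  by_contra hne
  have := h.pos x _ (sub_ne_zero.2 hne)
  have h0 : ∀ w, h.form x (L.1 x v - L'.1 x v) w = 0 := fun w => by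
    rw [map_sub, LinearMap.sub_apply, H, sub_self]
  rw [h0] at this
  simp at this

/-- The involution of `Γ^∞(End E)`: the fibrewise adjoint. -/
def adjoint (h : HermitianMetric d F V) : EndSect d F V →+ EndSect d F V where
  toFun L := (h.exists_smooth_adjoint L).choose
  map_zero' := h.adjoint_unique fun x v w => by
    rw [(h.exists_smooth_adjoint 0).choose_spec]; simp
  map_add' L S := h.adjoint_unique fun x v w => by
    have h1 := (h.exists_smooth_adjoint L).choose_spec x v w
    have h2 := (h.exists_smooth_adjoint S).choose_spec x v w
    have h3 := (h.exists_smooth_adjoint (L + S)).choose_spec x v w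
    rw [h3]
    change _ = h.form x ((h.exists_smooth_adjoint L).choose.1 x v +
      (h.exists_smooth_adjoint S).choose.1 x v) w
    rw [map_add, LinearMap.add_apply, h1, h2, ← map_add]
    rfl

theorem adjoint_spec (h : HermitianMetric d F V) (L : EndSect d F V) (x : M) (v w : V x) :
    h.form x ((h.adjoint L).1 x v) w = h.form x v (L.1 x w) :=
  (h.exists_smooth_adjoint L).choose_spec x v w

end HermitianMetric

end Geometry

/-! ### The deformation of `Γ^∞(End E)` induced by a deformed idempotent -/

section Induced

variable {d : ℕ} {M : Type*} [TopologicalSpace M] [ChartedSpace (EuclideanSpace ℝ (Fin d)) M]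
variable {F : Type*} [NormedAddCommGroup F] [NormedSpace ℂ F]
  {V : M → Type*} [TopologicalSpace (TotalSpace F V)]
  [∀ x, AddCommGroup (V x)] [∀ x, Module ℂ (V x)] [∀ x, TopologicalSpace (V x)]
  [FiberBundle F V] [VectorBundle ℂ F V] [VectorBundle ℝ F V]

variable (d F V) in
/-- An identification `Γ^∞(E) = P₀ Aⁿ` of `A`-modules, where `A = C^∞(M)` and `P₀ ∈ Mₙ(A)` is an
idempotent. -/
structure Presentation where
  n : ℕ
  P₀ : Matrix (Fin n) (Fin n) (SmoothFn d M)
  idem : P₀ * P₀ = P₀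
  iso : Sect d F V ≃ₗ[SmoothFn d M] LinearMap.range P₀.mulVecLin

namespace Presentation

/-- `P₀` is a projection and the identification is isometric for the Hermitian metric `h` and the
canonical inner product `∑ xᵢ* yᵢ` on `P₀ Aⁿ`. -/
def IsIsometric (p : Presentation d F V) (h : HermitianMetric d F V) : Prop :=
  (∀ i j, SmoothFn.conj d M (p.P₀ j i) = p.P₀ i j) ∧
    ∀ (s t : Sect d F V) (x : M), h.form x (s x) (t x) =
      ∑ i, (starRingEnd ℂ) ((p.iso s : Fin p.n → SmoothFn d M) i x) *
        (p.iso t : Fin p.n → SmoothFn d M) i x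

/-- The identification of `Γ^∞(End E)` with `P₀ Mₙ(A) P₀`: the matrix of
`Aⁿ → P₀ Aⁿ = Γ^∞(E) → Γ^∞(E) = P₀ Aⁿ ⊆ Aⁿ`. -/
def matrix (p : Presentation d F V) (L : EndSect d F V) :
    Matrix (Fin p.n) (Fin p.n) (SmoothFn d M) :=
  LinearMap.toMatrix' ((LinearMap.range p.P₀.mulVecLin).subtype ∘ₗ p.iso.toLinearMap ∘ₗ
    EndSect.toLin L ∘ₗ p.iso.symm.toLinearMap ∘ₗ p.P₀.mulVecLin.rangeRestrict)

/-- The `λ`-linear extension of `matrix`. -/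
def matrixSeries (p : Presentation d F V) (L : (EndSect d F V)⟦X⟧) :
    Matrix (Fin p.n) (Fin p.n) (SmoothFn d M)⟦X⟧ :=
  fun i j => PowerSeries.mk fun r => p.matrix (PowerSeries.coeff r L) i j

/-- `P ∈ Mₙ(A⟦λ⟧)` is a deformation of `P₀`: it is idempotent for `⋆` and equals `P₀` mod `λ`. -/
def IsDeformedIdempotent (p : Presentation d F V) (D : FormalProduct ℂ (SmoothFn d M))
    (P : Matrix (Fin p.n) (Fin p.n) (SmoothFn d M)⟦X⟧) : Prop :=
  D.matStar P P = P ∧ ∀ i j, PowerSeries.coeff 0 (P i j) = p.P₀ i j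

/-- The matrix `P` over `A⟦λ⟧` is Hermitian. -/
def IsSelfAdjoint (p : Presentation d F V)
    (P : Matrix (Fin p.n) (Fin p.n) (SmoothFn d M)⟦X⟧) : Prop :=
  ∀ i j r, SmoothFn.conj d M (PowerSeries.coeff r (P j i)) = PowerSeries.coeff r (P i j)

/-- The map `I(L) = P ⋆ L ⋆ P` on `P₀ Mₙ(A) P₀⟦λ⟧ = Γ^∞(End E)⟦λ⟧`. -/
def cornerMap (p : Presentation d F V) (D : FormalProduct ℂ (SmoothFn d M))
    (P : Matrix (Fin p.n) (Fin p.n) (SmoothFn d M)⟦X⟧) (L : (EndSect d F V)⟦X⟧) :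
    Matrix (Fin p.n) (Fin p.n) (SmoothFn d M)⟦X⟧ :=
  D.matStar (D.matStar P (p.matrixSeries L)) P

/-- `D'` is the product induced by `P ⋆ Mₙ(A⟦λ⟧) ⋆ P` through the bijection
`I : Γ^∞(End E)⟦λ⟧ → P ⋆ Mₙ(A⟦λ⟧) ⋆ P`. -/
def Induces (p : Presentation d F V) (D : FormalProduct ℂ (SmoothFn d M))
    (P : Matrix (Fin p.n) (Fin p.n) (SmoothFn d M)⟦X⟧)
    (D' : FormalProduct ℂ (EndSect d F V)) : Prop :=
  Set.BijOn (p.cornerMap D P) Set.univ (Set.range fun L => D.matStar (D.matStar P L) P) ∧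
    ∀ L S, p.cornerMap D P (D'.star L S) = D.matStar (p.cornerMap D P L) (p.cornerMap D P S)

end Presentation

end Induced

end StarProd

end

open StarProd

/-! The theorem is a deformed Morita equivalence. The smooth sections of `E` form a module over R =
C^∞(M) and over S = Γ^∞(End E), faithful and finitely generated projective over either, and the two
actions commute. `Bimod.Deforms` relates a formal product on R to one on S when E⟦λ⟧ carries
commuting actions of both that deform the classical ones. The relation is symmetric in the two
algebras and mentions neither an idempotent nor a frame.

A finite dual basis over R yields existence and uniqueness. Existence
(`DualBasis.exists_corner_mul`, `DualBasis.deforms_corner`): the projection matrix of E lifts to an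
idempotent P for the product, E⟦λ⟧ becomes the module of rows fixed by P, and the matrices fixed by
P on both sides act on it and form a deformation of S. Uniqueness (`DualBasis.deforms_unique`): E is
projective, so any two deformations of the R-module are isomorphic; every endomorphism of such a
deformation comes from S⟦λ⟧ (`DualBasis.exists_commutant`), so the product on S is determined up to
local equivalence. With dual bases over both algebras the relation becomes a bijection of classes
(`exists_bijective_def`). The product induced by any presentation and any P stands in the relation
to the given one, which gives independence of the choices. The bimodule formalism uses left actions
and rows while the statement uses columns, so the opposite product on R appears.

The formal part rests on two devices. Identities that hold modulo λ and can be divided by λ hold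
outright, because the modules involved are λ-separated (`XSep`). Operators that are the identity
modulo λ have local inverses by a Neumann series (`Ser.exists_inverse`).

In the Hermitian case P can be lifted self-adjointly. For uniqueness, an equivalence T between
Hermitian products is replaced by T√(T⁻¹T†), in the manner of a polar decomposition; this one
respects the involution (`exists_hermitian_equiv`). So Hermitian classes are compared by ordinary
equivalence.

Geometry supplies the dual bases on a possibly noncompact M: finitely many spanning sections by a
dimension count (`exists_spanning`), smooth coefficients by a partition of unity
(`exists_smoothFrame`), and coefficients that are inner products by Gram–Schmidt
(`SmoothFrame.exists_isParseval`). Over Γ^∞(End E) the same sections work, because ∑ αᵢ(sᵢ) is the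
rank of E, which is nonzero. -/

noncomputable section

namespace StarProd

open scoped Polynomial

/-! ### Formal series with coefficients in a module -/

section Series

variable {k : Type*} [CommRing k]
variable {X Y Z : Type*} [AddCommGroup X] [Module k X] [AddCommGroup Y] [Module k Y]
  [AddCommGroup Z] [Module k Z]

/-- Formal series `∑ xᵢ λⁱ` with coefficients in `X`. -/
def Ser (X : Type*) : Type _ := ℕ → X

namespace Ser

instance : AddCommGroup (Ser X) := inferInstanceAs (AddCommGroup (ℕ → X))

instance : Module k (Ser X) := inferInstanceAs (Module k (ℕ → X))

/-- The series with given coefficients. -/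
def mk {W : Type*} (f : ℕ → W) : Ser W := f

@[simp] theorem mk_apply {W : Type*} (f : ℕ → W) (n : ℕ) : mk f n = f n := rfl

@[ext] theorem ext {W : Type*} {f g : Ser W} (h : ∀ n, f n = g n) : f = g := funext h

@[simp] theorem add_apply (f g : Ser X) (n : ℕ) : (f + g) n = f n + g n := rfl
@[simp] theorem sub_apply (f g : Ser X) (n : ℕ) : (f - g) n = f n - g n := rfl
@[simp] theorem neg_apply (f : Ser X) (n : ℕ) : (-f) n = -f n := rfl
@[simp] theorem zero_apply (n : ℕ) : (0 : Ser X) n = 0 := rfl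
@[simp] theorem smul_apply (c : k) (f : Ser X) (n : ℕ) : (c • f) n = c • f n := rfl

@[simp] theorem sum_apply {ι : Type*} (s : Finset ι) (f : ι → Ser X) (n : ℕ) :
    (∑ i ∈ s, f i) n = ∑ i ∈ s, f i n :=
  map_sum (⟨⟨fun f : Ser X => f n, rfl⟩, fun _ _ => rfl⟩ : Ser X →+ X) f s

variable (k X) in
/-- Multiplication by `λ`. -/
def shift : Ser X →ₗ[k] Ser X where
  toFun f := mk fun n => Nat.casesOn n 0 f
  map_add' f g := by ext n; cases n <;> simp
  map_smul' c f := by ext n; cases n <;> simp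

@[simp] theorem shift_zero (f : Ser X) : shift k X f 0 = 0 := rfl
@[simp] theorem shift_succ (f : Ser X) (n : ℕ) : shift k X f (n + 1) = f n := rfl

instance instModulePolynomial : Module k[X] (Ser X) :=
  inferInstanceAs (Module k[X] (Module.AEval' (shift k X)))

instance instTower : IsScalarTower k k[X] (Ser X) :=
  inferInstanceAs (IsScalarTower k k[X] (Module.AEval' (shift k X)))

theorem X_smul (f : Ser X) : (Polynomial.X : k[X]) • f = shift k X f :=
  Module.AEval'.X_smul_of (shift k X) f

@[simp] theorem X_smul_zero (f : Ser X) : ((Polynomial.X : k[X]) • f) 0 = 0 := by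
  rw [X_smul]; rfl

@[simp] theorem X_smul_succ (f : Ser X) (n : ℕ) : ((Polynomial.X : k[X]) • f) (n + 1) = f n := by
  rw [X_smul]; rfl

/-- A `k`-linear map that commutes with `λ` is `k[λ]`-linear. -/
def mkLin {N : Type*} [AddCommGroup N] [Module k[X] N] [Module k N] [IsScalarTower k k[X] N]
    (φ : Ser X →ₗ[k] N)
    (h : ∀ f, φ (shift k X f) = (Polynomial.X : k[X]) • φ f) : Ser X →ₗ[k[X]] N :=
  LinearMap.ofAEval (M := Ser X) (shift k X) φ h

@[simp] theorem mkLin_apply {N : Type*} [AddCommGroup N] [Module k[X] N] [Module k N]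
    [IsScalarTower k k[X] N] (φ : Ser X →ₗ[k] N)
    (h : ∀ f, φ (shift k X f) = (Polynomial.X : k[X]) • φ f) (f : Ser X) :
    mkLin φ h f = φ f := rfl

/-- The constant series. -/
def const : X →+ Ser X where
  toFun x := mk fun n => Nat.casesOn n x fun _ => 0
  map_zero' := by ext n; cases n <;> rfl
  map_add' x y := by ext n; cases n <;> simp

@[simp] theorem const_zero (x : X) : const x 0 = x := rfl
@[simp] theorem const_succ (x : X) (n : ℕ) : const x (n + 1) = 0 := rfl

theorem const_smul (c : k) (x : X) : const (c • x) = c • const x := by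
  ext n; cases n <;> simp

variable (k) in
theorem eq_const_add (f : Ser X) :
    f = const (f 0) + (Polynomial.X : k[X]) • mk fun n => f (n + 1) := by
  ext n; cases n <;> simp

variable (k) in
theorem eq_X_smul (f : Ser X) (h : f 0 = 0) :
    f = (Polynomial.X : k[X]) • mk fun n => f (n + 1) := by
  ext n; cases n <;> simp [h]

end Ser

variable (k) in
/-- `λ`-torsion free and `λ`-adically separated modules. -/
class XSep (N : Type*) [AddCommGroup N] [Module k[X] N] : Prop where
  -- Separatedness as a coinduction principle: a property whose instances can be divided by λ
  -- without losing it holds only at 0. Later proofs only have to exhibit such a property.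
  coind : ∀ Q : N → Prop, (∀ y, Q y → ∃ z, Q z ∧ y = (Polynomial.X : k[X]) • z) → ∀ y, Q y → y = 0
  cancel : ∀ y z : N, (Polynomial.X : k[X]) • y = (Polynomial.X : k[X]) • z → y = z

instance : XSep k (Ser X) where
  coind Q h y hy := by
    ext n
    induction n generalizing y with
    | zero => obtain ⟨z, -, rfl⟩ := h y hy; simp
    | succ n ih => obtain ⟨z, hz, rfl⟩ := h y hy; simpa using ih z hz
  cancel y z h := by
    ext n
    simpa using congrFun h (n + 1)

instance {ι : Type*} {N : Type*} [AddCommGroup N] [Module k[X] N] [XSep k N] :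
    XSep k (ι → N) where
  coind Q h y hy := by
    ext i
    refine XSep.coind (k := k) (fun w => ∃ y, Q y ∧ y i = w) ?_ _ ⟨y, hy, rfl⟩
    rintro _ ⟨y, hy, rfl⟩
    obtain ⟨z, hz, rfl⟩ := h y hy
    exact ⟨z i, ⟨z, hz, rfl⟩, rfl⟩
  cancel y z h := by
    ext i
    exact XSep.cancel (k := k) _ _ (congrFun h i)

instance {m n : Type*} {N : Type*} [AddCommGroup N] [Module k[X] N] [XSep k N] :
    XSep k (Matrix m n N) := inferInstanceAs (XSep k (m → n → N))

instance {P : Type*} [AddCommGroup P] [Module k[X] P] {N : Type*} [AddCommGroup N]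
    [Module k[X] N] [XSep k N] : XSep k (P →ₗ[k[X]] N) where
  coind Q h y hy := by
    ext i
    refine XSep.coind (k := k) (fun w => ∃ y, Q y ∧ y i = w) ?_ _ ⟨y, hy, rfl⟩
    rintro _ ⟨y, hy, rfl⟩
    obtain ⟨z, hz, rfl⟩ := h y hy
    exact ⟨z i, ⟨z, hz, rfl⟩, rfl⟩
  cancel y z h := by
    ext i
    exact XSep.cancel (k := k) _ _ (LinearMap.congr_fun h i)

/-- Splitting off the constant term makes each value of φ - ψ equal to λ times another such value,
so separatedness forces 0. Hence k[λ]-linearity suffices and no λ-adic continuity has to be imposed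
on maps out of series. -/
theorem Ser.hom_ext {N : Type*} [AddCommGroup N] [Module k[X] N] [XSep k N]
    {φ ψ : Ser X →ₗ[k[X]] N} (h : ∀ x, φ (Ser.const x) = ψ (Ser.const x)) : φ = ψ := by
  refine LinearMap.ext fun f => sub_eq_zero.1 ?_
  refine XSep.coind (k := k) (fun w => ∃ f, φ f - ψ f = w) ?_ _ ⟨f, rfl⟩
  rintro _ ⟨f, rfl⟩
  refine ⟨_, ⟨Ser.mk fun n => f (n + 1), rfl⟩, ?_⟩
  conv_lhs => rw [Ser.eq_const_add k f]
  rw [map_add, map_add, h, map_smul, map_smul, smul_sub]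
  abel

namespace Ser

/-- The linear map `∑ xⱼ λʲ ↦ ∑ Tᵢ(xⱼ) λ^(i+j)` for fixed `T = ∑ Tᵢ λⁱ`. -/
def linAux (T : Ser (X →ₗ[k] Y)) : Ser X →ₗ[k[X]] Ser Y :=
  mkLin
    { toFun := fun f => mk fun n => ∑ p ∈ Finset.HasAntidiagonal.antidiagonal n, T p.1 (f p.2)
      map_add' := fun f g => by ext n; simp [Finset.sum_add_distrib]
      map_smul' := fun c f => by ext n; simp [Finset.smul_sum] }
    (fun f => by
      ext n
      rw [X_smul]
      cases n with
      | zero => simp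
      | succ n => simp [Finset.Nat.sum_antidiagonal_succ'])

theorem linAux_apply (T : Ser (X →ₗ[k] Y)) (f : Ser X) (n : ℕ) :
    linAux T f n = ∑ p ∈ Finset.HasAntidiagonal.antidiagonal n, T p.1 (f p.2) := rfl

/-- The linear map `∑ xⱼ λʲ ↦ ∑ Tᵢ(xⱼ) λ^(i+j)`, bilinear in `T = ∑ Tᵢ λⁱ` and `x`. -/
def lin : Ser (X →ₗ[k] Y) →ₗ[k[X]] Ser X →ₗ[k[X]] Ser Y :=
  mkLin
    { toFun := linAux
      map_add' := fun S T => LinearMap.ext fun f => Ser.ext fun n => by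
        simp [linAux_apply, Finset.sum_add_distrib]
      map_smul' := fun c T => LinearMap.ext fun f => Ser.ext fun n => by
        change _ = c • linAux T f n
        simp [linAux_apply, Finset.smul_sum] }
    (fun T => LinearMap.ext fun f => Ser.ext fun n => by
      rw [LinearMap.smul_apply]
      change linAux (shift k _ T) f n = ((Polynomial.X : k[X]) • linAux T f) n
      cases n with
      | zero => simp [linAux_apply]
      | succ n => simp [linAux_apply, Finset.Nat.sum_antidiagonal_succ])

theorem lin_apply (T : Ser (X →ₗ[k] Y)) (f : Ser X) (n : ℕ) :
    lin T f n = ∑ p ∈ Finset.HasAntidiagonal.antidiagonal n, T p.1 (f p.2) := rfl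

/-- The bilinear map `(∑ xᵢ λⁱ, ∑ yⱼ λʲ) ↦ ∑ Cᵣ(xᵢ, yⱼ) λ^(r+i+j)`. -/
def bil (C : Ser (X →ₗ[k] Y →ₗ[k] Z)) : Ser X →ₗ[k[X]] Ser Y →ₗ[k[X]] Ser Z :=
  lin ∘ₗ lin C

theorem bil_apply (C : Ser (X →ₗ[k] Y →ₗ[k] Z)) (f : Ser X) (g : Ser Y) (n : ℕ) :
    bil C f g n = ∑ p ∈ Finset.HasAntidiagonal.antidiagonal n, ∑ q ∈ Finset.HasAntidiagonal.antidiagonal p.2,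
      C p.1 (f q.1) (g q.2) := by
  simp only [bil, LinearMap.comp_apply, lin_apply, LinearMap.sum_apply]
  rw [Finset.sum_sigma', Finset.sum_sigma']
  refine Finset.sum_nbij' (fun ⟨⟨_, l⟩, ⟨i, j⟩⟩ => ⟨(i, j + l), (j, l)⟩)
    (fun ⟨⟨i, _⟩, ⟨j, l⟩⟩ => ⟨(i + j, l), (i, j)⟩) ?_ ?_ ?_ ?_ (fun _ _ => rfl) <;>
  · rintro ⟨⟨a, b⟩, ⟨c, d⟩⟩ h
    simp only [Finset.mem_sigma, Finset.HasAntidiagonal.mem_antidiagonal] at h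
    obtain ⟨h1, h2⟩ := h
    subst h2
    simp [← h1, add_assoc]

/-- The coefficientwise extension of a linear map. -/
def map (T : X →ₗ[k] Y) : Ser X →ₗ[k[X]] Ser Y :=
  mkLin
    { toFun := fun f => mk fun n => T (f n)
      map_add' := fun f g => by ext n; exact map_add T _ _
      map_smul' := fun c f => by ext n; exact map_smul T _ _ }
    (fun f => by
      ext n
      rw [X_smul]
      cases n with
      | zero => exact map_zero T
      | succ n => rfl)

@[simp] theorem map_apply (T : X →ₗ[k] Y) (f : Ser X) (n : ℕ) : map T f n = T (f n) := rfl

/-- The coefficients of a `k[λ]`-linear map. -/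
def coef (φ : Ser X →ₗ[k[X]] Ser Y) : Ser (X →ₗ[k] Y) := fun n =>
  { toFun := fun x => φ (const x) n
    map_add' := fun x y => by simp
    map_smul' := fun c x => by
      rw [const_smul, LinearMap.map_smul_of_tower]; rfl }

theorem coef_apply (φ : Ser X →ₗ[k[X]] Ser Y) (n : ℕ) (x : X) : coef φ n x = φ (const x) n := rfl

theorem lin_const (T : Ser (X →ₗ[k] Y)) (x : X) (n : ℕ) : lin T (const x) n = T n x := by
  rw [lin_apply, Finset.sum_eq_single (n, 0)]
  · simp
  · rintro ⟨i, j⟩ h hne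
    cases j with
    | zero => simp at h; simp [h] at hne
    | succ j => simp
  · simp

/-- Together with `lin_const` this identifies formal series of operators with k[λ]-linear maps, so
that coefficients can be forgotten until locality is compared at the end. -/
theorem lin_coef (φ : Ser X →ₗ[k[X]] Ser Y) : lin (coef φ) = φ :=
  hom_ext fun x => by ext n; rw [lin_const, coef_apply]

/-- The coefficients of a `k[λ]`-bilinear map. -/
def coef₂ (β : Ser X →ₗ[k[X]] Ser Y →ₗ[k[X]] Ser Z) : Ser (X →ₗ[k] Y →ₗ[k] Z) := fun n =>
  { toFun := fun x => coef (β (const x)) n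
    map_add' := fun x y => by ext z; simp [coef_apply]
    map_smul' := fun c x => by
      ext z
      rw [coef_apply, const_smul, LinearMap.map_smul_of_tower]; rfl }

theorem coef₂_apply (β : Ser X →ₗ[k[X]] Ser Y →ₗ[k[X]] Ser Z) (n : ℕ) (x : X) (y : Y) :
    coef₂ β n x y = β (const x) (const y) n := rfl

theorem bil_const (C : Ser (X →ₗ[k] Y →ₗ[k] Z)) (x : X) (y : Y) (n : ℕ) :
    bil C (const x) (const y) n = C n x y := by
  rw [bil, LinearMap.comp_apply, lin_const, lin_const]

theorem bil_coef₂ (β : Ser X →ₗ[k[X]] Ser Y →ₗ[k[X]] Ser Z) : bil (coef₂ β) = β :=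
  hom_ext fun x => hom_ext fun y => by ext n; rw [bil_const, coef₂_apply]

/-- A linear map is determined modulo `λ` by its values on constant series. -/
theorem apply_zero (φ : Ser X →ₗ[k[X]] Ser Y) (f : Ser X) : φ f 0 = φ (const (f 0)) 0 := by
  conv_lhs => rw [eq_const_add k f]
  simp

end Ser

end Series

/-! ### Local maps -/

/-- A family of subgroups of `X`, to be thought of as the elements of `X` that vanish on the
members of a family `𝓤` of sets. -/
class Van (𝓤 : Type*) (X : Type*) [AddCommGroup X] where
  van : 𝓤 → AddSubgroup X

section Local

variable {k : Type*} [CommRing k] {𝓤 : Type*}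
variable {X Y Z : Type*} [AddCommGroup X] [AddCommGroup Y] [AddCommGroup Z]

open Van

instance [Van 𝓤 X] : Van 𝓤 (Ser X) where
  van u :=
    { carrier := {f | ∀ n, f n ∈ van u}
      zero_mem' := fun _ => zero_mem _
      add_mem' := fun hf hg n => add_mem (hf n) (hg n)
      neg_mem' := fun hf n => neg_mem (hf n) }

instance {ι : Type*} [Van 𝓤 X] : Van 𝓤 (ι → X) where
  van u :=
    { carrier := {f | ∀ n, f n ∈ van u}
      zero_mem' := fun _ => zero_mem _
      add_mem' := fun hf hg n => add_mem (hf n) (hg n)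
      neg_mem' := fun hf n => neg_mem (hf n) }

instance {m n : Type*} [Van 𝓤 X] : Van 𝓤 (Matrix m n X) :=
  inferInstanceAs (Van 𝓤 (m → n → X))

theorem Ser.const_mem_van [Van 𝓤 X] {u : 𝓤} {x : X} (hx : x ∈ van u) : Ser.const x ∈ van u := by
  intro n
  cases n with
  | zero => exact hx
  | succ n => exact zero_mem _

variable [Van 𝓤 X] [Van 𝓤 Y] [Van 𝓤 Z]

variable (𝓤) in
/-- A map that preserves vanishing. -/
def IsLoc (φ : X → Y) : Prop := ∀ (u : 𝓤) (x : X), x ∈ van u → φ x ∈ van u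

variable (𝓤) in
/-- A map of two arguments that vanishes wherever one of the arguments does. -/
def IsLoc₂ (β : X → Y → Z) : Prop :=
  ∀ (u : 𝓤) (x : X) (y : Y), x ∈ van u ∨ y ∈ van u → β x y ∈ van u

variable [Module k X] [Module k Y] [Module k Z]

namespace Ser

theorem isLoc_lin {T : Ser (X →ₗ[k] Y)} (h : ∀ n, IsLoc 𝓤 (T n)) : IsLoc 𝓤 (lin T) := by
  intro u f hf n
  rw [lin_apply]
  exact sum_mem fun p _ => h _ _ _ (hf _)

theorem isLoc_lin_iff {T : Ser (X →ₗ[k] Y)} : IsLoc 𝓤 (lin T) ↔ ∀ n, IsLoc 𝓤 (T n) := by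
  refine ⟨fun h n u x hx => ?_, isLoc_lin⟩
  rw [← lin_const]
  exact h u _ (const_mem_van hx) n

theorem isLoc_map {T : X →ₗ[k] Y} (h : IsLoc 𝓤 T) : IsLoc 𝓤 (map T) :=
  fun u _ hf n => h u _ (hf n)

theorem isLoc₂_bil_iff {C : Ser (X →ₗ[k] Y →ₗ[k] Z)} :
    IsLoc₂ 𝓤 (fun f g => bil C f g) ↔ ∀ n, IsLoc₂ 𝓤 (fun x y => C n x y) := by
  refine ⟨fun h n u x y hxy => ?_, fun h u f g hfg n => ?_⟩
  · change C n x y ∈ _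
    rw [← bil_const]
    exact h u _ _ (hxy.imp const_mem_van const_mem_van) n
  · change bil C f g n ∈ _
    rw [bil_apply]
    exact sum_mem fun p _ => sum_mem fun q _ => h _ _ _ _ (hfg.imp (fun h => h _) fun h => h _)

/-- Neumann series: id - φ raises the λ-order, so ∑ (id - φ)^j is a finite sum in each coefficient,
and it is local because every power is. -/
theorem exists_inverse (φ : Ser X →ₗ[k[X]] Ser X) (h0 : ∀ f, φ f 0 = f 0) (hl : IsLoc 𝓤 φ) :
    ∃ ψ : Ser X →ₗ[k[X]] Ser X, IsLoc 𝓤 ψ ∧ (∀ f, ψ f 0 = f 0) ∧ (∀ f, ψ (φ f) = f) ∧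
      ∀ f, φ (ψ f) = f := by
  have key : ∀ φ : Ser X →ₗ[k[X]] Ser X, (∀ f, φ f 0 = f 0) → IsLoc 𝓤 φ →
      ∃ ψ : Ser X →ₗ[k[X]] Ser X, IsLoc 𝓤 ψ ∧ (∀ f, ψ f 0 = f 0) ∧ (∀ f, ψ (φ f) = f) := by
    intro φ h0 hl
    let N : Module.End k[X] (Ser X) := LinearMap.id - φ
    have hN : ∀ f, N f = f - φ f := fun f => rfl
    have hNl : ∀ j : ℕ, IsLoc 𝓤 (N ^ j : Module.End k[X] (Ser X)) := fun j => by
      induction j with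
      | zero => exact fun u x hx => hx
      | succ j ih =>
        intro u x hx
        rw [pow_succ]
        exact ih u _ (sub_mem hx (hl u _ hx))
    have hpow : ∀ (j n : ℕ) (f : Ser X), n < j → (N ^ j) f n = 0 := by
      intro j
      induction j with
      | zero => intro n f h; omega
      | succ j ih =>
        intro n f h
        rw [pow_succ, Module.End.mul_apply, eq_X_smul k (N f) (by rw [hN]; simp [h0]), map_smul]
        cases n with
        | zero => simp
        | succ n => rw [X_smul_succ]; exact ih _ _ (by omega)
    -- Truncation after j = n loses nothing in the n-th coefficient, since N^j f starts in order j.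
    let ψ : Ser X →ₗ[k[X]] Ser X := mkLin
      { toFun := fun f => mk fun n => ∑ j ∈ Finset.range (n + 1), (N ^ j) f n
        map_add' := fun f g => by ext n; simp [Finset.sum_add_distrib]
        map_smul' := fun c f => by ext n; simp [Finset.smul_sum, LinearMap.map_smul_of_tower] }
      (fun f => by
        ext n
        rw [← X_smul]
        simp only [LinearMap.coe_mk, AddHom.coe_mk, map_smul, mk_apply]
        cases n with
        | zero => simp
        | succ n =>
          rw [Finset.sum_range_succ]
          simp [hpow])
    have hψ : ∀ f n, ψ f n = ∑ j ∈ Finset.range (n + 1), (N ^ j) f n := fun _ _ => rfl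
    refine ⟨ψ, fun u f hf n => ?_, fun f => by simp [hψ], fun f => ?_⟩
    · rw [hψ]
      exact sum_mem fun j _ => hNl j u f hf n
    · ext n
      have : ∀ j : ℕ, (N ^ j) (φ f) n = (N ^ j) f n - (N ^ (j + 1)) f n := fun j => by
        rw [pow_succ, Module.End.mul_apply, hN, map_sub]; simp
      rw [hψ, Finset.sum_congr rfl fun j _ => this j, Finset.sum_range_sub', hpow (n + 1) n f (by omega)]
      simp
  obtain ⟨ψ, hψl, hψ0, hψ⟩ := key φ h0 hl
  -- The construction only gives left inverses. Applied to ψ it gives a left inverse of ψ, which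
  -- must be φ; hence ψ is also a right inverse of φ.
  obtain ⟨χ, -, -, hχ⟩ := key ψ hψ0 hψl
  refine ⟨ψ, hψl, hψ0, hψ, fun f => ?_⟩
  have : χ f = φ f := by rw [← hχ (φ f), hψ]
  rw [← hχ (φ (ψ f)), hψ, hχ]

end Ser

/-- If `e` is an idempotent that splits modulo `λ` as `ι ∘ g`, then it splits. -/
theorem exists_splitting {N : Type*} [AddCommGroup N] [Module k[X] N] [XSep k N] [Van 𝓤 N]
    (e : N →ₗ[k[X]] N) (ι : Ser X →ₗ[k[X]] N) (g : N →ₗ[k[X]] Ser X)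
    (he : ∀ y, e (e y) = e y) (h0 : ∀ x, g (e (ι x)) 0 = x 0)
    (h1 : ∀ y, ∃ w, e y - ι (g y) = (Polynomial.X : k[X]) • w)
    (le : IsLoc 𝓤 e) (lι : IsLoc 𝓤 ι) (lg : IsLoc 𝓤 g) :
    ∃ τ : Ser X →ₗ[k[X]] Ser X, IsLoc 𝓤 τ ∧ (∀ x, τ x 0 = x 0) ∧
      (∀ x, τ (g (e (ι x))) = x) ∧ (∀ x, g (e (ι (τ x))) = x) ∧
      ∀ y, e (ι (τ (g (e y)))) = e y := by
  -- The composite g ∘ e ∘ ι is the identity modulo λ; correcting by its inverse τ makes g and e ∘ ι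
  -- ∘ τ mutually inverse between the image of e and the series.
  obtain ⟨τ, lτ, hτ0, hτ1, hτ2⟩ := Ser.exists_inverse (𝓤 := 𝓤) (g ∘ₗ e ∘ₗ ι) h0
    fun u x hx => lg u _ (le u _ (lι u _ hx))
  refine ⟨τ, lτ, hτ0, hτ1, hτ2, fun y => sub_eq_zero.1 ?_⟩
  -- It remains that g is injective on the image of e. An element of the image killed by g is
  -- divisible by λ by `h1`, and the quotient has both properties again because λ can be cancelled.
  refine XSep.coind (k := k) (fun z => e z = z ∧ g z = 0) ?_ _ ⟨by simp [he], ?_⟩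
  · rintro z ⟨h2, h3⟩
    obtain ⟨w, hw⟩ := h1 z
    rw [h2, h3, map_zero, sub_zero] at hw
    refine ⟨w, ⟨?_, ?_⟩, hw⟩
    · refine XSep.cancel (k := k) _ _ ?_
      rw [← map_smul, ← hw, h2]
    · refine XSep.cancel (k := k) _ _ ?_
      rw [← map_smul, ← hw, h3, smul_zero]
  · rw [map_sub, sub_eq_zero]
    exact hτ2 _

end Local

/-! ### Lifting of idempotents -/

section Lift

variable (k : Type*) [CommRing k] (N : Type*) [AddCommGroup N] [Module k[X] N]

/-- `λ`-adic completeness, for sequences that converge at unit speed. -/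
class XComplete : Prop where
  exists_limit : ∀ p : ℕ → N,
    (∀ n, ∃ w, p (n + 1) - p n = (Polynomial.X ^ (n + 1) : k[X]) • w) →
    ∃ q, ∀ n, ∃ w, q - p n = (Polynomial.X ^ (n + 1) : k[X]) • w

variable {k N}

theorem XSep.eq_zero [XSep k N] {y : N} (h : ∀ n, ∃ w, y = (Polynomial.X ^ n : k[X]) • w) :
    y = 0 := by
  refine XSep.coind (k := k) (fun y => ∀ n, ∃ w, y = (Polynomial.X ^ n : k[X]) • w) ?_ _ h
  intro y h
  obtain ⟨z, hz⟩ := h 1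
  rw [pow_one] at hz
  refine ⟨z, fun n => ?_, hz⟩
  obtain ⟨w, hw⟩ := h (n + 1)
  refine ⟨w, XSep.cancel (k := k) _ _ ?_⟩
  rw [← hz, hw, pow_succ', mul_smul]

theorem Ser.exists_eq_X_pow_smul {X : Type*} [AddCommGroup X] [Module k X] {f : Ser X} {n : ℕ} :
    (∃ w, f = (Polynomial.X ^ n : k[X]) • w) ↔ ∀ m < n, f m = 0 := by
  induction n generalizing f with
  | zero => simp
  | succ n ih =>
    constructor
    · rintro ⟨w, rfl⟩ m hm
      rw [pow_succ', mul_smul]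
      cases m with
      | zero => simp
      | succ m => rw [X_smul_succ]; exact ih.1 ⟨w, rfl⟩ m (by omega)
    · intro h
      obtain ⟨w, hw⟩ := (ih (f := Ser.mk fun n => f (n + 1))).2 fun m hm => h (m + 1) (by omega)
      exact ⟨w, by rw [pow_succ', mul_smul, ← hw]; exact eq_X_smul k f (h 0 (by omega))⟩

instance {X : Type*} [AddCommGroup X] [Module k X] : XComplete k (Ser X) where
  exists_limit p h := by
    refine ⟨Ser.mk fun n => p n n, fun n => Ser.exists_eq_X_pow_smul.2 fun m hm => ?_⟩
    have h' : ∀ n m, m ≤ n → p (n + 1) m = p n m := fun n m hm =>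
      sub_eq_zero.1 (Ser.exists_eq_X_pow_smul.1 (h n) m (by omega))
    have : ∀ j, p (m + j) m = p m m := fun j => by
      induction j with
      | zero => rfl
      | succ j ih => rw [← add_assoc, h' _ _ (by omega), ih]
    obtain ⟨j, rfl⟩ := Nat.exists_eq_add_of_le (Nat.lt_succ_iff.1 hm)
    simp [this]

instance {ι : Type*} [XComplete k N] : XComplete k (ι → N) where
  exists_limit p h := by
    choose w hw using h
    choose q hq using fun i => XComplete.exists_limit (k := k) (fun n => p n i)
      fun n => ⟨w n i, congrFun (hw n) i⟩
    choose v hv using hq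
    exact ⟨q, fun n => ⟨fun i => v i n, funext fun i => hv i n⟩⟩

instance {m n : Type*} [XComplete k N] : XComplete k (Matrix m n N) :=
  inferInstanceAs (XComplete k (m → n → N))

/-- Newton iteration p ↦ 3p² - 2p³. Its convergence is quadratic, but one extra power of λ per step
is all that is used. An anti-automorphism fixing p₀ fixes every iterate, these being polynomials in
p₀, and hence the limit. -/
theorem exists_idempotent_lift {N : Type*} [NonUnitalRing N] [Module k[X] N]
    [IsScalarTower k[X] N N] [SMulCommClass k[X] N N] [XSep k N] [XComplete k N] (p₀ : N)
    (h : ∃ w, p₀ * p₀ - p₀ = (Polynomial.X : k[X]) • w) :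
    ∃ p : N, p * p = p ∧ (∃ w, p - p₀ = (Polynomial.X : k[X]) • w) ∧
      ∀ σ : N →+ N, (∀ y, σ ((Polynomial.X : k[X]) • y) = (Polynomial.X : k[X]) • σ y) →
        (∀ a b, σ (a * b) = σ b * σ a) → σ p₀ = p₀ → σ p = p := by
  let F : N → N := fun p => p * p + p * p + p * p - (p * p * p + p * p * p)
  have hF1 : ∀ p, F p - p = (p * p - p) - (p * (p * p - p) + p * (p * p - p)) := fun p => by
    simp only [F, mul_sub, mul_assoc]; abel
  -- With e = p² - p the new defect is e(4e² - 3e), which is quadratic in e.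
  have hF2 : ∀ p, F p * F p - F p = (p * p - p) * ((p * p - p) * (p * p - p) +
      (p * p - p) * (p * p - p) + (p * p - p) * (p * p - p) + (p * p - p) * (p * p - p) -
        ((p * p - p) + (p * p - p) + (p * p - p))) := fun p => by
    simp only [F, mul_sub, mul_add, sub_mul, add_mul, mul_assoc]; abel
  let q : ℕ → N := fun n => F^[n] p₀
  have hq : ∀ n, q (n + 1) = F (q n) := fun n => Function.iterate_succ_apply' F n p₀
  have hd : ∀ n, ∃ w, q n * q n - q n = (Polynomial.X ^ (n + 1) : k[X]) • w := by
    intro n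
    induction n with
    | zero => simpa [q] using h
    | succ n ih =>
      obtain ⟨w, hw⟩ := ih
      rw [hq, hF2, hw]
      refine ⟨(Polynomial.X ^ n : k[X]) • (w * (((Polynomial.X ^ (n + 1) : k[X]) • (w * w) +
        (Polynomial.X ^ (n + 1) : k[X]) • (w * w) + (Polynomial.X ^ (n + 1) : k[X]) • (w * w) +
        (Polynomial.X ^ (n + 1) : k[X]) • (w * w)) - (w + w + w))), ?_⟩
      simp only [mul_sub, mul_add, smul_add, smul_sub, smul_mul_assoc, mul_smul_comm, smul_smul,
        ← pow_add]
      ring_nf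
  obtain ⟨p, hp⟩ := XComplete.exists_limit (k := k) q fun n => by
    obtain ⟨w, hw⟩ := hd n
    rw [hq, hF1, hw]
    exact ⟨w - (q n * w + q n * w), by simp only [smul_sub, smul_add, mul_smul_comm]⟩
  refine ⟨p, ?_, by simpa [q] using hp 0, fun σ hσ hσm hσ0 => ?_⟩
  · refine sub_eq_zero.1 (XSep.eq_zero (k := k) fun n => ?_)
    obtain ⟨w, hw⟩ := hp n
    obtain ⟨v, hv⟩ := hd n
    rw [sub_eq_iff_eq_add] at hw
    refine ⟨(Polynomial.X : k[X]) • (w * p + q n * w + v - w), ?_⟩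
    have : p * p - p = (p - q n) * p + q n * (p - q n) + (q n * q n - q n) - (p - q n) := by
      simp only [sub_mul, mul_sub]; abel
    rw [this, hv, sub_eq_iff_eq_add.2 hw]
    simp only [smul_sub, smul_add, mul_smul_comm, smul_mul_assoc, smul_smul, ← pow_succ]
  · have hσq : ∀ n, σ (q n) = q n := fun n => by
      induction n with
      | zero => exact hσ0
      | succ n ih => rw [hq]; simp only [F, map_sub, map_add, hσm, ih, mul_assoc]
    have hσX : ∀ n y, σ ((Polynomial.X ^ n : k[X]) • y) = (Polynomial.X ^ n : k[X]) • σ y := by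
      intro n y
      induction n with
      | zero => simp
      | succ n ih => rw [pow_succ', mul_smul, hσ, ih, mul_smul]
    refine sub_eq_zero.1 (XSep.eq_zero (k := k) fun n => ?_)
    obtain ⟨w, hw⟩ := hp n
    refine ⟨(Polynomial.X : k[X]) • (σ w - w), ?_⟩
    have : σ p - p = σ (p - q n) - (p - q n) := by rw [map_sub, hσq]; abel
    rw [this, hw, hσX, smul_smul, ← pow_succ, smul_sub]

end Lift

/-! ### Formal products on series -/

section Products

variable {k A : Type*} [CommRing k] [Ring A] [Algebra k A]

/-- Power series over `A`, as series in the module `A`. -/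
def toSer (f : A⟦X⟧) : Ser A := Ser.mk fun n => PowerSeries.coeff n f

@[simp] theorem toSer_apply (f : A⟦X⟧) (n : ℕ) : toSer f n = PowerSeries.coeff n f := rfl

/-- A series in the module `A`, as a power series. -/
def ofSer (f : Ser A) : A⟦X⟧ := PowerSeries.mk f

@[simp] theorem toSer_ofSer (f : Ser A) : toSer (ofSer f) = f := by
  ext n; exact PowerSeries.coeff_mk _ _

@[simp] theorem ofSer_toSer (f : A⟦X⟧) : ofSer (toSer f) = f := by
  ext n; exact PowerSeries.coeff_mk _ _

theorem toSer_injective : Function.Injective (toSer : A⟦X⟧ → Ser A) :=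
  Function.LeftInverse.injective ofSer_toSer

namespace FormalProduct

/-- The product of a formal product, as a bilinear map on series. -/
def mul (D : FormalProduct k A) : Ser A →ₗ[k[X]] Ser A →ₗ[k[X]] Ser A := Ser.bil (Ser.mk D.cochain)

theorem toSer_star (D : FormalProduct k A) (f g : A⟦X⟧) :
    toSer (D.star f g) = D.mul (toSer f) (toSer g) := by
  ext n
  simp only [toSer_apply, star, formalProd, PowerSeries.coeff_mk, mul, Ser.bil_apply, Ser.mk_apply]

theorem mul_assoc (D : FormalProduct k A) (f g h : Ser A) :
    D.mul (D.mul f g) h = D.mul f (D.mul g h) := by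
  rw [← toSer_ofSer f, ← toSer_ofSer g, ← toSer_ofSer h]
  simp only [← toSer_star]
  exact congrArg toSer (D.assoc _ _ _)

theorem mul_zero_coeff (D : FormalProduct k A) (f g : Ser A) :
    D.mul f g 0 = f 0 * g 0 := by
  rw [mul, Ser.bil_apply]
  simp [D.cochain_zero]

theorem mul_const (D : FormalProduct k A) (a b : A) (n : ℕ) :
    D.mul (Ser.const a) (Ser.const b) n = D.cochain n a b := Ser.bil_const _ _ _ _

/-- The formal product given by an associative bilinear map on series. -/
def ofBil (β : Ser A →ₗ[k[X]] Ser A →ₗ[k[X]] Ser A)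
    (h0 : ∀ a b, β (Ser.const a) (Ser.const b) 0 = a * b)
    (hβ : ∀ f g h, β (β f g) h = β f (β g h)) : FormalProduct k A where
  cochain := Ser.coef₂ β
  cochain_zero := h0
  assoc f g h := by
    have key : ∀ f g : A⟦X⟧, toSer (formalProd (Ser.coef₂ β) f g) = β (toSer f) (toSer g) := by
      intro f g
      conv_rhs => rw [← Ser.bil_coef₂ β]
      ext n
      rw [Ser.bil_apply]
      exact PowerSeries.coeff_mk _ _
    apply toSer_injective
    rw [key, key, key, key, hβ]

@[simp] theorem mul_ofBil (β : Ser A →ₗ[k[X]] Ser A →ₗ[k[X]] Ser A)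
    (h0 : ∀ a b, β (Ser.const a) (Ser.const b) 0 = a * b)
    (hβ : ∀ f g h, β (β f g) h = β f (β g h)) : (ofBil β h0 hβ).mul = β :=
  Ser.bil_coef₂ β

/-- The opposite of a formal product on a commutative algebra. -/
def op {A : Type*} [CommRing A] [Algebra k A] (D : FormalProduct k A) : FormalProduct k A :=
  ofBil D.mul.flip (fun a b => by
      change D.mul (Ser.const b) (Ser.const a) 0 = _
      rw [D.mul_zero_coeff, mul_comm]; rfl)
    (fun f g h => by simpa only [LinearMap.flip_apply] using (D.mul_assoc h g f).symm)

@[simp] theorem mul_op {A : Type*} [CommRing A] [Algebra k A] (D : FormalProduct k A)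
    (f g : Ser A) : D.op.mul f g = D.mul g f := by
  rw [op, mul_ofBil]; rfl

/-- The ring structure on series given by a formal product. -/
abbrev nonUnitalRing (D : FormalProduct k A) : NonUnitalRing (Ser A) where
  mul f g := D.mul f g
  left_distrib f g h := map_add _ _ _
  right_distrib f g h := by change D.mul _ _ = D.mul _ _ + D.mul _ _; simp
  zero_mul f := by change D.mul _ _ = _; simp
  mul_zero f := map_zero _
  mul_assoc := D.mul_assoc

variable {n : ℕ}

/-- The product of matrices over a formal product. -/
def matMul (D : FormalProduct k A) : Matrix (Fin n) (Fin n) (Ser A) →ₗ[k[X]]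
    Matrix (Fin n) (Fin n) (Ser A) →ₗ[k[X]] Matrix (Fin n) (Fin n) (Ser A) :=
  LinearMap.mk₂ _ (fun P Q => Matrix.of fun i j => ∑ l, D.mul (P i l) (Q l j))
    (fun P Q R => by ext1 i j; simp [Finset.sum_add_distrib])
    (fun c P Q => by ext1 i j; simp [Finset.smul_sum])
    (fun P Q R => by ext1 i j; simp [Finset.sum_add_distrib])
    (fun c P Q => by ext1 i j; simp [Finset.smul_sum])

theorem matMul_apply (D : FormalProduct k A) (P Q : Matrix (Fin n) (Fin n) (Ser A)) (i j : Fin n) :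
    D.matMul P Q i j = ∑ l, D.mul (P i l) (Q l j) := rfl

/-- The product of rows with matrices over a formal product. -/
def rowMul (D : FormalProduct k A) : (Fin n → Ser A) →ₗ[k[X]]
    Matrix (Fin n) (Fin n) (Ser A) →ₗ[k[X]] (Fin n → Ser A) :=
  LinearMap.mk₂ _ (fun y Q j => ∑ l, D.mul (y l) (Q l j))
    (fun P Q R => by ext1 j; simp [Finset.sum_add_distrib])
    (fun c P Q => by ext1 j; simp [Finset.smul_sum])
    (fun P Q R => by ext1 j; simp [Finset.sum_add_distrib])
    (fun c P Q => by ext1 j; simp [Finset.smul_sum])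

theorem rowMul_apply (D : FormalProduct k A) (y : Fin n → Ser A)
    (Q : Matrix (Fin n) (Fin n) (Ser A)) (j : Fin n) :
    D.rowMul y Q j = ∑ l, D.mul (y l) (Q l j) := rfl

/-- The scalar product of series with rows of series. -/
def smulRow (D : FormalProduct k A) : Ser A →ₗ[k[X]] (Fin n → Ser A) →ₗ[k[X]] (Fin n → Ser A) :=
  LinearMap.mk₂ _ (fun a y j => D.mul a (y j))
    (fun P Q R => by ext1 j; simp) (fun c P Q => by ext1 j; simp)
    (fun P Q R => by ext1 j; simp) (fun c P Q => by ext1 j; simp)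

theorem smulRow_apply (D : FormalProduct k A) (a : Ser A) (y : Fin n → Ser A) (j : Fin n) :
    D.smulRow a y j = D.mul a (y j) := rfl

theorem matMul_assoc (D : FormalProduct k A) (P Q R : Matrix (Fin n) (Fin n) (Ser A)) :
    D.matMul (D.matMul P Q) R = D.matMul P (D.matMul Q R) := by
  ext1 i j
  simp only [matMul_apply, map_sum, LinearMap.sum_apply, D.mul_assoc]
  exact Finset.sum_comm

theorem rowMul_matMul (D : FormalProduct k A) (y : Fin n → Ser A)
    (Q R : Matrix (Fin n) (Fin n) (Ser A)) :
    D.rowMul y (D.matMul Q R) = D.rowMul (D.rowMul y Q) R := by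
  ext1 j
  simp only [matMul_apply, rowMul_apply, map_sum, LinearMap.sum_apply, D.mul_assoc]
  exact Finset.sum_comm

theorem smulRow_rowMul (D : FormalProduct k A) (a : Ser A) (y : Fin n → Ser A)
    (Q : Matrix (Fin n) (Fin n) (Ser A)) :
    D.rowMul (D.smulRow a y) Q = D.smulRow a (D.rowMul y Q) := by
  ext1 j
  simp only [smulRow_apply, rowMul_apply, map_sum, D.mul_assoc]

theorem smulRow_mul (D : FormalProduct k A) (a b : Ser A) (y : Fin n → Ser A) :
    D.smulRow (D.mul a b) y = D.smulRow a (D.smulRow b y) := by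
  ext1 j
  simp only [smulRow_apply, D.mul_assoc]

section Loc

variable {𝓤 : Type*} [Van 𝓤 A]

theorem isLoc₂_matMul {D : FormalProduct k A} (hD : IsLoc₂ 𝓤 fun f g => D.mul f g) :
    IsLoc₂ 𝓤 fun P Q : Matrix (Fin n) (Fin n) (Ser A) => D.matMul P Q :=
  fun u P Q h i j => by
    change ∑ l, D.mul (P i l) (Q l j) ∈ Van.van u
    exact sum_mem fun l _ => hD u _ _ (h.imp (fun h => h i l) fun h => h l j)

theorem isLoc₂_rowMul {D : FormalProduct k A} (hD : IsLoc₂ 𝓤 fun f g => D.mul f g) :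
    IsLoc₂ 𝓤 fun (y : Fin n → Ser A) (Q : Matrix (Fin n) (Fin n) (Ser A)) => D.rowMul y Q :=
  fun u y Q h j => by
    change ∑ l, D.mul (y l) (Q l j) ∈ Van.van u
    exact sum_mem fun l _ => hD u _ _ (h.imp (fun h => h l) fun h => h l j)

theorem isLoc₂_smulRow {D : FormalProduct k A} (hD : IsLoc₂ 𝓤 fun f g => D.mul f g) :
    IsLoc₂ 𝓤 fun (a : Ser A) (y : Fin n → Ser A) => D.smulRow a y :=
  fun u _ _ h j => hD u _ _ (h.imp id fun h => h j)

end Loc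

/-- Idempotent matrices lift to idempotent matrices for a formal product, and the lift can be
taken invariant under the anti-automorphisms that fix the given matrix. -/
theorem exists_matMul_idempotent (D : FormalProduct k A) (q : Matrix (Fin n) (Fin n) A)
    (hq : q * q = q) :
    ∃ P : Matrix (Fin n) (Fin n) (Ser A), D.matMul P P = P ∧ (∀ i j, P i j 0 = q i j) ∧
      ∀ σ : Ser A →+ Ser A,
        (∀ y, σ ((Polynomial.X : k[X]) • y) = (Polynomial.X : k[X]) • σ y) →
        (∀ a b, σ (D.mul a b) = D.mul (σ b) (σ a)) →
        (∀ i j, σ (Ser.const (q j i)) = Ser.const (q i j)) → ∀ i j, σ (P j i) = P i j := by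
  let _ := D.nonUnitalRing
  have _ : IsScalarTower k[X] (Ser A) (Ser A) :=
    ⟨fun c a b => by change D.mul _ _ = _ • D.mul _ _; simp⟩
  have _ : SMulCommClass k[X] (Ser A) (Ser A) :=
    ⟨fun c a b => by change _ • D.mul _ _ = D.mul _ _; simp⟩
  have hmul : ∀ P Q : Matrix (Fin n) (Fin n) (Ser A), P * Q = D.matMul P Q := fun P Q => rfl
  let Q : Matrix (Fin n) (Fin n) (Ser A) := Matrix.of fun i j => Ser.const (q i j)
  obtain ⟨P, hP, ⟨w, hw⟩, hσ⟩ := exists_idempotent_lift (k := k) Q (by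
      refine ⟨Matrix.of fun i j => Ser.mk fun m => (D.matMul Q Q i j - Q i j) (m + 1), ?_⟩
      ext1 i j
      refine Ser.eq_X_smul k (D.matMul Q Q i j - Q i j) ?_
      rw [matMul_apply, Ser.sub_apply, Ser.sum_apply]
      simp only [mul_zero_coeff, Q, Matrix.of_apply, Ser.const_zero]
      rw [sub_eq_zero, ← Matrix.mul_apply, hq])
  refine ⟨P, hP, fun i j => ?_, fun σ h1 h2 h3 i j => ?_⟩
  · have := congrFun (congrFun (congrFun hw i) j) 0
    rw [Matrix.sub_apply, Ser.sub_apply, Matrix.smul_apply, Ser.X_smul_zero] at this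
    exact sub_eq_zero.1 this
  -- Applying σ entrywise reverses products of entries, so it must be combined with transposition to
  -- become an anti-automorphism of the matrices.
  · have := hσ ⟨⟨fun P => Matrix.of fun i j => σ (P j i), by ext1 i j; exact map_zero σ⟩,
        fun P Q => by ext1 i j; exact map_add σ _ _⟩ (fun P => by ext1 i j; exact h1 _)
      (fun P Q => by
        ext1 i j
        change σ (∑ l, D.mul (P j l) (Q l i)) = ∑ l, D.mul (σ (Q l i)) (σ (P j l))
        rw [map_sum]
        exact Finset.sum_congr rfl fun l _ => h2 _ _) (by ext1 i j; exact h3 i j)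
    exact congrFun (congrFun this i) j

end FormalProduct

end Products

/-! ### Formal deformations of bimodules -/

section Bimodules

open Van

variable {k : Type*} [CommRing k] {𝓤 R S E : Type*} [Ring R] [Algebra k R] [Ring S] [Algebra k S]
  [AddCommGroup E] [Module k E] [Van 𝓤 R] [Van 𝓤 S] [Van 𝓤 E]

variable (k 𝓤 R S E) in
/-- Two commuting faithful local actions on `E`. -/
structure Bimod where
  aR : R →ₗ[k] E →ₗ[k] E
  aS : S →ₗ[k] E →ₗ[k] E
  aR_mul : ∀ r r' x, aR (r * r') x = aR r (aR r' x)
  aS_mul : ∀ s s' x, aS (s * s') x = aS s (aS s' x)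
  comm : ∀ r s x, aR r (aS s x) = aS s (aR r x)
  aR_loc : IsLoc₂ 𝓤 fun r x => aR r x
  aS_loc : IsLoc₂ 𝓤 fun s x => aS s x
  aR_faith : ∀ r, (∀ x, aR r x = 0) → r = 0
  aS_faith : ∀ s, (∀ x, aS s x = 0) → s = 0

/-- The two actions, interchanged. -/
def Bimod.swap (b : Bimod k 𝓤 R S E) : Bimod k 𝓤 S R E :=
  ⟨b.aS, b.aR, b.aS_mul, b.aR_mul, fun s r x => (b.comm r s x).symm, b.aS_loc, b.aR_loc,
    b.aS_faith, b.aR_faith⟩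

/-- A finite dual basis `(xᵢ, ξᵢ)` of the `R`-module `E`, with the elements `ηᵢ(y)` of `S` that act
as `ξᵢ(·) y`. -/
structure DualBasis (b : Bimod k 𝓤 R S E) where
  n : ℕ
  x : Fin n → E
  ξ : Fin n → E →ₗ[k] R
  η : Fin n → E →ₗ[k] S
  ξ_loc : ∀ i, IsLoc 𝓤 (ξ i)
  η_loc : ∀ i, IsLoc 𝓤 (η i)
  compat : ∀ i y z, b.aS (η i y) z = b.aR (ξ i z) y
  sum : ∀ y, ∑ i, b.aR (ξ i y) (x i) = y

/-- A formal deformation `l` of the action `a`, for a formal product on `R`. -/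
structure IsAct (𝓤 : Type*) [Van 𝓤 R] [Van 𝓤 E] (D : FormalProduct k R) (a : R →ₗ[k] E →ₗ[k] E)
    (l : Ser R →ₗ[k[X]] Ser E →ₗ[k[X]] Ser E) : Prop where
  loc : IsLoc₂ 𝓤 fun r x => l r x
  red : ∀ r x, l r x 0 = a (r 0) (x 0)
  mul : ∀ r r' x, l (D.mul r r') x = l r (l r' x)

/-- The bimodule `E` deforms to a bimodule for the formal products `D` and `D'`. -/
def Bimod.Deforms (b : Bimod k 𝓤 R S E) (D : FormalProduct k R) (D' : FormalProduct k S) : Prop :=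
  ∃ l s, IsAct 𝓤 D b.aR l ∧ IsAct 𝓤 D' b.aS s ∧ ∀ r f x, l r (s f x) = s f (l r x)

theorem Bimod.Deforms.swap {b : Bimod k 𝓤 R S E} {D : FormalProduct k R} {D' : FormalProduct k S}
    (h : b.Deforms D D') : b.swap.Deforms D' D := by
  obtain ⟨l, s, hl, hs, hc⟩ := h
  exact ⟨s, l, hs, hl, fun r f x => (hc f r x).symm⟩

variable (𝓤) in
/-- Equivalence of formal products through local maps. -/
def EquivLoc (D D' : FormalProduct k R) : Prop :=
  ∃ φ : Ser R →ₗ[k[X]] Ser R, IsLoc 𝓤 φ ∧ (∀ f, φ f 0 = f 0) ∧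
    ∀ f g, φ (D.mul f g) = D'.mul (φ f) (φ g)

theorem EquivLoc.symm {D D' : FormalProduct k R} (h : EquivLoc 𝓤 D D') : EquivLoc 𝓤 D' D := by
  obtain ⟨φ, l, h0, hm⟩ := h
  obtain ⟨ψ, hl, h0', h1, h2⟩ := Ser.exists_inverse φ h0 l
  refine ⟨ψ, hl, h0', fun f g => ?_⟩
  conv_lhs => rw [← h2 f, ← h2 g, ← hm, h1]

/-- Restriction of the deformed action along the equivalence. -/
theorem Bimod.Deforms.congr_left {b : Bimod k 𝓤 R S E} {D₁ D₂ : FormalProduct k R}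
    {D' : FormalProduct k S} (h : b.Deforms D₂ D') (e : EquivLoc 𝓤 D₁ D₂) : b.Deforms D₁ D' := by
  obtain ⟨l, s, hl, hs, hc⟩ := h
  obtain ⟨φ, lφ, h0, hm⟩ := e
  refine ⟨l ∘ₗ φ, s, ⟨fun u r x h => hl.loc u _ _ (h.imp (lφ u _) id), fun r x => ?_,
    fun r r' x => ?_⟩, hs, fun r => hc _⟩
  · rw [LinearMap.comp_apply, hl.red, h0]
  · simp only [LinearMap.comp_apply, hm, hl.mul]

namespace DualBasis

variable {b : Bimod k 𝓤 R S E} (B : DualBasis b)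

/-- Linearity over R need not be assumed: x ↦ ξᵢ(x) y is the action of ηᵢ(y), which commutes with R,
and R acts faithfully. -/
theorem ξ_smul (i : Fin B.n) (r : R) (x : E) : B.ξ i (b.aR r x) = r * B.ξ i x := by
  refine sub_eq_zero.1 (b.aR_faith _ fun y => ?_)
  rw [map_sub, LinearMap.sub_apply, b.aR_mul, ← B.compat, ← B.compat, b.comm, sub_self]

theorem sum_ξ_mul (j : Fin B.n) (s : S) (y : E) :
    ∑ l, B.ξ l y * B.ξ j (b.aS s (B.x l)) = B.ξ j (b.aS s y) := by
  simp only [← B.ξ_smul, ← map_sum, b.comm, B.sum]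

theorem sum_ξ_mul' (j : Fin B.n) (y : E) : ∑ l, B.ξ l y * B.ξ j (B.x l) = B.ξ j y := by
  simp only [← B.ξ_smul, ← map_sum, B.sum]

/-- The sum acts on y as ∑ ξᵢ(y) s xᵢ = s y, and S acts faithfully. Thus s is recovered from its
values on the dual basis, which is what later lets operators be read back as elements of S. -/
theorem sum_η (s : S) : ∑ i, B.η i (b.aS s (B.x i)) = s := by
  refine sub_eq_zero.1 (b.aS_faith _ fun y => ?_)
  rw [map_sub, map_sum, LinearMap.sub_apply, LinearMap.sum_apply]
  simp only [B.compat, b.comm, ← map_sum, B.sum, sub_self]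

/-- The coordinate map `E⟦λ⟧ → R⟦λ⟧ⁿ`. -/
def coord : Ser E →ₗ[k[X]] (Fin B.n → Ser R) := LinearMap.pi fun i => Ser.map (B.ξ i)

theorem coord_apply (x : Ser E) (i : Fin B.n) (m : ℕ) : B.coord x i m = B.ξ i (x m) := rfl

theorem isLoc_coord : IsLoc 𝓤 B.coord := fun u _ hx i => Ser.isLoc_map (B.ξ_loc i) u _ hx

/-- The matrix of the projection of `Rⁿ` onto `E`. -/
def proj : Matrix (Fin B.n) (Fin B.n) R := Matrix.of fun i j => B.ξ j (B.x i)

theorem proj_mul_proj : B.proj * B.proj = B.proj := by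
  ext i j
  simp only [Matrix.mul_apply, proj, Matrix.of_apply, B.sum_ξ_mul']

end DualBasis

theorem exists_eq_X_smul_row {n : ℕ} {Y : Type*} [AddCommGroup Y] [Module k Y] (y : Fin n → Ser Y)
    (h : ∀ i, y i 0 = 0) : ∃ w, y = (Polynomial.X : k[X]) • w :=
  ⟨fun i => Ser.mk fun m => y i (m + 1), funext fun i => Ser.eq_X_smul k _ (h i)⟩

theorem exists_eq_X_smul_matrix {n : ℕ} {Y : Type*} [AddCommGroup Y] [Module k Y]
    (y : Matrix (Fin n) (Fin n) (Ser Y)) (h : ∀ i j, y i j 0 = 0) :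
    ∃ w, y = (Polynomial.X : k[X]) • w :=
  ⟨Matrix.of fun i j => Ser.mk fun m => y i j (m + 1), by
    ext1 i j; exact Ser.eq_X_smul k _ (h i j)⟩

theorem exists_eq_X_smul_hom {X Y : Type*} [AddCommGroup X] [Module k X] [AddCommGroup Y]
    [Module k Y] (φ : Ser X →ₗ[k[X]] Ser Y) (h : ∀ f, φ f 0 = 0) :
    ∃ ψ : Ser X →ₗ[k[X]] Ser Y, φ = (Polynomial.X : k[X]) • ψ := by
  refine ⟨Ser.lin (Ser.mk fun n => Ser.coef φ (n + 1)), ?_⟩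
  rw [← map_smul, ← Ser.eq_X_smul k (Ser.coef φ) (LinearMap.ext fun x => h _), Ser.lin_coef]

namespace DualBasis

variable {b : Bimod k 𝓤 R S E} (B : DualBasis b)

/-! ### Deformed coordinates: E⟦λ⟧ as the rows fixed by P. -/

section RowSplitting

variable {D : FormalProduct k R} (hD : IsLoc₂ 𝓤 fun f g => D.mul f g)
  {P : Matrix (Fin B.n) (Fin B.n) (Ser R)} (hP : D.matMul P P = P)
  (hP0 : ∀ i j, P i j 0 = B.proj i j)

include hD hP hP0

/-- Right multiplication of rows by P is an idempotent which modulo λ is the projection of Rⁿ onto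
E, so `exists_splitting` applies. The map g may be any local lift of (yᵢ) ↦ ∑ yᵢ xᵢ: this freedom
serves both a given deformed action (`exists_lift`) and the classical action (`deforms_corner`). -/
theorem exists_row_splitting (g : (Fin B.n → Ser R) →ₗ[k[X]] Ser E) (lg : IsLoc 𝓤 g)
    (hg : ∀ y, g y 0 = ∑ i, b.aR (y i 0) (B.x i)) :
    ∃ Ξ : Ser E →ₗ[k[X]] (Fin B.n → Ser R), IsLoc 𝓤 Ξ ∧ (∀ x i, Ξ x i 0 = B.ξ i (x 0)) ∧
      (∀ x, D.rowMul (Ξ x) P = Ξ x) ∧ (∀ x, g (Ξ x) = x) ∧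
      ∀ y, D.rowMul y P = y → Ξ (g y) = y := by
  have h0 : ∀ y i, D.rowMul y P i 0 = B.ξ i (∑ l, b.aR (y l 0) (B.x l)) := fun y i => by
    rw [D.rowMul_apply, Ser.sum_apply, map_sum]
    exact Finset.sum_congr rfl fun l _ => by rw [D.mul_zero_coeff, hP0, B.ξ_smul]; rfl
  have hidem : ∀ y, D.rowMul (D.rowMul y P) P = D.rowMul y P := fun y => by
    rw [← D.rowMul_matMul, hP]
  obtain ⟨τ, lτ, hτ0, hτ1, hτ2, hτ3⟩ := exists_splitting (𝓤 := 𝓤) (D.rowMul.flip P) B.coord g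
    hidem
    (fun x => by
      rw [hg]
      simp only [LinearMap.flip_apply, h0, B.coord_apply, B.sum])
    (fun y => exists_eq_X_smul_row _ fun i => by
      rw [Pi.sub_apply, Ser.sub_apply, LinearMap.flip_apply, h0, B.coord_apply, hg, sub_self])
    (fun u y hy => FormalProduct.isLoc₂_rowMul hD u _ _ (Or.inl hy)) B.isLoc_coord lg
  refine ⟨D.rowMul.flip P ∘ₗ B.coord ∘ₗ τ, fun u x hx =>
    FormalProduct.isLoc₂_rowMul hD u _ _ (Or.inl (B.isLoc_coord u _ (lτ u _ hx))), fun x i => ?_,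
    fun x => hidem _, hτ2, fun y hy => ?_⟩
  · simp only [LinearMap.comp_apply, LinearMap.flip_apply, h0, B.coord_apply, B.sum, hτ0]
  · have := hτ3 y
    simpa only [LinearMap.comp_apply, LinearMap.flip_apply, hy] using this

end RowSplitting

/-- The coordinates of a dual basis lift to any deformation of the module. -/
theorem exists_lift {D : FormalProduct k R} (hD : IsLoc₂ 𝓤 fun f g => D.mul f g)
    {l : Ser R →ₗ[k[X]] Ser E →ₗ[k[X]] Ser E} (hl : IsAct 𝓤 D b.aR l) :
    ∃ Ξ : Ser E →ₗ[k[X]] (Fin B.n → Ser R), IsLoc 𝓤 Ξ ∧ (∀ x i, Ξ x i 0 = B.ξ i (x 0)) ∧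
      (∀ x, ∑ i, l (Ξ x i) (Ser.const (B.x i)) = x) ∧
      ∀ r x, Ξ (l r x) = D.smulRow r (Ξ x) := by
  obtain ⟨P, hP, hP0, -⟩ := D.exists_matMul_idempotent B.proj B.proj_mul_proj
  let g : (Fin B.n → Ser R) →ₗ[k[X]] Ser E :=
    ∑ i, l.flip (Ser.const (B.x i)) ∘ₗ LinearMap.proj i
  have hg : ∀ y, g y = ∑ i, l (y i) (Ser.const (B.x i)) := fun y => by simp [g]
  obtain ⟨Ξ, h1, h2, h3, h4, h5⟩ := B.exists_row_splitting hD hP hP0 g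
    (fun u y hy => by
      rw [hg]
      exact sum_mem fun i _ => hl.loc u _ _ (Or.inl (hy i)))
    (fun y => by simp [hg, hl.red])
  refine ⟨Ξ, h1, h2, fun x => by rw [← hg, h4], fun r x => ?_⟩
  -- Both sides lie among the rows fixed by P, where g is injective, so linearity can be checked
  -- after applying g.
  rw [← h5 (D.smulRow r (Ξ x)) (by rw [D.smulRow_rowMul, h3]), hg]
  congr 1
  conv_lhs => rw [← h4 x, hg, map_sum]
  exact Finset.sum_congr rfl fun i _ => (hl.mul _ _ _).symm

/-- Every endomorphism of a deformed module is given by the action of a deformation of `S`. -/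
theorem exists_commutant {D : FormalProduct k R} (hD : IsLoc₂ 𝓤 fun f g => D.mul f g)
    {l : Ser R →ₗ[k[X]] Ser E →ₗ[k[X]] Ser E} (hl : IsAct 𝓤 D b.aR l)
    {s : Ser S →ₗ[k[X]] Ser E →ₗ[k[X]] Ser E} (ls : IsLoc₂ 𝓤 fun f x => s f x)
    (hs : ∀ f x, s f x 0 = b.aS (f 0) (x 0)) (hc : ∀ r f x, l r (s f x) = s f (l r x)) :
    (∀ f, (∀ x, s f x = 0) → f = 0) ∧
    ∃ τ : Ser S →ₗ[k[X]] Ser S, IsLoc 𝓤 τ ∧ (∀ f, τ f 0 = f 0) ∧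
      ∀ φ : Ser E →ₗ[k[X]] Ser E, (∀ r x, φ (l r x) = l r (φ x)) →
        s (τ (∑ i, Ser.map (B.η i) (φ (Ser.const (B.x i))))) = φ := by
  obtain ⟨Ξ, -, hΞ0, hΞ, -⟩ := B.exists_lift hD hl
  -- Reading f back from the operator s f on the classical dual basis recovers f only modulo λ; τ
  -- corrects the error.
  let ν : Ser S →ₗ[k[X]] Ser S := ∑ i, Ser.map (B.η i) ∘ₗ s.flip (Ser.const (B.x i))
  have hν : ∀ f, ν f = ∑ i, Ser.map (B.η i) (s f (Ser.const (B.x i))) := fun f => by simp [ν]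
  obtain ⟨τ, lτ, hτ0, hτ1, hτ2⟩ := Ser.exists_inverse (𝓤 := 𝓤) ν
    (fun f => by simp [hν, hs, B.sum_η])
    (fun u f hf => by
      rw [hν]
      exact sum_mem fun i _ => Ser.isLoc_map (B.η_loc i) u _ (ls u _ _ (Or.inl hf)))
  refine ⟨fun f hf => ?_, τ, lτ, hτ0, fun φ hφ => ?_⟩
  · rw [← hτ1 f, hν]
    simp [hf]
  -- The difference of the two sides commutes with R and is read back as 0. In lowest order such a ψ
  -- sends y to ∑ ξᵢ(y) ψ(xᵢ), the action on y of the element read back from ψ. So ψ is divisible by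
  -- λ, with a quotient of the same kind.
  · refine (sub_eq_zero.1 (XSep.coind (k := k) (fun ψ : Ser E →ₗ[k[X]] Ser E =>
      (∀ r x, ψ (l r x) = l r (ψ x)) ∧
        ∑ i, Ser.map (B.η i) (ψ (Ser.const (B.x i))) = 0) ?_ _ ⟨fun r x => ?_, ?_⟩)).symm
    · rintro ψ ⟨h1, h2⟩
      obtain ⟨χ, rfl⟩ := exists_eq_X_smul_hom ψ fun y => by
        have h3 := congrArg (fun f : Ser S => b.aS (f 0) (y 0)) h2
        simp only [Ser.sum_apply, Ser.map_apply, map_sum, LinearMap.sum_apply, B.compat,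
          Ser.zero_apply, map_zero, LinearMap.zero_apply] at h3
        conv_lhs => rw [← hΞ y, map_sum, Ser.sum_apply]
        rw [← h3]
        exact Finset.sum_congr rfl fun i _ => by rw [h1, hl.red, hΞ0]
      refine ⟨χ, ⟨fun r x => ?_, ?_⟩, rfl⟩
      · refine XSep.cancel (k := k) (χ (l r x)) _ ?_
        simpa using h1 r x
      · have h4 : (Polynomial.X : k[X]) • (∑ i, Ser.map (B.η i) (χ (Ser.const (B.x i)))) =
            (Polynomial.X : k[X]) • (0 : Ser S) := by simpa [Finset.smul_sum] using h2
        exact XSep.cancel _ _ h4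
    · simp [hφ, hc]
    · simp only [LinearMap.sub_apply, map_sub, Finset.sum_sub_distrib]
      rw [← hν, hτ2, sub_self]

include B in
/-- The formal product on `S` in a deformation of a bimodule is determined, up to equivalence, by
the one on `R`. -/
theorem deforms_unique {D : FormalProduct k R} (hD : IsLoc₂ 𝓤 fun f g => D.mul f g)
    {D₁ D₂ : FormalProduct k S} (h₁ : b.Deforms D D₁) (h₂ : b.Deforms D D₂) :
    EquivLoc 𝓤 D₁ D₂ := by
  obtain ⟨l, s, hl, hs, hc⟩ := h₁
  obtain ⟨l', s', hl', hs', hc'⟩ := h₂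
  obtain ⟨Ξ, lΞ, hΞ0, hΞ, hΞl⟩ := B.exists_lift hD hl
  -- An isomorphism between the two deformed R-modules: take the lifted coordinates for the first
  -- action and recombine the xᵢ with the second. It is the identity modulo λ.
  let U : Ser E →ₗ[k[X]] Ser E :=
    ∑ i, l'.flip (Ser.const (B.x i)) ∘ₗ LinearMap.proj i ∘ₗ Ξ
  have hU : ∀ x, U x = ∑ i, l' (Ξ x i) (Ser.const (B.x i)) := fun x => by simp [U]
  have hUl : ∀ r x, U (l r x) = l' r (U x) := fun r x => by
    simp only [hU, hΞl, D.smulRow_apply, hl'.mul, map_sum]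
  have hU0 : ∀ x, U x 0 = x 0 := fun x => by simp [hU, hl'.red, hΞ0, B.sum]
  have lU : IsLoc 𝓤 U := fun u x hx => by
    rw [hU]
    exact sum_mem fun i _ => hl'.loc u _ _ (Or.inl (lΞ u _ hx i))
  obtain ⟨V, lV, hV0, hVU, hUV⟩ := Ser.exists_inverse U hU0 lU
  have hVl : ∀ r x, V (l' r x) = l r (V x) := fun r x => by
    rw [← hVU (l r (V x)), hUl, hUV]
  obtain ⟨hinj, τ, lτ, hτ0, hτ⟩ := B.exists_commutant hD hl' hs'.loc hs'.red hc'
  let Ψ : Ser S →ₗ[k[X]] Ser S :=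
    τ ∘ₗ ∑ i, Ser.map (B.η i) ∘ₗ U ∘ₗ s.flip (V (Ser.const (B.x i)))
  have hΨ : ∀ f, Ψ f = τ (∑ i, Ser.map (B.η i) (U (s f (V (Ser.const (B.x i)))))) := fun f => by
    simp [Ψ]
  -- The first action of S, carried over by U, commutes with the second action of R, so it is the
  -- second action of some element Ψ f. Faithfulness of the deformed action of S then makes Ψ
  -- multiplicative.
  have hΨs : ∀ f y, s' (Ψ f) y = U (s f (V y)) := fun f y => by
    have := hτ (U ∘ₗ s f ∘ₗ V) fun r x => by
      simp only [LinearMap.comp_apply, hVl, ← hc, hUl]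
    rw [hΨ]
    exact LinearMap.congr_fun this y
  refine ⟨Ψ, fun u f hf => ?_, fun f => ?_, fun f g => sub_eq_zero.1 (hinj _ fun y => ?_)⟩
  · rw [hΨ]
    exact lτ u _ (sum_mem fun i _ =>
      Ser.isLoc_map (B.η_loc i) u _ (lU u _ (hs.loc u _ _ (Or.inl hf))))
  · rw [hΨ, hτ0]
    simp [hU0, hs.red, hV0, B.sum_η]
  · rw [map_sub, LinearMap.sub_apply, hs'.mul, hΨs, hΨs, hΨs, hVU, hs.mul, sub_self]

/-- The map `ι : S⟦λ⟧ → Mₙ(R⟦λ⟧)` that represents the action of `S` on `E` by matrices. -/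
def toMat : Ser S →ₗ[k[X]] Matrix (Fin B.n) (Fin B.n) (Ser R) :=
  LinearMap.pi fun i => LinearMap.pi fun j => Ser.map (B.ξ j ∘ₗ b.aS.flip (B.x i))

theorem toMat_apply (f : Ser S) (i j : Fin B.n) (m : ℕ) :
    B.toMat f i j m = B.ξ j (b.aS (f m) (B.x i)) := rfl

/-- The map `L ↦ P ⋆ ι(L) ⋆ P`. -/
def corner (D : FormalProduct k R) (P : Matrix (Fin B.n) (Fin B.n) (Ser R)) :
    Ser S →ₗ[k[X]] Matrix (Fin B.n) (Fin B.n) (Ser R) :=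
  D.matMul.flip P ∘ₗ D.matMul P ∘ₗ B.toMat

theorem corner_apply (D : FormalProduct k R) (P : Matrix (Fin B.n) (Fin B.n) (Ser R)) (f : Ser S) :
    B.corner D P f = D.matMul (D.matMul P (B.toMat f)) P := rfl

theorem isLoc_toMat : IsLoc 𝓤 B.toMat := fun u _ hf _ j m =>
  B.ξ_loc j u _ (b.aS_loc u _ _ (Or.inl (hf m)))

/-- The left inverse `Mₙ(R⟦λ⟧) → S⟦λ⟧` of `toMat`. -/
def ofMat : Matrix (Fin B.n) (Fin B.n) (Ser R) →ₗ[k[X]] Ser S :=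
  ∑ i, ∑ j, Ser.map (B.η i ∘ₗ b.aR.flip (B.x j)) ∘ₗ Matrix.entryLinearMap k[X] (Ser R) i j

theorem ofMat_apply (Y : Matrix (Fin B.n) (Fin B.n) (Ser R)) (m : ℕ) :
    B.ofMat Y m = ∑ i, ∑ j, B.η i (b.aR (Y i j m) (B.x j)) := by
  simp [ofMat]

theorem isLoc_ofMat : IsLoc 𝓤 B.ofMat := fun u Y hY m => by
  rw [ofMat_apply]
  exact sum_mem fun i _ => sum_mem fun j _ => B.η_loc i u _ (b.aR_loc u _ _ (Or.inl (hY i j m)))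

/-! ### The corner P ⋆ Mₙ ⋆ P as a deformation of S. -/

section Corner

variable {D : FormalProduct k R} (hD : IsLoc₂ 𝓤 fun f g => D.mul f g)
  {P : Matrix (Fin B.n) (Fin B.n) (Ser R)} (hP : D.matMul P P = P)
  (hP0 : ∀ i j, P i j 0 = B.proj i j)

include hP0 in
theorem matMul_coeff_zero (Y : Matrix (Fin B.n) (Fin B.n) (Ser R)) (i j : Fin B.n) :
    D.matMul (D.matMul P Y) P i j 0 =
      ∑ m, (∑ l, B.ξ l (B.x i) * Y l m 0) * B.ξ j (B.x m) := by
  simp only [D.matMul_apply, Ser.sum_apply, D.mul_zero_coeff, hP0, proj, Matrix.of_apply]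

include hP0 in
theorem corner_coeff_zero (f : Ser S) (i j : Fin B.n) :
    B.corner D P f i j 0 = B.ξ j (b.aS (f 0) (B.x i)) := by
  rw [corner_apply, B.matMul_coeff_zero hP0]
  simp only [B.toMat_apply, B.sum_ξ_mul, B.sum_ξ_mul']

include hP in
theorem matMul_corner (f : Ser S) : D.matMul P (B.corner D P f) = B.corner D P f := by
  rw [corner_apply, ← D.matMul_assoc, ← D.matMul_assoc, hP]

include hP in
theorem corner_matMul (f : Ser S) : D.matMul (B.corner D P f) P = B.corner D P f := by
  rw [corner_apply, D.matMul_assoc, hP]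

include hD in
theorem isLoc_corner : IsLoc 𝓤 (B.corner D P) := fun u _ hf =>
  FormalProduct.isLoc₂_matMul hD u _ _ (Or.inl (FormalProduct.isLoc₂_matMul hD u _ _
    (Or.inr (B.isLoc_toMat u _ hf))))

include hD hP hP0

/-- The idempotent Y ↦ P ⋆ Y ⋆ P on matrices splits modulo λ through S by `toMat` and `ofMat`, so
`exists_splitting` provides the inverse of the corner map. -/
theorem exists_corner_splitting :
    ∃ τ : Ser S →ₗ[k[X]] Ser S, IsLoc 𝓤 τ ∧ (∀ f, τ f 0 = f 0) ∧
      (∀ f, τ (B.ofMat (B.corner D P f)) = f) ∧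
      ∀ Y, B.corner D P (τ (B.ofMat (D.matMul (D.matMul P Y) P))) =
        D.matMul (D.matMul P Y) P := by
  obtain ⟨τ, lτ, hτ0, hτ1, -, hτ3⟩ := exists_splitting (𝓤 := 𝓤) (D.matMul.flip P ∘ₗ D.matMul P)
    B.toMat B.ofMat
    (fun Y => by
      simp only [LinearMap.comp_apply, LinearMap.flip_apply]
      rw [← D.matMul_assoc, ← D.matMul_assoc, hP, D.matMul_assoc, hP])
    (fun f => by
      rw [B.ofMat_apply]
      change ∑ i, ∑ j, B.η i (b.aR (B.corner D P f i j 0) (B.x j)) = _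
      simp only [B.corner_coeff_zero hP0, ← map_sum, B.sum, B.sum_η])
    (fun Y => exists_eq_X_smul_matrix _ fun i j => by
      rw [Matrix.sub_apply, Ser.sub_apply, LinearMap.comp_apply, LinearMap.flip_apply,
        B.matMul_coeff_zero hP0, B.toMat_apply, ofMat_apply, sub_eq_zero]
      simp only [map_sum, LinearMap.sum_apply, B.compat, B.ξ_smul, Finset.sum_mul, _root_.mul_assoc]
      exact Finset.sum_comm)
    (fun u Y hY => by
      change D.matMul (D.matMul P Y) P ∈ van u
      exact FormalProduct.isLoc₂_matMul hD u (D.matMul P Y) P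
        (Or.inl (FormalProduct.isLoc₂_matMul hD u P Y (Or.inr hY)))) B.isLoc_toMat B.isLoc_ofMat
  exact ⟨τ, lτ, hτ0, hτ1, hτ3⟩

/-- The matrix product is pulled back along the bijection onto the corner, and associativity follows
from injectivity. The factors are interchanged because matrices act on rows from the right while S
acts on E from the left. -/
theorem exists_corner_mul :
    ∃ D' : FormalProduct k S, IsLoc₂ 𝓤 (fun f g => D'.mul f g) ∧
      Function.Injective (B.corner D P) ∧
      (∀ Y, ∃ f, B.corner D P f = D.matMul (D.matMul P Y) P) ∧
      ∀ f g, B.corner D P (D'.mul f g) = D.matMul (B.corner D P g) (B.corner D P f) := by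
  obtain ⟨τ, lτ, hτ0, hτ1, hτ3⟩ := B.exists_corner_splitting hD hP hP0
  have hinj : Function.Injective (B.corner D P) := fun f f' h => by
    rw [← hτ1 f, ← hτ1 f', h]
  let β : Ser S →ₗ[k[X]] Ser S →ₗ[k[X]] Ser S :=
    ((D.matMul.flip.compl₁₂ (B.corner D P) (B.corner D P)).compr₂ B.ofMat).compr₂ τ
  have hβ : ∀ f f', β f f' = τ (B.ofMat (D.matMul (B.corner D P f') (B.corner D P f))) :=
    fun f f' => rfl
  have hΘβ : ∀ f f', B.corner D P (β f f') = D.matMul (B.corner D P f') (B.corner D P f) := by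
    intro f f'
    have h := hτ3 (D.matMul (B.corner D P f') (B.corner D P f))
    rw [← D.matMul_assoc, B.matMul_corner hP, D.matMul_assoc, B.corner_matMul hP] at h
    rw [hβ, h]
  have h0 : ∀ s t, β (Ser.const s) (Ser.const t) 0 = s * t := fun s t => by
    rw [hβ, hτ0, ofMat_apply]
    simp only [D.matMul_apply, Ser.sum_apply, D.mul_zero_coeff, B.corner_coeff_zero hP0,
      Ser.const_zero, B.sum_ξ_mul, ← b.aS_mul, ← map_sum, B.sum, B.sum_η]
  have hassoc : ∀ f f' f'', β (β f f') f'' = β f (β f' f'') := fun f f' f'' =>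
    hinj (by rw [hΘβ, hΘβ, hΘβ, hΘβ, D.matMul_assoc])
  refine ⟨FormalProduct.ofBil β h0 hassoc, ?_, hinj, fun Y => ⟨_, hτ3 Y⟩, fun f f' => ?_⟩
  · intro u f f' h
    change (FormalProduct.ofBil β h0 hassoc).mul f f' ∈ van u
    rw [FormalProduct.mul_ofBil, hβ]
    exact lτ u _ (B.isLoc_ofMat u _ (FormalProduct.isLoc₂_matMul hD u _ _
      (h.symm.imp (B.isLoc_corner hD u _) (B.isLoc_corner hD u _))))
  · rw [FormalProduct.mul_ofBil, hΘβ]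

/-- On rows fixed by P, series act by multiplication from the left and the corner by multiplication
from the right; associativity makes the two commute. Carrying both actions to E⟦λ⟧ by g and Ξ gives
the deformed bimodule. -/
theorem deforms_corner {D' : FormalProduct k S}
    (h : ∀ f g, B.corner D P (D'.mul f g) = D.matMul (B.corner D P g) (B.corner D P f)) :
    b.Deforms D D' := by
  let g : (Fin B.n → Ser R) →ₗ[k[X]] Ser E :=
    ∑ i, Ser.map (b.aR.flip (B.x i)) ∘ₗ LinearMap.proj i
  have hg : ∀ y m, g y m = ∑ i, b.aR (y i m) (B.x i) := fun y m => by simp [g]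
  have lg : IsLoc 𝓤 g := fun u y hy m => by
    rw [hg]
    exact sum_mem fun i _ => b.aR_loc u _ _ (Or.inl (hy i m))
  obtain ⟨Ξ, lΞ, hΞ0, hΞP, hgΞ, hΞg⟩ := B.exists_row_splitting hD hP hP0 g lg fun y => hg y 0
  have hΞ1 : ∀ r x, Ξ (g (D.smulRow r (Ξ x))) = D.smulRow r (Ξ x) := fun r x =>
    hΞg _ (by rw [D.smulRow_rowMul, hΞP])
  have hΞ2 : ∀ f x, Ξ (g (D.rowMul (Ξ x) (B.corner D P f))) = D.rowMul (Ξ x) (B.corner D P f) :=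
    fun f x => hΞg _ (by rw [← D.rowMul_matMul, B.corner_matMul hP])
  let l : Ser R →ₗ[k[X]] Ser E →ₗ[k[X]] Ser E := (D.smulRow.compl₂ Ξ).compr₂ g
  have hl : ∀ r x, l r x = g (D.smulRow r (Ξ x)) := fun r x => rfl
  let s : Ser S →ₗ[k[X]] Ser E →ₗ[k[X]] Ser E :=
    (D.rowMul.flip.compl₁₂ (B.corner D P) Ξ).compr₂ g
  have hs : ∀ f x, s f x = g (D.rowMul (Ξ x) (B.corner D P f)) := fun f x => rfl
  refine ⟨l, s, ⟨fun u r x h => ?_, fun r x => ?_, fun r r' x => ?_⟩,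
    ⟨fun u f x h => ?_, fun f x => ?_, fun f f' x => ?_⟩, fun r f x => ?_⟩
  · exact lg u _ (FormalProduct.isLoc₂_smulRow hD u _ _ (h.imp id (lΞ u _)))
  · rw [hl, hg]
    simp only [D.smulRow_apply, D.mul_zero_coeff, hΞ0, b.aR_mul, ← map_sum, B.sum]
  · rw [hl, hl, hl, hΞ1, D.smulRow_mul]
  · exact lg u _ (FormalProduct.isLoc₂_rowMul hD u _ _
      (h.symm.imp (lΞ u _) (B.isLoc_corner hD u _)))
  · rw [hs, hg]
    simp only [D.rowMul_apply, Ser.sum_apply, D.mul_zero_coeff, hΞ0, B.corner_coeff_zero hP0,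
      B.sum_ξ_mul, B.sum]
  · rw [hs, hs, hs, hΞ2, h, D.rowMul_matMul]
  · rw [hl, hs, hl, hs, hΞ1, hΞ2, D.smulRow_rowMul]

end Corner

end DualBasis

end Bimodules

/-! ### Units -/

section Units

variable {k : Type*} [CommRing k] {𝓤 A : Type*} [Ring A] [Algebra k A] [Van 𝓤 A]

/-- The undeformed product on series. -/
def classicalMul (k A : Type*) [CommRing k] [Ring A] [Algebra k A] :
    Ser A →ₗ[k[X]] Ser A →ₗ[k[X]] Ser A :=
  Ser.bil (Ser.const (LinearMap.mul k A))

theorem classicalMul_const (a b : A) :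
    classicalMul k A (Ser.const a) (Ser.const b) = Ser.const (a * b) := by
  ext n
  rw [classicalMul, Ser.bil_const]
  cases n <;> rfl

theorem classicalMul_one (f : Ser A) : classicalMul k A f (Ser.const 1) = f := by
  have : (classicalMul k A).flip (Ser.const 1) = LinearMap.id :=
    Ser.hom_ext fun x => by simp [classicalMul_const]
  exact LinearMap.congr_fun this f

theorem one_classicalMul (f : Ser A) : classicalMul k A (Ser.const 1) f = f := by
  have : classicalMul k A (Ser.const 1) = LinearMap.id :=
    Ser.hom_ext fun x => by simp [classicalMul_const]
  exact LinearMap.congr_fun this f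

theorem classicalMul_zero_coeff (f g : Ser A) : classicalMul k A f g 0 = f 0 * g 0 := by
  rw [classicalMul, Ser.bil_apply]
  simp

namespace FormalProduct

/-- Left and right multiplication by the classical unit are the identity modulo λ, hence invertible.
The preimages of 1 under them are a left and a right unit, and these must agree. -/
theorem exists_unit (D : FormalProduct k A) :
    ∃ u : Ser A, u 0 = 1 ∧ ∀ f, D.mul u f = f ∧ D.mul f u = f := by
  -- Locality plays no role here, so the vanishing condition is made trivial.
  let _ : Van Unit A := ⟨fun _ => ⊤⟩
  have triv : ∀ φ : Ser A → Ser A, IsLoc Unit φ := fun φ u x _ n => AddSubgroup.mem_top _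
  obtain ⟨ψ, -, -, h1, h2⟩ := Ser.exists_inverse (𝓤 := Unit) (D.mul (Ser.const 1))
    (fun f => by simp [D.mul_zero_coeff]) (triv _)
  obtain ⟨χ, -, -, h3, h4⟩ := Ser.exists_inverse (𝓤 := Unit) (D.mul.flip (Ser.const 1))
    (fun f => by simp [D.mul_zero_coeff]) (triv _)
  have hl : ∀ f, D.mul (ψ (Ser.const 1)) f = f := fun f => by
    rw [← h1 (D.mul (ψ (Ser.const 1)) f), ← D.mul_assoc, h2, h1]
  have hr : ∀ f, D.mul f (χ (Ser.const 1)) = f := fun f => by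
    rw [← h3 (D.mul f (χ (Ser.const 1))), LinearMap.flip_apply, D.mul_assoc]
    have := h4 (Ser.const 1)
    rw [LinearMap.flip_apply] at this
    rw [this]
    exact h3 f
  have heq : ψ (Ser.const 1) = χ (Ser.const 1) := by
    rw [← hr (ψ (Ser.const 1)), hl]
  refine ⟨ψ (Ser.const 1), ?_, fun f => ⟨hl f, by rw [heq]; exact hr f⟩⟩
  have := congrArg (fun f : Ser A => f 0) (h2 (Ser.const 1))
  simpa [D.mul_zero_coeff] using this

theorem toSer_one : toSer (1 : A⟦X⟧) = Ser.const 1 := by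
  ext n
  cases n with
  | zero => simp
  | succ n => simp [PowerSeries.coeff_one]

theorem isUnital_iff (D : FormalProduct k A) :
    D.IsUnital ↔ ∀ f, D.mul (Ser.const 1) f = f ∧ D.mul f (Ser.const 1) = f := by
  constructor
  · intro h f
    obtain ⟨h1, h2⟩ := h (ofSer f)
    have h1 := congrArg toSer h1
    have h2 := congrArg toSer h2
    rw [toSer_star, toSer_one, toSer_ofSer] at h1 h2
    exact ⟨h1, h2⟩
  · intro h f
    refine ⟨toSer_injective ?_, toSer_injective ?_⟩
    · rw [toSer_star, toSer_one, (h _).1]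
    · rw [toSer_star, toSer_one, (h _).2]

theorem isLoc₂_mul_of_local {D : FormalProduct k A} (hD : IsLoc₂ 𝓤 fun f g => D.mul f g) :
    IsLoc₂ 𝓤 fun a b : A => a * b := fun u a b h => by
  have : D.mul (Ser.const a) (Ser.const b) 0 ∈ Van.van u :=
    hD u (Ser.const a) (Ser.const b) (h.imp Ser.const_mem_van Ser.const_mem_van) 0
  rwa [D.mul_zero_coeff] at this

/-- The local self-map of `A⟦λ⟧` with leading term the identity that maps `1` to a given `u`. -/
theorem exists_map_one [Invertible (2 : k)] (hA : IsLoc₂ 𝓤 fun a b : A => a * b) (u : Ser A)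
    (hu : u 0 = 1) :
    ∃ φ : Ser A →ₗ[k[X]] Ser A, IsLoc 𝓤 φ ∧ (∀ f, φ f 0 = f 0) ∧ φ (Ser.const 1) = u ∧
      ∀ f, φ f = (⅟2 : k) • (classicalMul k A u f + classicalMul k A f u) := by
  have hloc : IsLoc₂ 𝓤 fun f g => classicalMul k A f g := by
    refine Ser.isLoc₂_bil_iff.2 fun n u a b h => ?_
    cases n with
    | zero => exact hA u a b h
    | succ n => exact zero_mem _
  -- The symmetrized product with u, rather than multiplication from one side, so that φ commutes
  -- with an involution that fixes u.
  let φ : Ser A →ₗ[k[X]] Ser A := (⅟2 : k) • (classicalMul k A u + (classicalMul k A).flip u)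
  have hφ : ∀ f, φ f = (⅟2 : k) • (classicalMul k A u f + classicalMul k A f u) := fun f => rfl
  have h2 : ∀ a : A, (⅟2 : k) • (a + a) = a := fun a => by
    rw [← two_smul k a, smul_smul, invOf_mul_self, one_smul]
  have hred : ∀ f, φ f 0 = f 0 := fun f => by
    rw [hφ, Ser.smul_apply, Ser.add_apply, classicalMul_zero_coeff, classicalMul_zero_coeff, hu,
      one_mul, mul_one, h2]
  refine ⟨φ, ?_, hred, ?_, hφ⟩
  · have key : IsLoc₂ 𝓤 fun (c : Ser A) (f : Ser A) =>
        classicalMul k A c f + classicalMul k A f c :=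
      fun v c f h => add_mem (hloc v _ _ h) (hloc v _ _ h.symm)
    -- The vanishing elements are only known to form an additive subgroup, so the factor 1/2 is
    -- moved onto u.
    have h3 : φ = (classicalMul k A ((⅟2 : k) • u) +
        (classicalMul k A).flip ((⅟2 : k) • u)) := by
      refine LinearMap.ext fun f => ?_
      rw [hφ, LinearMap.add_apply, LinearMap.flip_apply, LinearMap.map_smul_of_tower,
        LinearMap.map_smul_of_tower, LinearMap.smul_apply, smul_add]
    rw [h3]
    exact fun v f hf => key v _ f (Or.inr hf)
  · ext n
    rw [hφ, classicalMul_one, one_classicalMul]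
    exact h2 _

/-- The product that makes a given bijection multiplicative. -/
theorem exists_transport (D : FormalProduct k A) (hD : IsLoc₂ 𝓤 fun f g => D.mul f g)
    (φ : Ser A →ₗ[k[X]] Ser A) (lφ : IsLoc 𝓤 φ) (h0 : ∀ f, φ f 0 = f 0) :
    ∃ D' : FormalProduct k A, IsLoc₂ 𝓤 (fun f g => D'.mul f g) ∧
      ∀ f g, φ (D'.mul f g) = D.mul (φ f) (φ g) := by
  obtain ⟨ψ, lψ, hψ0, h1, h2⟩ := Ser.exists_inverse φ h0 lφ
  have hβ : ∀ f g, φ ((D.mul.compl₁₂ φ φ).compr₂ ψ f g) = D.mul (φ f) (φ g) := fun f g => h2 _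
  refine ⟨ofBil ((D.mul.compl₁₂ φ φ).compr₂ ψ) (fun a b => ?_) (fun f g h => ?_), ?_, ?_⟩
  · change ψ (D.mul (φ _) (φ _)) 0 = _
    rw [hψ0, D.mul_zero_coeff, h0, h0]; rfl
  · rw [← h1 (((D.mul.compl₁₂ φ φ).compr₂ ψ) _ h), hβ, hβ, D.mul_assoc, ← hβ g h, ← hβ, h1]
  · rw [mul_ofBil]
    exact fun u f g h => lψ u _ (hD u _ _ (h.imp (lφ u _) (lφ u _)))
  · rw [mul_ofBil]
    exact hβ

end FormalProduct

end Units

/-! ### Involutions -/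

section Involutions

variable {k : Type*} [CommRing k] {𝓤 A : Type*} [Ring A] [Algebra k A] [Van 𝓤 A]

/-- The coefficientwise extension of an additive map. -/
def Ser.mapAdd {X Y : Type*} [AddCommGroup X] [AddCommGroup Y] (σ : X →+ Y) : Ser X →+ Ser Y where
  toFun f := Ser.mk fun n => σ (f n)
  map_zero' := by ext n; simp
  map_add' f g := by ext n; simp

@[simp] theorem Ser.mapAdd_apply {X Y : Type*} [AddCommGroup X] [AddCommGroup Y] (σ : X →+ Y)
    (f : Ser X) (n : ℕ) : Ser.mapAdd σ f n = σ (f n) := rfl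

theorem Ser.mapAdd_const {X Y : Type*} [AddCommGroup X] [AddCommGroup Y] (σ : X →+ Y) (x : X) :
    Ser.mapAdd σ (Ser.const x) = Ser.const (σ x) := by
  ext n; cases n <;> simp

theorem Ser.mapAdd_X_smul {X Y : Type*} [AddCommGroup X] [AddCommGroup Y] [Module k X] [Module k Y]
    (σ : X →+ Y) (f : Ser X) :
    Ser.mapAdd σ ((Polynomial.X : k[X]) • f) = (Polynomial.X : k[X]) • Ser.mapAdd σ f := by
  ext n; cases n <;> simp

theorem Ser.mapAdd_bil {X : Type*} [AddCommGroup X] [Module k X] (σ : X →+ X)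
    (C : Ser (X →ₗ[k] X →ₗ[k] X)) (h : ∀ n a b, σ (C n a b) = C n (σ b) (σ a)) (f g : Ser X) :
    Ser.mapAdd σ (Ser.bil C f g) = Ser.bil C (Ser.mapAdd σ g) (Ser.mapAdd σ f) := by
  ext n
  rw [Ser.mapAdd_apply, Ser.bil_apply, Ser.bil_apply, map_sum]
  refine Finset.sum_congr rfl fun p _ => ?_
  rw [map_sum, ← Finset.Nat.sum_antidiagonal_swap]
  exact Finset.sum_congr rfl fun q _ => h _ _ _

namespace FormalProduct

theorem isHermitian_iff {st : A →+ A} {D : FormalProduct k A} :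
    D.IsHermitian st ↔
      ∀ f g, Ser.mapAdd st (D.mul f g) = D.mul (Ser.mapAdd st g) (Ser.mapAdd st f) := by
  refine ⟨fun h => Ser.mapAdd_bil st _ h, fun h n a b => ?_⟩
  rw [← D.mul_const, ← Ser.mapAdd_apply, h, Ser.mapAdd_const, Ser.mapAdd_const, D.mul_const]

/-- Every local formal product is equivalent to a unital one. -/
theorem exists_unital [Invertible (2 : k)] (D : FormalProduct k A)
    (hD : IsLoc₂ 𝓤 fun f g => D.mul f g) :
    ∃ D' : FormalProduct k A, IsLoc₂ 𝓤 (fun f g => D'.mul f g) ∧ D'.IsUnital ∧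
      ∃ φ : Ser A →ₗ[k[X]] Ser A, IsLoc 𝓤 φ ∧ (∀ f, φ f 0 = f 0) ∧
        (∀ f g, φ (D'.mul f g) = D.mul (φ f) (φ g)) ∧
        ∀ st : A →+ A, (∀ a b, st (a * b) = st b * st a) → (∀ a, st (st a) = a) →
          (∀ a, st ((⅟2 : k) • a) = (⅟2 : k) • st a) →
          D.IsHermitian st → (∀ f, φ (Ser.mapAdd st f) = Ser.mapAdd st (φ f)) := by
  obtain ⟨u, hu0, hu⟩ := D.exists_unit
  obtain ⟨φ, lφ, hφ0, hφ1, hφ⟩ := exists_map_one (k := k) (isLoc₂_mul_of_local hD) u hu0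
  obtain ⟨ψ, -, -, h1, -⟩ := Ser.exists_inverse φ hφ0 lφ
  have hinj : Function.Injective φ := Function.LeftInverse.injective h1
  obtain ⟨D', lD', hD'⟩ := D.exists_transport hD φ lφ hφ0
  refine ⟨D', lD', D'.isUnital_iff.2 fun f => ⟨hinj ?_, hinj ?_⟩, φ, lφ, hφ0, hD',
    fun st hst hst2 hst3 hherm f => ?_⟩
  · rw [hD', hφ1, (hu _).1]
  · rw [hD', hφ1, (hu _).2]
  · have hss : ∀ f, Ser.mapAdd st (Ser.mapAdd st f) = f := fun f => by ext n; simp [hst2]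
    have hustar : Ser.mapAdd st u = u := by
      calc Ser.mapAdd st u = D.mul u (Ser.mapAdd st u) := (hu _).1.symm
        _ = Ser.mapAdd st (D.mul u (Ser.mapAdd st u)) := by rw [isHermitian_iff.1 hherm, hss]
        _ = u := by rw [(hu _).1, hss]
    have hcl : ∀ f g, Ser.mapAdd st (classicalMul k A f g) =
        classicalMul k A (Ser.mapAdd st g) (Ser.mapAdd st f) := by
      refine Ser.mapAdd_bil st _ fun n a b => ?_
      cases n with
      | zero => exact hst a b
      | succ n => exact map_zero st
    have hhalf : ∀ f : Ser A, Ser.mapAdd st ((⅟2 : k) • f) = (⅟2 : k) • Ser.mapAdd st f :=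
      fun f => by ext n; exact hst3 _
    rw [hφ, hφ, hhalf, map_add, hcl, hcl, hustar, add_comm]

end FormalProduct

/-- The product induced by a self-adjoint deformed idempotent is Hermitian. -/
theorem DualBasis.isHermitian_corner {R S E : Type*} [Ring R] [Algebra k R] [Ring S] [Algebra k S]
    [AddCommGroup E] [Module k E] [Van 𝓤 R] [Van 𝓤 S] [Van 𝓤 E] {b : Bimod k 𝓤 R S E}
    (B : DualBasis b) {D : FormalProduct k R} {D' : FormalProduct k S}
    {P : Matrix (Fin B.n) (Fin B.n) (Ser R)}
    (hinj : Function.Injective (B.corner D P))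
    (h : ∀ f g, B.corner D P (D'.mul f g) = D.matMul (B.corner D P g) (B.corner D P f))
    {σ : R →+ R} {st : S →+ S} (hD : D.IsHermitian σ)
    (hP : ∀ i j, Ser.mapAdd σ (P j i) = P i j)
    (hB : ∀ s i j, B.ξ j (b.aS (st s) (B.x i)) = σ (B.ξ i (b.aS s (B.x j)))) :
    D'.IsHermitian st := by
  -- The conjugate transpose. The corner map intertwines it with the involution of S because P is
  -- self-adjoint.
  let σM : Matrix (Fin B.n) (Fin B.n) (Ser R) → Matrix (Fin B.n) (Fin B.n) (Ser R) :=
    fun Y => Matrix.of fun i j => Ser.mapAdd σ (Y j i)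
  have hσM : ∀ Y Z, σM (D.matMul Y Z) = D.matMul (σM Z) (σM Y) := fun Y Z => by
    ext1 i j
    change Ser.mapAdd σ (D.matMul Y Z j i) = _
    rw [D.matMul_apply, D.matMul_apply, map_sum]
    exact Finset.sum_congr rfl fun l _ => FormalProduct.isHermitian_iff.1 hD _ _
  have hPM : σM P = P := by ext1 i j; exact hP i j
  have hc : ∀ f, B.corner D P (Ser.mapAdd st f) = σM (B.corner D P f) := fun f => by
    have : B.toMat (Ser.mapAdd st f) = σM (B.toMat f) := by
      ext1 i j
      ext n
      exact hB _ _ _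
    rw [B.corner_apply, B.corner_apply, hσM, hσM, hPM, this, D.matMul_assoc]
  refine FormalProduct.isHermitian_iff.2 fun f g => hinj ?_
  rw [hc, h, hσM, h, hc, hc]

end Involutions

/-! ### Square roots of formal operators -/

section Sqrt

variable {k : Type*} [CommRing k]

/-! ### Square roots congruent to 1 in a λ-adic ring. -/

section Ring

variable {N : Type*} [Ring N] [Algebra k[X] N] [XSep k N]

/-- Square roots congruent to `1` modulo `λ` exist. The last clause gives the properties they
inherit from the approximations. -/
theorem exists_sqrt [XComplete k N] (h : k[X]) (hh : h + h = 1) (s : N)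
    (hs : ∃ v, s - 1 = (Polynomial.X : k[X]) • v) :
    ∃ r : N, (∃ v, r - 1 = (Polynomial.X : k[X]) • v) ∧ r * r = s ∧
      ∀ C : N → Prop, C 1 → (∀ p, C p → C (p + h • (s - p * p))) →
        (∀ q, (∀ n, ∃ p, C p ∧ ∃ w, q - p = (Polynomial.X ^ (n + 1) : k[X]) • w) → C q) → C r := by
  -- Newton's method with the derivative 2p frozen at 2, which avoids inverting noncommuting
  -- elements.
  let F : N → N := fun p => p + h • (s - p * p)
  have h2 : ∀ e : N, e = h • e + h • e := fun e => by rw [← add_smul, hh, one_smul]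
  -- Every term of the new error contains p - 1 or the old error a second time, so each step gains
  -- at least one power of λ.
  have hF : ∀ p, s - F p * F p = -(h • ((p - 1) * (s - p * p) + (s - p * p) * (p - 1))) -
      (h * h) • ((s - p * p) * (s - p * p)) := by
    intro p
    have : s - F p * F p = (s - p * p) - h • (p * (s - p * p) + (s - p * p) * p) -
        (h * h) • ((s - p * p) * (s - p * p)) := by
      simp only [F, add_mul, mul_add, smul_mul_assoc, mul_smul_comm, smul_smul, smul_add]
      abel
    rw [this]
    generalize s - p * p = e
    simp only [sub_mul, mul_sub, one_mul, mul_one, smul_add, smul_sub]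
    linear_combination (norm := module) h2 e
  let q : ℕ → N := fun n => F^[n] 1
  have hq : ∀ n, q (n + 1) = F (q n) := fun n => Function.iterate_succ_apply' F n 1
  have hd : ∀ n, (∃ v, q n - 1 = (Polynomial.X : k[X]) • v) ∧
      ∃ w, s - q n * q n = (Polynomial.X ^ (n + 1) : k[X]) • w := by
    intro n
    induction n with
    | zero => exact ⟨⟨0, by simp [q]⟩, by simpa [q] using hs⟩
    | succ n ih =>
      obtain ⟨⟨v, hv⟩, w, hw⟩ := ih
      refine ⟨⟨v + (Polynomial.X ^ n * h : k[X]) • w, ?_⟩, ?_⟩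
      · rw [hq]
        change q n + h • (s - q n * q n) - 1 = _
        rw [hw, smul_add, ← hv, smul_smul, smul_smul, pow_succ']
        have : h * ((Polynomial.X : k[X]) * Polynomial.X ^ n) =
          Polynomial.X * (Polynomial.X ^ n * h) := by ring
        rw [this]
        abel
      · rw [hq, hF, hv, hw]
        refine ⟨-(h • (v * w + w * v)) - (h * h * Polynomial.X ^ n) • (w * w), ?_⟩
        simp only [smul_mul_assoc, mul_smul_comm, smul_sub, smul_neg, smul_add, smul_smul]
        congr 1
        · congr 2 <;> congr 1 <;> ring
        · congr 1; ring
  obtain ⟨r, hr⟩ := XComplete.exists_limit (k := k) q fun n => by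
    obtain ⟨-, w, hw⟩ := hd n
    rw [hq]
    refine ⟨h • w, ?_⟩
    change q n + h • (s - q n * q n) - q n = _
    rw [hw, smul_comm h]
    abel
  refine ⟨r, ?_, ?_, fun C h1 h2 h3 => ?_⟩
  · simpa [q] using hr 0
  · refine sub_eq_zero.1 (XSep.eq_zero (k := k) fun n => ?_)
    obtain ⟨w, hw⟩ := hr n
    obtain ⟨-, v, hv⟩ := hd n
    have : r * r - s = (r - q n) * r + q n * (r - q n) - (s - q n * q n) := by
      simp only [sub_mul, mul_sub]; abel
    refine ⟨(Polynomial.X : k[X]) • (w * r + q n * w - v), ?_⟩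
    rw [this, hv, hw]
    simp only [smul_sub, smul_add, mul_smul_comm, smul_mul_assoc, smul_smul, ← pow_succ]
  · have hC : ∀ n, C (q n) := fun n => by
      induction n with
      | zero => exact h1
      | succ n ih => rw [hq]; exact h2 _ ih
    exact h3 r fun n => ⟨q n, hC n, hr n⟩

/-- Square roots congruent to `1` modulo `λ` are unique. -/
theorem sqrt_unique (h : k[X]) (hh : h + h = 1) {r r' : N}
    (hr : ∃ v, r - 1 = (Polynomial.X : k[X]) • v) (hr' : ∃ v, r' - 1 = (Polynomial.X : k[X]) • v)
    (heq : r * r = r' * r') : r = r' := by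
  obtain ⟨v, hv⟩ := hr
  obtain ⟨v', hv'⟩ := hr'
  -- For d = r - r' the sum r d + d r' is r² - r'² = 0. Modulo λ this reads 2d = 0, so d is
  -- divisible by λ and the quotient satisfies the same equation.
  refine sub_eq_zero.1 (XSep.coind (k := k) (fun d => r * d + d * r' = 0) ?_ _ ?_)
  · intro d hd
    have h1 : d = (Polynomial.X : k[X]) • -(h • (v * d + d * v')) := by
      have h2 : d = h • d + h • d := by rw [← add_smul, hh, one_smul]
      rw [smul_neg, smul_comm, smul_add, ← smul_mul_assoc, ← mul_smul_comm, ← hv, ← hv']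
      have h3 : (r - 1) * d + d * (r' - 1) = -(d + d) := by
        rw [sub_mul, mul_sub, one_mul, mul_one]
        linear_combination (norm := abel) hd
      rw [h3]
      conv_lhs => rw [h2]
      rw [smul_neg, neg_neg, smul_add]
    refine ⟨_, XSep.cancel (k := k) _ _ ?_, h1⟩
    rw [smul_add, ← mul_smul_comm, ← smul_mul_assoc, ← h1, hd, smul_zero]
  · rw [mul_sub, sub_mul, heq]; abel

end Ring

theorem half_add_half [Invertible (2 : k)] : (Polynomial.C (⅟2) : k[X]) + Polynomial.C ⅟2 = 1 := by
  rw [← Polynomial.C_add, ← two_mul, mul_invOf_self, Polynomial.C_1]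

theorem exists_eq_X_pow_smul_hom {X Y : Type*} [AddCommGroup X] [Module k X] [AddCommGroup Y]
    [Module k Y] (φ : Ser X →ₗ[k[X]] Ser Y) (n : ℕ) (h : ∀ f, ∀ m < n, φ f m = 0) :
    ∃ ψ : Ser X →ₗ[k[X]] Ser Y, φ = (Polynomial.X ^ n : k[X]) • ψ := by
  induction n generalizing φ with
  | zero => exact ⟨φ, by simp⟩
  | succ n ih =>
    obtain ⟨ψ, rfl⟩ := exists_eq_X_smul_hom φ fun f => h f 0 (by omega)
    obtain ⟨χ, rfl⟩ := ih ψ fun f m hm => by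
      have := h f (m + 1) (by omega)
      rwa [LinearMap.smul_apply, Ser.X_smul_succ] at this
    exact ⟨χ, by rw [smul_smul, pow_succ']⟩

instance {X Y : Type*} [AddCommGroup X] [Module k X] [AddCommGroup Y] [Module k Y] :
    XComplete k (Ser X →ₗ[k[X]] Ser Y) where
  exists_limit p h := by
    have hstep : ∀ n f m, m ≤ n → p (n + 1) f m = p n f m := fun n f m hm => by
      obtain ⟨w, hw⟩ := h n
      have := Ser.exists_eq_X_pow_smul.1 ⟨w f, LinearMap.congr_fun hw f⟩ m (by omega : m < n + 1)
      exact sub_eq_zero.1 this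
    have hdiag : ∀ m j f, p (m + j) f m = p m f m := fun m j f => by
      induction j with
      | zero => rfl
      | succ j ih => rw [← add_assoc, hstep _ _ _ (by omega), ih]
    refine ⟨Ser.mkLin
      { toFun := fun f => Ser.mk fun m => p m f m
        map_add' := fun f g => by ext m; simp
        map_smul' := fun c f => by ext m; simp [LinearMap.map_smul_of_tower] }
      (fun f => ?_), fun n => exists_eq_X_pow_smul_hom _ _ fun f m hm => ?_⟩
    · ext m
      rw [← Ser.X_smul]
      simp only [LinearMap.coe_mk, AddHom.coe_mk, map_smul, Ser.mk_apply]
      cases m with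
      | zero => simp
      | succ m => rw [Ser.X_smul_succ, Ser.X_smul_succ]; exact hstep m f m le_rfl
    · obtain ⟨j, rfl⟩ := Nat.exists_eq_add_of_le (Nat.lt_succ_iff.1 hm)
      rw [LinearMap.sub_apply, Ser.sub_apply, hdiag]
      exact sub_self _

theorem exists_eq_X_smul_bilin {X Y Z : Type*} [AddCommGroup X] [Module k X] [AddCommGroup Y]
    [Module k Y] [AddCommGroup Z] [Module k Z] (β : Ser X →ₗ[k[X]] Ser Y →ₗ[k[X]] Ser Z)
    (h : ∀ f g, β f g 0 = 0) :
    ∃ β' : Ser X →ₗ[k[X]] Ser Y →ₗ[k[X]] Ser Z, β = (Polynomial.X : k[X]) • β' := by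
  refine ⟨Ser.bil (Ser.mk fun n => Ser.coef₂ β (n + 1)), ?_⟩
  have h1 := Ser.eq_X_smul k (Ser.coef₂ β) (by ext x y; exact h _ _)
  have h2 := Ser.bil_coef₂ β
  rw [h1, Ser.bil, map_smul, LinearMap.comp_smul] at h2
  exact h2.symm

variable {𝓤 A : Type*} [Ring A] [Algebra k A] [Van 𝓤 A]

theorem exists_sub_one_eq {φ : Module.End k[X] (Ser A)} (h : ∀ f, φ f 0 = f 0) :
    ∃ ν : Module.End k[X] (Ser A), φ - 1 = (Polynomial.X : k[X]) • ν :=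
  exists_eq_X_smul_hom (φ - 1) fun f => by simp [h]

theorem coeff_zero_of_sub_one {φ : Module.End k[X] (Ser A)}
    (h : ∃ ν : Module.End k[X] (Ser A), φ - 1 = (Polynomial.X : k[X]) • ν) (f : Ser A) :
    φ f 0 = f 0 := by
  obtain ⟨ν, hν⟩ := h
  have := congrArg (fun g : Ser A => g 0) (LinearMap.congr_fun hν f)
  simp only [LinearMap.sub_apply, Module.End.one_apply, Ser.sub_apply, LinearMap.smul_apply,
    Ser.X_smul_zero] at this
  exact sub_eq_zero.1 this

/-- A local formal operator with leading term the identity has a local square root. -/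
theorem exists_local_sqrt [Invertible (2 : k)] (hA : IsLoc₂ 𝓤 fun a b : A => a * b)
    (φ : Module.End k[X] (Ser A)) (lφ : IsLoc 𝓤 φ)
    (h0 : ∀ f, φ f 0 = f 0) :
    ∃ ρ : Module.End k[X] (Ser A), IsLoc 𝓤 ρ ∧ (∀ f, ρ f 0 = f 0) ∧ ρ * ρ = φ := by
  obtain ⟨ρ, hρ1, hρ, hC⟩ := exists_sqrt (k := k) _ half_add_half φ (exists_sub_one_eq h0)
  refine ⟨ρ, ?_, coeff_zero_of_sub_one hρ1, hρ⟩
  refine hC (fun p => IsLoc 𝓤 p) (fun u f hf => hf) (fun p hp u f hf => ?_) fun q hq u f hf n => ?_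
  -- Closure under 1/2 is not part of the vanishing structure; it comes from locality of the
  -- product, by writing (1/2) g as a product with (1/2) 1.
  · have hc : ∀ g : Ser A, g ∈ Van.van u → (Polynomial.C ⅟2 : k[X]) • g ∈ Van.van u := by
      intro g hg n
      have : (Polynomial.C ⅟2 : k[X]) • g = (⅟2 : k) • g := algebraMap_smul k[X] (⅟2 : k) g
      rw [this, Ser.smul_apply, ← one_mul (g n), ← smul_mul_assoc]
      exact hA u _ _ (Or.inr (hg n))
    exact add_mem (hp u f hf) (hc _ (sub_mem (lφ u f hf) (hp u _ (hp u f hf))))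
  · obtain ⟨p, hp, w, hw⟩ := hq n
    have := Ser.exists_eq_X_pow_smul.1 ⟨w f, LinearMap.congr_fun hw f⟩ n (by omega : n < n + 1)
    rw [sub_eq_zero.1 this]
    exact hp u f hf n

theorem eq_zero_of_eq_neg [Invertible (2 : k)] {a : A} (h : a = -a) : a = 0 := by
  have h2 : (2 : k) • a = 0 := by
    rw [two_smul]
    nth_rewrite 1 [h]
    exact neg_add_cancel a
  rw [← one_smul k a, ← invOf_mul_self (2 : k), mul_smul, h2, smul_zero]

/-- The square root of an automorphism is an automorphism. -/
theorem sqrt_multiplicative [Invertible (2 : k)] (D : FormalProduct k A)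
    (ρ : Module.End k[X] (Ser A)) (h0 : ∀ f, ρ f 0 = f 0)
    (h : ∀ f g, ρ (ρ (D.mul f g)) = D.mul (ρ (ρ f)) (ρ (ρ g))) (f g : Ser A) :
    ρ (D.mul f g) = D.mul (ρ f) (ρ g) := by
  -- β measures the failure of multiplicativity. As ρ² is multiplicative, ρ β(f, g) = -β(ρ f, ρ g),
  -- which modulo λ says β = -β; hence β is divisible by λ, and the quotient satisfies the same
  -- identity.
  let β : Ser A →ₗ[k[X]] Ser A →ₗ[k[X]] Ser A := D.mul.compr₂ ρ - D.mul.compl₁₂ ρ ρ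
  have hβ : ∀ f g, β f g = ρ (D.mul f g) - D.mul (ρ f) (ρ g) := fun f g => rfl
  have h1 : β = 0 := by
    refine XSep.coind (k := k) (fun β : Ser A →ₗ[k[X]] Ser A →ₗ[k[X]] Ser A =>
      ∀ f g, ρ (β f g) = -β (ρ f) (ρ g)) (fun β hβ => ?_) _ fun f g => ?_
    · obtain ⟨γ, rfl⟩ := exists_eq_X_smul_bilin β fun f g => by
        refine eq_zero_of_eq_neg (k := k) ?_
        have h2 := congrArg (fun f : Ser A => f 0) (hβ f g)
        simp only [h0, Ser.neg_apply] at h2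
        have h3 : β (ρ f) (ρ g) 0 = β f g 0 := by
          have h4 : ∀ f g, β f g 0 = β (Ser.const (f 0)) (Ser.const (g 0)) 0 := fun f g => by
            rw [Ser.apply_zero (β f) g, ← LinearMap.flip_apply, Ser.apply_zero _ f]; rfl
          rw [h4, h0, h0, ← h4]
        rw [← h3, ← h2, h3]
      refine ⟨γ, fun f g => XSep.cancel (k := k) (ρ (γ f g)) _ ?_, rfl⟩
      simpa using hβ f g
    · rw [hβ, hβ, map_sub, h]; abel
  exact sub_eq_zero.1 ((hβ f g).symm.trans (by rw [h1]; rfl))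

/-! ### Making an equivalence compatible with the involution. -/

section Dagger

variable [StarRing k] (st : A →+ A) (hst : ∀ a, st (st a) = a)
  (hsm : ∀ (c : k) a, st (c • a) = star c • st a)

/-- The conjugate of a formal operator by an involution. -/
def dagger (φ : Ser A →ₗ[k[X]] Ser A) : Ser A →ₗ[k[X]] Ser A :=
  Ser.mkLin
    { toFun := fun f => Ser.mapAdd st (φ (Ser.mapAdd st f))
      map_add' := fun f g => by simp
      map_smul' := fun c f => by
        have hS : ∀ (c : k) f, Ser.mapAdd st (c • f) = star c • Ser.mapAdd st f := fun c f => by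
          ext n; exact hsm _ _
        simp only [hS, LinearMap.map_smul_of_tower, star_star, RingHom.id_apply] }
    (fun f => by
      rw [← Ser.X_smul]
      simp only [LinearMap.coe_mk, AddHom.coe_mk, Ser.mapAdd_X_smul, map_smul])

include hst hsm in
/-- Equivalent Hermitian products are equivalent through a map that preserves the involution. -/
theorem exists_hermitian_equiv [Invertible (2 : k)] (lst : IsLoc 𝓤 st) {D₁ D₂ : FormalProduct k A}
    (hD : IsLoc₂ 𝓤 fun f g => D₁.mul f g)
    (h₁ : D₁.IsHermitian st) (h₂ : D₂.IsHermitian st) (h : EquivLoc 𝓤 D₁ D₂) :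
    ∃ φ : Ser A →ₗ[k[X]] Ser A, IsLoc 𝓤 φ ∧ (∀ f, φ f 0 = f 0) ∧
      (∀ f g, φ (D₁.mul f g) = D₂.mul (φ f) (φ g)) ∧
      ∀ f, φ (Ser.mapAdd st f) = Ser.mapAdd st (φ f) := by
  obtain ⟨T, lT, hT0, hT⟩ := h
  obtain ⟨U, lU, hU0, hUT, hTU⟩ := Ser.exists_inverse T hT0 lT
  have hss : ∀ f, Ser.mapAdd st (Ser.mapAdd st f) = f := fun f => by ext n; simp [hst]
  have lS : IsLoc 𝓤 (Ser.mapAdd st) := fun u f hf n => lst u _ (hf n)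
  let d := dagger st hsm
  have hd : ∀ φ f, d φ f = Ser.mapAdd st (φ (Ser.mapAdd st f)) := fun _ _ => rfl
  have hd0 : ∀ φ, (∀ f, φ f 0 = f 0) → ∀ f, d φ f 0 = f 0 := fun φ h f => by
    rw [hd, Ser.mapAdd_apply, h, Ser.mapAdd_apply, hst]
  have ld : ∀ φ : Ser A →ₗ[k[X]] Ser A, IsLoc 𝓤 φ → IsLoc 𝓤 (d φ) := fun φ h u f hf => by
    rw [hd]; exact lS u _ (h u _ (lS u _ hf))
  have hdT : ∀ f g, d T (D₁.mul f g) = D₂.mul (d T f) (d T g) := fun f g => by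
    rw [hd, FormalProduct.isHermitian_iff.1 h₁, hT, FormalProduct.isHermitian_iff.1 h₂]; rfl
  have hU : ∀ f g, U (D₂.mul f g) = D₁.mul (U f) (U g) := fun f g => by
    conv_lhs => rw [← hTU f, ← hTU g, ← hT, hUT]
  -- ρ = √(T⁻¹T†). The operator under the root is an automorphism of the first product, so ρ is one
  -- as well.
  obtain ⟨ρ, lρ, hρ0, hρ⟩ := exists_local_sqrt (FormalProduct.isLoc₂_mul_of_local hD) (U ∘ₗ d T)
    (fun u f hf => lU u _ (ld T lT u f hf)) (fun f => by rw [LinearMap.comp_apply, hU0, hd0 T hT0])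
  have hρ' : ∀ f, ρ (ρ f) = U (d T f) := fun f => LinearMap.congr_fun hρ f
  obtain ⟨σ, lσ, hσ0, hσρ, hρσ⟩ := Ser.exists_inverse ρ hρ0 lρ
  have hρm : ∀ f g, ρ (D₁.mul f g) = D₁.mul (ρ f) (ρ g) :=
    sqrt_multiplicative D₁ ρ hρ0 fun f g => by rw [hρ', hρ', hρ', hdT, hU]
  -- ρ† and ρ⁻¹ are both square roots of (T†)⁻¹T, so they coincide by uniqueness.
  have hdρ : d ρ = σ := by
    refine sqrt_unique (N := Module.End k[X] (Ser A)) _ half_add_half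
      (exists_sub_one_eq (hd0 ρ hρ0)) (exists_sub_one_eq hσ0) (LinearMap.ext fun f => ?_)
    change d ρ (d ρ f) = σ (σ f)
    have h1 : d ρ (d ρ f) = Ser.mapAdd st (U (Ser.mapAdd st (T f))) := by
      rw [hd, hd, hss, hρ', hd, hss]
    have h2 : ρ (ρ (d ρ (d ρ f))) = f := by
      rw [hρ', h1, hd, hss, hTU, hss, hUT]
    rw [← h2, hσρ, hσρ]
    rw [h2]
  -- (Tρ)† = T†ρ⁻¹ = Tρ²ρ⁻¹ = Tρ.
  refine ⟨T ∘ₗ ρ, fun u f hf => lT u _ (lρ u _ hf), fun f => ?_, fun f g => ?_, fun f => ?_⟩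
  · rw [LinearMap.comp_apply, hT0, hρ0]
  · simp only [LinearMap.comp_apply, hρm, hT]
  · simp only [LinearMap.comp_apply]
    have h3 : d ρ (Ser.mapAdd st f) = σ (Ser.mapAdd st f) := by rw [hdρ]
    rw [hd, hss] at h3
    have h4 : T (ρ (ρ (σ (Ser.mapAdd st f)))) = d T (σ (Ser.mapAdd st f)) := by
      rw [hρ', hTU]
    rw [hρσ, hd, ← h3, hss] at h4
    exact h4

end Dagger

end Sqrt

/-! ### Comparison of supports and vanishing -/

section Supports

open Van TopologicalSpace

variable {k : Type*} [CommRing k] {A : Type*} [Ring A] [Algebra k A]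
variable {M : Type*} [TopologicalSpace M] {W : M → Type*} [∀ x, AddCommGroup (W x)]
variable [Van (Opens M) A] {ev : ∀ x, A →+ W x}
  (hv : ∀ (U : Opens M) (a : A), a ∈ van U ↔ ∀ x ∈ U, ev x a = 0)

include hv in
-- The complement of the support of b is the largest open set on which b vanishes. This turns
-- support conditions into preservation of vanishing on open sets, which passes through sums and
-- compositions.
theorem supp_subset_iff (a b : A) :
    supp ev a ⊆ supp ev b ↔ ∀ U : Opens M, b ∈ van U → a ∈ van U := by
  refine ⟨fun h U hb => (hv U a).2 fun x hx => ?_, fun h => ?_⟩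
  · by_contra hne
    obtain ⟨y, hyU, hy⟩ := mem_closure_iff.1 (h (subset_closure hne)) U U.isOpen hx
    exact hy ((hv U b).1 hb y hyU)
  · refine closure_minimal (fun x hx => ?_) isClosed_closure
    by_contra hxb
    refine hx ((hv ⟨(supp ev b)ᶜ, isClosed_closure.isOpen_compl⟩ a).1
      (h _ ((hv _ b).2 fun y hy => ?_)) x hxb)
    by_contra hne
    exact hy (subset_closure hne)

include hv in
theorem isLocal_iff (D : FormalProduct k A) :
    D.IsLocal ev ↔ IsLoc₂ (Opens M) fun f g => D.mul f g := by
  refine Iff.trans ?_ Ser.isLoc₂_bil_iff.symm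
  refine forall_congr' fun r => ⟨fun h U a b hab => ?_, fun h a b => Set.subset_inter ?_ ?_⟩
  · rcases hab with ha | hb
    · exact (supp_subset_iff hv _ _).1 ((h a b).trans Set.inter_subset_left) U ha
    · exact (supp_subset_iff hv _ _).1 ((h a b).trans Set.inter_subset_right) U hb
  · exact (supp_subset_iff hv _ _).2 fun U ha => h U a b (Or.inl ha)
  · exact (supp_subset_iff hv _ _).2 fun U hb => h U a b (Or.inr hb)

theorem toSer_formalMap (T : (Module.End k A)⟦X⟧) (f : A⟦X⟧) :
    toSer (formalMap T f) = Ser.lin (k := k) (X := A) (Y := A) (toSer T) (toSer f) := by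
  ext n
  rw [Ser.lin_apply]
  exact PowerSeries.coeff_mk _ _

/-- The dictionary `lin`/`coef` between series of operators and k[λ]-linear maps; the condition on
coefficients remains explicit, so the local and the Hermitian case are both covered. -/
theorem equivVia_iff (S : Subring (Module.End k A)) (D D' : FormalProduct k A) :
    EquivVia S D D' ↔ ∃ φ : Ser A →ₗ[k[X]] Ser A, (∀ n, Ser.coef φ n ∈ S) ∧ (∀ f, φ f 0 = f 0) ∧
      ∀ f g, φ (D.mul f g) = D'.mul (φ f) (φ g) := by
  constructor
  · rintro ⟨T, hT0, hT, hm⟩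
    refine ⟨Ser.lin (k := k) (X := A) (Y := A) (toSer T), fun n => ?_, fun f => ?_, fun f g => ?_⟩
    · convert hT n using 1
      exact LinearMap.ext fun a => by rw [Ser.coef_apply, Ser.lin_const]; rfl
    · rw [Ser.lin_apply]
      simp [hT0]
    · have := congrArg toSer (hm (ofSer f) (ofSer g))
      simpa only [toSer_formalMap, FormalProduct.toSer_star, toSer_ofSer] using this
  · rintro ⟨φ, hφ, h0, hm⟩
    have hl : toSer (ofSer (Ser.coef φ) : (Module.End k A)⟦X⟧) = Ser.coef φ := toSer_ofSer _
    have hc : ∀ r, PowerSeries.coeff r (ofSer (Ser.coef φ) : (Module.End k A)⟦X⟧) = Ser.coef φ r :=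
      fun r => congrFun hl r
    refine ⟨ofSer (Ser.coef φ), ?_, fun r => ?_, fun f g => toSer_injective ?_⟩
    · refine LinearMap.ext fun a => ?_
      rw [hc, Ser.coef_apply, h0]; rfl
    · rw [hc]; exact hφ r
    · simp only [toSer_formalMap, FormalProduct.toSer_star, hl, Ser.lin_coef, hm]

include hv in
theorem mem_localOps_iff (T : Module.End k A) : T ∈ localOps k ev ↔ IsLoc (Opens M) T :=
  ⟨fun h U a ha => (supp_subset_iff hv _ _).1 (h a) U ha,
    fun h a => (supp_subset_iff hv _ _).2 fun U ha => h U a ha⟩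

theorem isLoc_coef_iff (φ : Ser A →ₗ[k[X]] Ser A) :
    (∀ n, IsLoc (Opens M) (Ser.coef φ n)) ↔ IsLoc (Opens M) φ := by
  rw [← Ser.isLoc_lin_iff, Ser.lin_coef]

theorem coef_comm_iff (st : A →+ A) (φ : Ser A →ₗ[k[X]] Ser A) :
    (∀ n a, Ser.coef φ n (st a) = st (Ser.coef φ n a)) ↔
      ∀ f, φ (Ser.mapAdd st f) = Ser.mapAdd st (φ f) := by
  refine ⟨fun h f => ?_, fun h n a => ?_⟩
  · rw [← Ser.lin_coef φ]
    ext n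
    rw [Ser.mapAdd_apply, Ser.lin_apply, Ser.lin_apply, map_sum]
    exact Finset.sum_congr rfl fun p _ => h _ _
  · rw [Ser.coef_apply, Ser.coef_apply, ← Ser.mapAdd_const, h, Ser.mapAdd_apply]

include hv in
theorem equivVia_localOps_iff (D D' : FormalProduct k A) :
    EquivVia (localOps k ev) D D' ↔ EquivLoc (Opens M) D D' := by
  rw [equivVia_iff]
  refine exists_congr fun φ => and_congr_left fun _ => ?_
  simp only [mem_localOps_iff hv]
  exact isLoc_coef_iff φ

/-- Equivalence of formal products through local maps that preserve the involution. -/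
def HermEquivLoc (𝓤 : Type*) [Van 𝓤 A] (st : A →+ A) (D D' : FormalProduct k A) : Prop :=
  ∃ φ : Ser A →ₗ[k[X]] Ser A, IsLoc 𝓤 φ ∧ (∀ f, φ f 0 = f 0) ∧
    (∀ f g, φ (D.mul f g) = D'.mul (φ f) (φ g)) ∧ ∀ f, φ (Ser.mapAdd st f) = Ser.mapAdd st (φ f)

theorem HermEquivLoc.equivLoc {A : Type*} [Ring A] [Algebra k A] {𝓤 : Type*} [Van 𝓤 A]
    {st : A →+ A} {D D' : FormalProduct k A} (h : HermEquivLoc 𝓤 st D D') :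
    EquivLoc 𝓤 D D' := by
  obtain ⟨φ, h1, h2, h3, -⟩ := h
  exact ⟨φ, h1, h2, h3⟩

include hv in
theorem equivVia_hermLocalOps_iff (st : A →+ A) (D D' : FormalProduct k A) :
    EquivVia (hermLocalOps k ev st) D D' ↔ HermEquivLoc (Opens M) st D D' := by
  rw [equivVia_iff]
  refine exists_congr fun φ => ?_
  have : (∀ n, Ser.coef φ n ∈ hermLocalOps k ev st) ↔ IsLoc (Opens M) φ ∧
      ∀ f, φ (Ser.mapAdd st f) = Ser.mapAdd st (φ f) := by
    rw [← coef_comm_iff, ← isLoc_coef_iff, ← forall_and]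
    refine forall_congr' fun n => and_congr_left fun _ => ?_
    exact mem_localOps_iff hv _
  rw [this]
  tauto

end Supports

/-! ### The correspondence of deformations -/

section Correspondence

open Van TopologicalSpace

variable {k : Type*} [CommRing k]
variable {M : Type*} [TopologicalSpace M] {W W' : M → Type*} [∀ x, AddCommGroup (W x)]
  [∀ x, AddCommGroup (W' x)]
variable {R S E : Type*} [CommRing R] [Algebra k R] [Ring S] [Algebra k S]
  [AddCommGroup E] [Module k E] [Van (Opens M) R] [Van (Opens M) S] [Van (Opens M) E]

theorem FormalProduct.isLoc₂_op {𝓤 : Type*} [Van 𝓤 R] {D : FormalProduct k R}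
    (hD : IsLoc₂ 𝓤 fun f g => D.mul f g) : IsLoc₂ 𝓤 fun f g => D.op.mul f g :=
  fun u f g h => by
    change D.op.mul f g ∈ van u
    rw [FormalProduct.mul_op]
    exact hD u g f h.symm

theorem EquivLoc.op {𝓤 : Type*} [Van 𝓤 R] {D D' : FormalProduct k R} (h : EquivLoc 𝓤 D D') :
    EquivLoc 𝓤 D.op D'.op := by
  obtain ⟨φ, l, h0, hm⟩ := h
  exact ⟨φ, l, h0, fun f g => by rw [FormalProduct.mul_op, FormalProduct.mul_op, hm]⟩

theorem FormalProduct.mul_ext {A : Type*} [Ring A] [Algebra k A] {D D' : FormalProduct k A}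
    (h : D.mul = D'.mul) : D = D' := by
  have : D.cochain = D'.cochain := by
    ext n a b
    rw [← D.mul_const, ← D'.mul_const, h]
  cases D; cases D'; cases this; rfl

theorem FormalProduct.op_op (D : FormalProduct k R) : D.op.op = D :=
  FormalProduct.mul_ext (LinearMap.ext fun f => LinearMap.ext fun g => by
    rw [mul_op, mul_op])

theorem EquivLoc.of_op {𝓤 : Type*} [Van 𝓤 R] {D D' : FormalProduct k R}
    (h : EquivLoc 𝓤 D.op D'.op) : EquivLoc 𝓤 D D' := by
  simpa only [FormalProduct.op_op] using h.op

theorem FormalProduct.IsUnital.op {D : FormalProduct k R} (h : D.IsUnital) : D.op.IsUnital := by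
  rw [FormalProduct.isUnital_iff] at h ⊢
  exact fun f => by rw [mul_op, mul_op]; exact (h f).symm

theorem FormalProduct.IsHermitian.op {D : FormalProduct k R} {σ : R →+ R} (h : D.IsHermitian σ) :
    D.op.IsHermitian σ := by
  rw [FormalProduct.isHermitian_iff] at h ⊢
  exact fun f g => by rw [mul_op, mul_op]; exact h g f

variable {b : Bimod k (Opens M) R S E} (B : DualBasis b) (B' : DualBasis b.swap)

theorem Bimod.Deforms.congr_right {𝓤 R S E : Type*} [Ring R] [Algebra k R] [Ring S]
    [Algebra k S] [AddCommGroup E] [Module k E] [Van 𝓤 R] [Van 𝓤 S] [Van 𝓤 E]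
    {b : Bimod k 𝓤 R S E} {D : FormalProduct k R} {D₁ D₂ : FormalProduct k S}
    (h : b.Deforms D D₁) (e : EquivLoc 𝓤 D₁ D₂) : b.Deforms D D₂ :=
  (h.swap.congr_left e.symm).swap

theorem DualBasis.exists_deforms {𝓤 R S E : Type*} [Ring R] [Algebra k R] [Ring S]
    [Algebra k S] [AddCommGroup E] [Module k E] [Van 𝓤 R] [Van 𝓤 S] [Van 𝓤 E]
    {b : Bimod k 𝓤 R S E} (B : DualBasis b) {D : FormalProduct k R}
    (hD : IsLoc₂ 𝓤 fun f g => D.mul f g) :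
    ∃ D' : FormalProduct k S, IsLoc₂ 𝓤 (fun f g => D'.mul f g) ∧ b.Deforms D D' := by
  obtain ⟨P, hP, hP0, -⟩ := D.exists_matMul_idempotent B.proj B.proj_mul_proj
  obtain ⟨D', l, -, -, h⟩ := B.exists_corner_mul hD hP hP0
  exact ⟨D', l, B.deforms_corner hD hP hP0 h⟩

theorem exists_unital_equiv [Invertible (2 : k)] {A : Type*} [Ring A] [Algebra k A] {𝓤 : Type*} [Van 𝓤 A]
    {D : FormalProduct k A} (hD : IsLoc₂ 𝓤 fun f g => D.mul f g) :
    ∃ D' : FormalProduct k A, IsLoc₂ 𝓤 (fun f g => D'.mul f g) ∧ D'.IsUnital ∧ EquivLoc 𝓤 D D' := by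
  obtain ⟨D', l, hu, φ, lφ, h0, hm, -⟩ := D.exists_unital hD
  exact ⟨D', l, hu, EquivLoc.symm ⟨φ, lφ, h0, hm⟩⟩

include B B' in
/-- The correspondence of local deformations through deformations of the bimodule. -/
theorem exists_bijective_def [Invertible (2 : k)] {ev : ∀ x, R →+ W x} {ev' : ∀ x, S →+ W' x}
    (hv : ∀ (U : Opens M) (a : R), a ∈ van U ↔ ∀ x ∈ U, ev x a = 0)
    (hv' : ∀ (U : Opens M) (a : S), a ∈ van U ↔ ∀ x ∈ U, ev' x a = 0) :
    ∃ Φ : Def k ev → Def k ev', Function.Bijective Φ ∧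
      ∀ (D : LocalDef k ev) (D' : LocalDef k ev'),
        b.Deforms D.toFormalProduct.op D'.toFormalProduct → Φ D.cls = D'.cls := by
  -- Well-definedness: equivalent products on R may be exchanged in the relation, and the class on S
  -- is then unique.
  have key : ∀ (D₁ D₂ : LocalDef k ev) (D₁' D₂' : LocalDef k ev'), D₁.cls = D₂.cls →
      b.Deforms D₁.toFormalProduct.op D₁'.toFormalProduct →
      b.Deforms D₂.toFormalProduct.op D₂'.toFormalProduct → D₁'.cls = D₂'.cls := by
    intro D₁ D₂ D₁' D₂' h h₁ h₂
    have e : EquivLoc (Opens M) D₁.toFormalProduct D₂.toFormalProduct :=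
      (equivVia_localOps_iff hv _ _).1 (Quotient.exact h)
    refine Quotient.sound ((equivVia_localOps_iff hv' _ _).2 ?_)
    exact B.deforms_unique (FormalProduct.isLoc₂_op ((isLocal_iff hv _).1 D₁.isLocal)) h₁
      (h₂.congr_left e.op)
  have hex : ∀ D : LocalDef k ev, ∃ D' : LocalDef k ev',
      b.Deforms D.toFormalProduct.op D'.toFormalProduct := fun D => by
    obtain ⟨D₁, l₁, h₁⟩ := B.exists_deforms
      (FormalProduct.isLoc₂_op ((isLocal_iff hv _).1 D.isLocal))
    obtain ⟨D', l', hu, e⟩ := exists_unital_equiv l₁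
    exact ⟨⟨D', hu, (isLocal_iff hv' _).2 l'⟩, h₁.congr_right e⟩
  choose G hG using hex
  refine ⟨Quotient.lift (fun D => (G D).cls) fun D₁ D₂ h =>
    key _ _ _ _ (Quotient.sound h) (hG D₁) (hG D₂), ⟨?_, ?_⟩, fun D D' h => key _ _ _ _ rfl (hG D) h⟩
  -- Injectivity is uniqueness for the interchanged bimodule.
  · rintro ⟨D₁⟩ ⟨D₂⟩ h
    have e : EquivLoc (Opens M) (G D₁).toFormalProduct (G D₂).toFormalProduct :=
      (equivVia_localOps_iff hv' _ _).1 (Quotient.exact h)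
    refine Quotient.sound ((equivVia_localOps_iff hv _ _).2 (EquivLoc.of_op ?_))
    exact B'.deforms_unique ((isLocal_iff hv' _).1 (G D₁).isLocal) (hG D₁).swap
      ((hG D₂).swap.congr_left e)
  -- Surjectivity is existence for the interchanged bimodule. The product found on R is made unital
  -- and then reversed, because the relation is imposed on the opposite product.
  · rintro ⟨D'⟩
    obtain ⟨D₁, l₁, h₁⟩ := B'.exists_deforms ((isLocal_iff hv' _).1 D'.isLocal)
    obtain ⟨D, l, hu, e⟩ := exists_unital_equiv l₁
    let D₀ : LocalDef k ev :=
      { toFormalProduct := D.op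
        unital := hu.op
        isLocal := (isLocal_iff hv _).2 (FormalProduct.isLoc₂_op l) }
    have h₀ : b.Deforms D₀.toFormalProduct.op D'.toFormalProduct := by
      have h₂ := (h₁.congr_right e).swap
      rw [← D.op_op] at h₂
      exact h₂
    exact ⟨D₀.cls, key D₀ D₀ _ D' rfl (hG D₀) h₀⟩

/-- Local conjugate-linear involutions. -/
structure IsInvol (k 𝓤 : Type*) [CommRing k] [StarRing k] {A : Type*} [Ring A] [Algebra k A]
    [Van 𝓤 A] (st : A →+ A) : Prop where
  mul : ∀ a b, st (a * b) = st b * st a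
  invol : ∀ a, st (st a) = a
  smul : ∀ (c : k) a, st (c • a) = star c • st a
  loc : IsLoc 𝓤 st

theorem HermEquivLoc.symm {A : Type*} [Ring A] [Algebra k A] {𝓤 : Type*} [Van 𝓤 A]
    {st : A →+ A} {D D' : FormalProduct k A} (h : HermEquivLoc 𝓤 st D D') :
    HermEquivLoc 𝓤 st D' D := by
  obtain ⟨φ, l, h0, hm, hs⟩ := h
  obtain ⟨ψ, hl, h0', h1, h2⟩ := Ser.exists_inverse φ h0 l
  refine ⟨ψ, hl, h0', fun f g => ?_, fun f => ?_⟩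
  · conv_lhs => rw [← h2 f, ← h2 g, ← hm, h1]
  · conv_lhs => rw [← h2 f, ← hs, h1]

theorem exists_unital_hermEquiv [Invertible (2 : k)] [StarRing k] {A : Type*} [Ring A]
    [Algebra k A] {𝓤 : Type*} [Van 𝓤 A] {st : A →+ A} (hst : IsInvol k 𝓤 st)
    {D : FormalProduct k A} (hD : IsLoc₂ 𝓤 fun f g => D.mul f g) (h : D.IsHermitian st) :
    ∃ D' : FormalProduct k A, IsLoc₂ 𝓤 (fun f g => D'.mul f g) ∧ D'.IsUnital ∧
      D'.IsHermitian st ∧ HermEquivLoc 𝓤 st D D' := by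
  obtain ⟨D', l, hu, φ, lφ, h0, hm, hs⟩ := D.exists_unital hD
  -- The conjugate-linear involution has to commute with the factor 1/2 in the symmetrized product.
  have h2 : star (⅟2 : k) = ⅟2 := by
    have h3 : star (⅟2 : k) * 2 = 1 := by
      have h4 : star (2 : k) = 2 := star_ofNat 2
      calc star (⅟2 : k) * 2 = star (⅟2 : k) * star 2 := by rw [h4]
        _ = 1 := by rw [← star_mul, mul_invOf_self, star_one]
    rw [← mul_one (star (⅟2 : k)), ← mul_invOf_self (2 : k), ← _root_.mul_assoc, h3, one_mul]
  have hφ := hs st hst.mul hst.invol (fun a => by rw [hst.smul, h2]) h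
  obtain ⟨ψ, -, -, h1, -⟩ := Ser.exists_inverse φ h0 lφ
  refine ⟨D', l, hu, FormalProduct.isHermitian_iff.2 fun f g =>
    Function.LeftInverse.injective h1 ?_, HermEquivLoc.symm ⟨φ, lφ, h0, hm, hφ⟩⟩
  rw [hφ, hm, FormalProduct.isHermitian_iff.1 h, hm, hφ, hφ]

/-- A dual basis for which the matrices of adjoint elements are adjoint. -/
structure DualBasis.IsAdjoint {𝓤 R S E : Type*} [Ring R] [Algebra k R] [Ring S] [Algebra k S]
    [AddCommGroup E] [Module k E] [Van 𝓤 R] [Van 𝓤 S] [Van 𝓤 E] {b : Bimod k 𝓤 R S E}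
    (B : DualBasis b) (σ : R →+ R) (st : S →+ S) : Prop where
  proj : ∀ i j, σ (B.proj j i) = B.proj i j
  adj : ∀ s i j, B.ξ j (b.aS (st s) (B.x i)) = σ (B.ξ i (b.aS s (B.x j)))

theorem DualBasis.IsAdjoint.exists_idempotent {𝓤 R S E : Type*} [Ring R] [Algebra k R] [Ring S]
    [Algebra k S] [AddCommGroup E] [Module k E] [Van 𝓤 R] [Van 𝓤 S] [Van 𝓤 E]
    {b : Bimod k 𝓤 R S E} {B : DualBasis b} {σ : R →+ R} {st : S →+ S} (hB : B.IsAdjoint σ st)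
    {D : FormalProduct k R} (h : D.IsHermitian σ) :
    ∃ P : Matrix (Fin B.n) (Fin B.n) (Ser R), D.matMul P P = P ∧ (∀ i j, P i j 0 = B.proj i j) ∧
      ∀ i j, Ser.mapAdd σ (P j i) = P i j := by
  obtain ⟨P, hP, hP0, hPs⟩ := D.exists_matMul_idempotent B.proj B.proj_mul_proj
  exact ⟨P, hP, hP0, hPs (Ser.mapAdd σ) (Ser.mapAdd_X_smul σ) (FormalProduct.isHermitian_iff.1 h)
    fun i j => by rw [Ser.mapAdd_const, hB.proj]⟩

theorem DualBasis.IsAdjoint.exists_deforms {𝓤 R S E : Type*} [Ring R] [Algebra k R] [Ring S]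
    [Algebra k S] [AddCommGroup E] [Module k E] [Van 𝓤 R] [Van 𝓤 S] [Van 𝓤 E]
    {b : Bimod k 𝓤 R S E} {B : DualBasis b} {σ : R →+ R} {st : S →+ S} (hB : B.IsAdjoint σ st)
    {D : FormalProduct k R} (hD : IsLoc₂ 𝓤 fun f g => D.mul f g) (h : D.IsHermitian σ) :
    ∃ D' : FormalProduct k S, IsLoc₂ 𝓤 (fun f g => D'.mul f g) ∧ D'.IsHermitian st ∧
      b.Deforms D D' := by
  obtain ⟨P, hP, hP0, hPs⟩ := hB.exists_idempotent h
  obtain ⟨D', l, hinj, -, hm⟩ := B.exists_corner_mul hD hP hP0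
  exact ⟨D', l, B.isHermitian_corner hinj hm h hPs hB.adj, B.deforms_corner hD hP hP0 hm⟩

/-- By `exists_hermitian_equiv` the involution imposes nothing on equivalences between Hermitian
products, so the uniqueness results without involution serve the Hermitian correspondence too. -/
theorem HermLocalDef.equiv_iff [Invertible (2 : k)] [StarRing k] {A : Type*} [Ring A]
    [Algebra k A] [Van (Opens M) A] {ev : ∀ x, A →+ W x}
    (hv : ∀ (U : Opens M) (a : A), a ∈ van U ↔ ∀ x ∈ U, ev x a = 0) {st : A →+ A}
    (hst : IsInvol k (Opens M) st) (D₁ D₂ : HermLocalDef k ev st) :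
    D₁.cls = D₂.cls ↔ EquivLoc (Opens M) D₁.toFormalProduct D₂.toFormalProduct := by
  refine ⟨fun h => ?_, fun h => Quotient.sound ((equivVia_hermLocalOps_iff hv _ _ _).2 ?_)⟩
  · exact ((equivVia_hermLocalOps_iff hv _ _ _).1 (Quotient.exact h)).equivLoc
  · exact exists_hermitian_equiv st hst.invol hst.smul hst.loc ((isLocal_iff hv _).1 D₁.isLocal)
      D₁.hermitian D₂.hermitian h

/-- The correspondence of local Hermitian deformations through deformations of the bimodule. -/
theorem exists_bijective_hermDef [Invertible (2 : k)] [StarRing k] {ev : ∀ x, R →+ W x}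
    {ev' : ∀ x, S →+ W' x}
    (hv : ∀ (U : Opens M) (a : R), a ∈ van U ↔ ∀ x ∈ U, ev x a = 0)
    (hv' : ∀ (U : Opens M) (a : S), a ∈ van U ↔ ∀ x ∈ U, ev' x a = 0)
    {σ : R →+ R} {st : S →+ S} (hσ : IsInvol k (Opens M) σ) (hst : IsInvol k (Opens M) st)
    (hB : B.IsAdjoint σ st) (hB' : B'.IsAdjoint st σ) :
    ∃ Φ : HermDef k ev σ → HermDef k ev' st, Function.Bijective Φ ∧
      ∀ (D : HermLocalDef k ev σ) (D' : HermLocalDef k ev' st),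
        b.Deforms D.toFormalProduct.op D'.toFormalProduct → Φ D.cls = D'.cls := by
  have key : ∀ (D₁ D₂ : HermLocalDef k ev σ) (D₁' D₂' : HermLocalDef k ev' st), D₁.cls = D₂.cls →
      b.Deforms D₁.toFormalProduct.op D₁'.toFormalProduct →
      b.Deforms D₂.toFormalProduct.op D₂'.toFormalProduct → D₁'.cls = D₂'.cls := by
    intro D₁ D₂ D₁' D₂' h h₁ h₂
    have e := (HermLocalDef.equiv_iff hv hσ _ _).1 h
    exact (HermLocalDef.equiv_iff hv' hst _ _).2
      (B.deforms_unique (FormalProduct.isLoc₂_op ((isLocal_iff hv _).1 D₁.isLocal)) h₁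
        (h₂.congr_left e.op))
  have hex : ∀ D : HermLocalDef k ev σ, ∃ D' : HermLocalDef k ev' st,
      b.Deforms D.toFormalProduct.op D'.toFormalProduct := fun D => by
    obtain ⟨D₁, l₁, hh, h₁⟩ := hB.exists_deforms
      (FormalProduct.isLoc₂_op ((isLocal_iff hv _).1 D.isLocal)) D.hermitian.op
    obtain ⟨D', l', hu, hh', e⟩ := exists_unital_hermEquiv hst l₁ hh
    exact ⟨⟨⟨D', hu, (isLocal_iff hv' _).2 l'⟩, hh'⟩, h₁.congr_right e.equivLoc⟩
  choose G hG using hex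
  refine ⟨Quotient.lift (fun D => (G D).cls) fun D₁ D₂ h =>
    key _ _ _ _ (Quotient.sound h) (hG D₁) (hG D₂), ⟨?_, ?_⟩, fun D D' h => key _ _ _ _ rfl (hG D) h⟩
  · rintro ⟨D₁⟩ ⟨D₂⟩ h
    have e := (HermLocalDef.equiv_iff hv' hst (G D₁) (G D₂)).1 h
    exact (HermLocalDef.equiv_iff hv hσ D₁ D₂).2 (EquivLoc.of_op
      (B'.deforms_unique ((isLocal_iff hv' _).1 (G D₁).isLocal) (hG D₁).swap
        ((hG D₂).swap.congr_left e)))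
  · rintro ⟨D'⟩
    obtain ⟨D₁, l₁, hh, h₁⟩ := hB'.exists_deforms ((isLocal_iff hv' _).1 D'.isLocal) D'.hermitian
    obtain ⟨D, l, hu, hh', e⟩ := exists_unital_hermEquiv hσ l₁ hh
    let D₀ : HermLocalDef k ev σ :=
      { toFormalProduct := D.op
        unital := hu.op
        isLocal := (isLocal_iff hv _).2 (FormalProduct.isLoc₂_op l)
        hermitian := hh'.op }
    have h₀ : b.Deforms D₀.toFormalProduct.op D'.toFormalProduct := by
      have h₂ := (h₁.congr_right e.equivLoc).swap
      rw [← D.op_op] at h₂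
      exact h₂
    exact ⟨D₀.cls, key D₀ D₀ _ D' rfl (hG D₀) h₀⟩

end Correspondence

/-! ### Finite families of sections that span the fibres -/

section Spanning

set_option linter.unusedSectionVars false

open Module

variable {d : ℕ} {M : Type*} [TopologicalSpace M] [ChartedSpace (EuclideanSpace ℝ (Fin d)) M]
  {F : Type*} [NormedAddCommGroup F] [NormedSpace ℂ F]
  {V : M → Type*} [TopologicalSpace (TotalSpace F V)]
  [∀ x, AddCommGroup (V x)] [∀ x, Module ℂ (V x)] [∀ x, TopologicalSpace (V x)]
  [FiberBundle F V] [VectorBundle ℂ F V] [VectorBundle ℝ F V]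

/-- The values of the sections `s i` at `x` span the fibre. -/
def SpansAt {ι : Type*} (s : ι → Sect d F V) (x : M) : Prop :=
  ∀ ξ : Dual ℂ (V x), (∀ i, ξ (s i x) = 0) → ξ = 0

variable [FiniteDimensional ℂ F] [IsManifold (𝓡 d) ∞ M] [ContMDiffVectorBundle ∞ F V (𝓡 d)]

/-- The coordinates of a section are smooth. -/
theorem contMDiffAt_coord (s : Sect d F V) (a : M) {x : M}
    (hx : x ∈ (trivializationAt F V a).baseSet) :
    ContMDiffAt (𝓡 d) 𝓘(ℝ, F) ∞ (fun x => (trivializationAt F V a ⟨x, s x⟩).2) x :=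
  ((trivializationAt F V a).contMDiffAt_section_iff hx).1 (s.contMDiff x)

/-- The values of functionals on fewer than sufficiently many sections do not exhaust `ℂᴺ`. -/
theorem exists_generic [SecondCountableTopology M] {N : ℕ} (hN : d + 2 * finrank ℂ F < 2 * N)
    (s : Fin N → Sect d F V) :
    ∃ c : Fin N → ℂ, ∀ (x : M) (ξ : Dual ℂ (V x)), ∃ j, ξ (s j x) ≠ c j := by
  let G := EuclideanSpace ℝ (Fin d) × (F →L[ℂ] ℂ)
  let e : M → Trivialization F (TotalSpace.proj : TotalSpace F V → M) := fun a =>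
    trivializationAt F V a
  -- In a chart and a trivialization: the map (x, ξ) ↦ (ξ(sⱼ(x)))ⱼ from real dimension d + 2 rank E
  -- to real dimension 2N.
  let f : M → G → Fin N → ℂ := fun a p j =>
    p.2 (e a ⟨(chartAt (EuclideanSpace ℝ (Fin d)) a).symm p.1,
      s j ((chartAt (EuclideanSpace ℝ (Fin d)) a).symm p.1)⟩).2
  let D : M → Set G := fun a => ((chartAt (EuclideanSpace ℝ (Fin d)) a).target ∩
    (chartAt (EuclideanSpace ℝ (Fin d)) a).symm ⁻¹' (e a).baseSet) ×ˢ Set.univ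
  have hf : ∀ a, ∀ p ∈ D a, ContDiffAt ℝ 1 (f a) p := by
    rintro a ⟨y, ξ⟩ ⟨⟨hy, hy'⟩, -⟩
    refine contDiffAt_pi.2 fun j => ?_
    let g : EuclideanSpace ℝ (Fin d) → F := fun y =>
      (e a ⟨(chartAt (EuclideanSpace ℝ (Fin d)) a).symm y,
        s j ((chartAt (EuclideanSpace ℝ (Fin d)) a).symm y)⟩).2
    have h1 : ContDiffAt ℝ ∞ g y := by
      rw [← contMDiffAt_iff_contDiffAt]
      exact (contMDiffAt_coord (s j) a hy').comp y ((contMDiffOn_chart_symm y hy).contMDiffAt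
        ((chartAt (EuclideanSpace ℝ (Fin d)) a).open_target.mem_nhds hy))
    have h2 : ContDiffAt ℝ 1 (fun p : G =>
        ContinuousLinearMap.restrictScalarsL ℂ F ℂ ℝ ℝ p.2) (y, ξ) :=
      ((ContinuousLinearMap.restrictScalarsL ℂ F ℂ ℝ ℝ).contDiff.comp contDiff_snd).contDiffAt
    have h3 : ContDiffAt ℝ 1 (g ∘ Prod.fst : G → F) (y, ξ) :=
      ContDiffAt.comp (y, ξ) (h1.of_le (by exact_mod_cast le_top)) contDiffAt_fst
    exact h2.clm_apply h3
  -- C¹ maps do not raise Hausdorff dimension. Countably many charts suffice, so the union of the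
  -- images is too small to be all of ℂᴺ.
  have hdim : ∀ a, dimH (f a '' D a) ≤ (d + 2 * finrank ℂ F : ℕ) := fun a => by
    refine (dimH_image_le_of_locally_lipschitzOn fun p hp => ?_).trans
      ((dimH_mono (Set.subset_univ _)).trans ?_)
    · obtain ⟨C, t, ht, hC⟩ := (hf a p hp).exists_lipschitzOnWith
      exact ⟨C, t, mem_nhdsWithin_of_mem_nhds ht, hC⟩
    · have h1 : finrank ℝ (F →L[ℂ] ℂ) = 2 * finrank ℂ F := by
        rw [finrank_real_of_complex, ← Subspace.dual_finrank_eq (K := ℂ) (V := F)]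
        exact congrArg _ (LinearMap.toContinuousLinearMap (𝕜 := ℂ) (E := F) (F' := ℂ)).finrank_eq.symm
      rw [Real.dimH_univ_eq_finrank, finrank_prod, finrank_euclideanSpace_fin, h1]
  obtain ⟨T, hT, hcov⟩ := TopologicalSpace.countable_cover_nhds (α := M)
    (f := fun a => (chartAt (EuclideanSpace ℝ (Fin d)) a).source ∩ (e a).baseSet)
    fun a => Filter.inter_mem (chart_source_mem_nhds _ a)
      ((e a).open_baseSet.mem_nhds (mem_baseSet_trivializationAt F V a))
  have : Countable T := hT
  have hlt : dimH (⋃ a : T, f a '' D a) < finrank ℝ (Fin N → ℂ) := by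
    rw [dimH_iUnion]
    refine (iSup_le fun a : T => hdim a).trans_lt ?_
    rw [finrank_real_of_complex, finrank_fin_fun]
    exact_mod_cast hN
  obtain ⟨c, hc⟩ := (dense_compl_of_dimH_lt_finrank hlt).nonempty
  refine ⟨c, fun x ξ => ?_⟩
  by_contra! hξ
  refine hc ?_
  obtain ⟨a, ha, hxa⟩ := Set.mem_iUnion₂.1 (hcov.symm ▸ Set.mem_univ x : x ∈ ⋃ a ∈ T, _)
  let φ : F →ₗ[ℂ] ℂ := ξ ∘ₗ ((e a).linearEquivAt ℂ x hxa.2).symm.toLinearMap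
  have hl := (chartAt (EuclideanSpace ℝ (Fin d)) a).left_inv hxa.1
  refine Set.mem_iUnion.2 ⟨⟨a, ha⟩, (chartAt (EuclideanSpace ℝ (Fin d)) a x,
    LinearMap.toContinuousLinearMap φ), ⟨⟨?_, ?_⟩, trivial⟩, ?_⟩
  · exact (chartAt (EuclideanSpace ℝ (Fin d)) a).map_source hxa.1
  · rw [Set.mem_preimage]
    exact hl.symm ▸ hxa.2
  · funext j
    rw [← hξ j]
    change φ (e a ⟨(chartAt (EuclideanSpace ℝ (Fin d)) a).symm _, s j _⟩).2 = _
    rw [hl]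
    change ξ (((e a).linearEquivAt ℂ x hxa.2).symm ((e a).linearEquivAt ℂ x hxa.2 (s j x))) = _
    rw [LinearEquiv.symm_apply_apply]

/-- Sufficiently many sections can be perturbed by further ones so that they span where they
spanned together with these. -/
theorem exists_perturbation [SecondCountableTopology M] {N : ℕ} (hN : d + 2 * finrank ℂ F < 2 * N)
    {m : ℕ} (s : Fin N → Sect d F V) (t : Fin m → Sect d F V) :
    ∃ s' : Fin N → Sect d F V, (∀ x, (∀ i, t i x = 0) → ∀ j, s' j x = s j x) ∧
      ∀ x, SpansAt (Sum.elim s t) x → SpansAt s' x := by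
  induction m generalizing s with
  | zero =>
    exact ⟨s, fun _ _ _ => rfl, fun x hx ξ hξ => hx ξ (Sum.rec hξ fun i => i.elim0)⟩
  | succ m ih =>
    obtain ⟨c, hc⟩ := exists_generic hN s
    -- The section t 0 is absorbed into the others, with a generic coefficient vector c. A
    -- functional that kills all of s₁ then kills t 0 as well.
    let s₁ : Fin N → Sect d F V := fun j => s j + algebraMap ℂ (SmoothFn d M) (c j) • t 0
    have hs₁ : ∀ j x, s₁ j x = s j x + c j • t 0 x := fun j x => rfl
    obtain ⟨s', h1, h2⟩ := ih s₁ fun i => t i.succ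
    refine ⟨s', fun x hx j => ?_, fun x hx => h2 x fun ξ hξ => ?_⟩
    · rw [h1 x (fun i => hx i.succ), hs₁, hx 0, smul_zero, add_zero]
    · have h3 : ∀ j, ξ (s j x) + c j * ξ (t 0 x) = 0 := fun j => by
        have := hξ (Sum.inl j)
        rwa [Sum.elim_inl, hs₁, map_add, map_smul] at this
      have h4 : ξ (t 0 x) = 0 := by
        by_contra h4
        -- Rescaled to take the value -1 on t 0, the functional would take the value c j on s j for
        -- every j, which c excludes.
        obtain ⟨j, hj⟩ := hc x (-(ξ (t 0 x))⁻¹ • ξ)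
        refine hj ?_
        rw [LinearMap.smul_apply, eq_neg_of_add_eq_zero_left (h3 j), smul_eq_mul]
        field_simp
      refine hx ξ (Sum.rec (fun j => ?_) fun i => Fin.cases h4 (fun i => hξ (Sum.inr i)) i)
      have := h3 j
      rwa [h4, mul_zero, add_zero] at this

/-- Every point has a neighbourhood over which finitely many global sections span the fibres. -/
theorem exists_local_spanning [T2Space M] (x₀ : M) :
    ∃ (n : ℕ) (u : Fin n → Sect d F V), ∀ᶠ x in nhds x₀, SpansAt u x := by
  obtain ⟨n, u, hu⟩ := HermitianMetric.exists_frame (d := d) (F := F) (V := V) x₀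
  refine ⟨n, u, hu.mono fun x hx ξ hξ => LinearMap.ext fun v => ?_⟩
  obtain ⟨a, ha⟩ := (Submodule.mem_span_range_iff_exists_fun ℝ).1 (hx.2 (Submodule.mem_top (x := v)))
  rw [← ha, map_sum]
  refine Finset.sum_eq_zero fun i _ => ?_
  rw [← Complex.coe_smul (a i) (u i x), map_smul, hξ, smul_zero]

theorem exists_spanning_of_isCompact [T2Space M] {K : Set M} (hK : IsCompact K) :
    ∃ (n : ℕ) (u : Fin n → Sect d F V), ∀ x ∈ K, SpansAt u x := by
  choose n u hu using exists_local_spanning (d := d) (F := F) (V := V)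
  obtain ⟨T, -, hT⟩ := hK.elim_nhds_subcover _ fun x _ => hu x
  let ι := Σ a : T, Fin (n a)
  let e := Fintype.equivFin ι
  refine ⟨Fintype.card ι, fun i => u (e.symm i).1 (e.symm i).2, fun x hx ξ hξ => ?_⟩
  obtain ⟨a, ha, hxa⟩ := Set.mem_iUnion₂.1 (hT hx)
  refine (show SpansAt (u a) x from hxa) ξ fun i => ?_
  have := hξ (e ⟨⟨a, ha⟩, i⟩)
  beta_reduce at this
  rwa [e.symm_apply_apply] at this

variable [T2Space M] [SecondCountableTopology M]

/-- Sections spanning over K are multiplied by a function χ that vanishes exactly on C. Absorbing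
them changes nothing on C, and off C they still span. -/
theorem exists_spanning_step {N : ℕ} (hN : d + 2 * finrank ℂ F < 2 * N) {C K : Set M}
    (hC : IsClosed C) (hK : IsCompact K) (s : Fin N → Sect d F V) (hs : ∀ x ∈ C, SpansAt s x) :
    ∃ s' : Fin N → Sect d F V, (∀ x ∈ C, ∀ j, s' j x = s j x) ∧ ∀ x ∈ K, SpansAt s' x := by
  have : LocallyCompactSpace M := ChartedSpace.locallyCompactSpace (EuclideanSpace ℝ (Fin d)) M
  have : SigmaCompactSpace M := sigmaCompactSpace_of_locallyCompact_secondCountable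
  obtain ⟨m, u, hu⟩ := exists_spanning_of_isCompact (d := d) (F := F) (V := V) hK
  obtain ⟨χ, hχ, hχs, -⟩ := hC.isOpen_compl.exists_contMDiff_support_eq (𝓡 d) (n := ⊤)
  have hχ0 : ∀ x, χ x = 0 ↔ x ∈ C := fun x => by
    rw [← Function.notMem_support, hχ, Set.mem_compl_iff, not_not]
  let χ' : SmoothFn d M := ⟨fun x => χ x, Complex.ofRealCLM.contDiff.contMDiff.comp hχs⟩
  let t : Fin m → Sect d F V := fun i => χ' • u i
  have ht : ∀ i x, t i x = (χ x : ℂ) • u i x := fun i x => rfl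
  obtain ⟨s', h1, h2⟩ := exists_perturbation hN s t
  have h3 : ∀ x ∈ C, ∀ j, s' j x = s j x := fun x hx =>
    h1 x fun i => by rw [ht, (hχ0 x).2 hx, Complex.ofReal_zero, zero_smul]
  refine ⟨s', h3, fun x hx => ?_⟩
  by_cases hxC : x ∈ C
  · exact fun ξ hξ => hs x hxC ξ fun j => by rw [← h3 x hxC]; exact hξ j
  · refine h2 x fun ξ hξ => hu x hx ξ fun i => ?_
    have h4 := hξ (Sum.inr i)
    rw [Sum.elim_inr, ht, map_smul] at h4
    exact (smul_eq_zero.1 h4).resolve_left (by exact_mod_cast fun h => hxC ((hχ0 x).1 h))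

variable (d F V) in
/-- The fibres of a vector bundle are spanned by finitely many global sections. -/
theorem exists_spanning : ∃ (n : ℕ) (s : Fin n → Sect d F V), ∀ x, SpansAt s x := by
  have : LocallyCompactSpace M := ChartedSpace.locallyCompactSpace (EuclideanSpace ℝ (Fin d)) M
  have : SigmaCompactSpace M := sigmaCompactSpace_of_locallyCompact_secondCountable
  -- What matters is that N does not depend on the compact set, so the extension step can be
  -- repeated along an exhaustion.
  let N := d + 2 * finrank ℂ F + 1
  have hN : d + 2 * finrank ℂ F < 2 * N := by omega
  let K := CompactExhaustion.choice M
  have hstep : ∀ (m : ℕ) (s : {s : Fin N → Sect d F V // ∀ x ∈ K m, SpansAt s x}),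
      ∃ s' : {s : Fin N → Sect d F V // ∀ x ∈ K (m + 1), SpansAt s x},
        ∀ x ∈ K m, ∀ j, s'.1 j x = s.1 j x := fun m s => by
    obtain ⟨s', h1, h2⟩ := exists_spanning_step hN (K.isCompact m).isClosed (K.isCompact (m + 1))
      s.1 s.2
    exact ⟨⟨s', h2⟩, h1⟩
  choose next hnext using hstep
  obtain ⟨s₀, -, hs₀⟩ := exists_spanning_step hN isClosed_empty (K.isCompact 0)
    (fun _ => (0 : Sect d F V)) (fun x hx => hx.elim)
  let S : ∀ m, {s : Fin N → Sect d F V // ∀ x ∈ K m, SpansAt s x} := fun m =>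
    Nat.rec ⟨s₀, hs₀⟩ next m
  have hS : ∀ m, ∀ x ∈ K m, ∀ j, (S (m + 1)).1 j x = (S m).1 j x := fun m => hnext m (S m)
  have hS' : ∀ m l, m ≤ l → ∀ x ∈ K m, ∀ j, (S l).1 j x = (S m).1 j x := fun m l hml x hx j => by
    induction l, hml using Nat.le_induction with
    | base => rfl
    | succ l hml ih => rw [hS l x (K.subset hml hx), ih]
  have hfind : ∀ m, ∀ x ∈ K m, ∀ j, (S (K.find x)).1 j x = (S m).1 j x := fun m x hx j =>
    (hS' _ _ (K.mem_iff_find_le.1 hx) x (K.mem_find x) j).symm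
  -- The families are stationary on each K m. Near x the glued section equals the one of stage
  -- `K.find x + 1`, whose compact set contains x in its interior; hence it is smooth.
  refine ⟨N, fun j => ⟨fun x => (S (K.find x)).1 j x, fun x => ?_⟩, fun x ξ hξ => ?_⟩
  · refine ((S (K.find x + 1)).1 j).contMDiff x |>.congr_of_eventuallyEq ?_
    filter_upwards [isOpen_interior.mem_nhds (K.subset_interior_succ _ (K.mem_find x))] with y hy
    rw [hfind _ y (interior_subset hy)]
  · exact (S (K.find x)).2 x (K.mem_find x) ξ hξ

end Spanning

/-! ### Frames of a vector bundle -/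

section Frames

set_option linter.unusedSectionVars false

open Module

variable {d : ℕ} {M : Type*} [TopologicalSpace M] [ChartedSpace (EuclideanSpace ℝ (Fin d)) M]
  {F : Type*} [NormedAddCommGroup F] [NormedSpace ℂ F]
  {V : M → Type*} [TopologicalSpace (TotalSpace F V)]
  [∀ x, AddCommGroup (V x)] [∀ x, Module ℂ (V x)] [∀ x, TopologicalSpace (V x)]
  [FiberBundle F V] [VectorBundle ℂ F V] [VectorBundle ℝ F V]

variable (d F V) in
/-- A finite family of smooth sections, with smooth fibrewise coefficients `αᵢ` such that
`∑ αᵢ(v) sᵢ = v`. -/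
structure SmoothFrame where
  n : ℕ
  s : Fin n → Sect d F V
  α : Fin n → ∀ x, Dual ℂ (V x)
  smooth : ∀ i (t : Sect d F V), ContMDiff (𝓡 d) 𝓘(ℝ, ℂ) ∞ fun x => α i x (t x)
  sum : ∀ x v, ∑ i, α i x v • s i x = v

theorem contMDiffAt_sum {ι : Type*} (T : Finset ι) {f : ι → M → ℂ} {x : M}
    (hf : ∀ i ∈ T, ContMDiffAt (𝓡 d) 𝓘(ℝ, ℂ) ∞ (f i) x) :
    ContMDiffAt (𝓡 d) 𝓘(ℝ, ℂ) ∞ (fun x => ∑ i ∈ T, f i x) x :=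
  ContMDiffAt.sum hf

variable [FiniteDimensional ℂ F] [IsManifold (𝓡 d) ∞ M] [ContMDiffVectorBundle ∞ F V (𝓡 d)]

/-- A right inverse r of the combination map L at x₀ is kept fixed. Composing the combination map at
x with r gives c(x), which is 1 at x₀ and so invertible nearby; the coefficients r ∘ c(x)⁻¹ depend
smoothly on x. -/
theorem exists_local_dual {n : ℕ} (s : Fin n → Sect d F V) (x₀ : M) (hs : SpansAt s x₀) :
    ∃ U ∈ nhds x₀, ∃ β : Fin n → ∀ x, Dual ℂ (V x),
      (∀ x ∈ U, ∀ v, ∑ i, β i x v • s i x = v) ∧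
      ∀ i (t : Sect d F V), ∀ x ∈ U, ContMDiffAt (𝓡 d) 𝓘(ℝ, ℂ) ∞ (fun x => β i x (t x)) x := by
  let e := trivializationAt F V x₀
  have hx₀ : x₀ ∈ e.baseSet := mem_baseSet_trivializationAt F V x₀
  let w : M → Fin n → F := fun x i => (e ⟨x, s i x⟩).2
  have hw : ∀ x ∈ e.baseSet, ContMDiffAt (𝓡 d) 𝓘(ℝ, Fin n → F) ∞ w x := fun x hx =>
    contMDiffAt_pi_space.2 fun i => contMDiffAt_coord (s i) x₀ hx
  let L : (Fin n → ℂ) →ₗ[ℂ] F := Fintype.linearCombination ℂ (w x₀)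
  have hL : Function.Surjective L := by
    rw [← LinearMap.range_eq_top]
    by_contra hne
    obtain ⟨f, hf, hker⟩ := Submodule.exists_le_ker_of_lt_top _ (lt_top_iff_ne_top.2 hne)
    have h1 := hs (f ∘ₗ (e.linearEquivAt ℂ x₀ hx₀).toLinearMap) fun i => by
      refine hker ⟨Pi.single i 1, ?_⟩
      simp only [L, Fintype.linearCombination_apply_single, one_smul]
      rfl
    refine hf (LinearMap.ext fun y => ?_)
    have := LinearMap.congr_fun h1 ((e.linearEquivAt ℂ x₀ hx₀).symm y)
    simpa only [LinearMap.comp_apply, LinearEquiv.coe_coe, LinearEquiv.apply_symm_apply,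
      LinearMap.zero_apply] using this
  obtain ⟨r, hr⟩ := L.exists_rightInverse_of_surjective (LinearMap.range_eq_top.2 hL)
  let ρ : Fin n → F →L[ℂ] ℂ := fun i => LinearMap.toContinuousLinearMap (LinearMap.proj i ∘ₗ r)
  let C : (Fin n → F) →ₗ[ℝ] (F →L[ℂ] F) :=
    { toFun := fun w => ∑ i, (ρ i).smulRight (w i)
      map_add' := fun w w' => by ext y; simp [Finset.sum_add_distrib]
      map_smul' := fun a w => by
        ext y
        simp only [sum_apply, ContinuousLinearMap.smulRight_apply, Pi.smul_apply,
          RingHom.id_apply, smul_apply, Finset.smul_sum]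
        exact Finset.sum_congr rfl fun i _ => smul_comm _ _ _ }
  have hCw : ∀ w y, C w y = ∑ i, r y i • w i := fun w y => by simp [C, ρ]
  let c : M → F →L[ℂ] F := fun x => C (w x)
  have hc : ∀ x ∈ e.baseSet, ContMDiffAt (𝓡 d) 𝓘(ℝ, F →L[ℂ] F) ∞ c x := fun x hx =>
    (LinearMap.toContinuousLinearMap C).contDiff.contMDiff.contMDiffAt.comp x (hw x hx)
  have hc₀ : c x₀ = 1 := by
    ext y
    rw [hCw]
    simpa [L, Fintype.linearCombination_apply] using LinearMap.congr_fun hr y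
  have hU : {x | x ∈ e.baseSet ∧ IsUnit (c x)} ∈ nhds x₀ := by
    refine Filter.inter_mem (e.open_baseSet.mem_nhds hx₀) ?_
    refine (hc x₀ hx₀).continuousAt (Units.isOpen.mem_nhds ?_)
    change IsUnit (c x₀)
    rw [hc₀]; exact isUnit_one
  have hlin : ∀ x ∈ e.baseSet, ∀ v, e.linearMapAt ℂ x v = (e ⟨x, v⟩).2 := fun x hx v => by
    rw [e.coe_linearMapAt_of_mem hx]
  refine ⟨_, hU, fun i x => (ρ i).toLinearMap ∘ₗ (Ring.inverse (c x)).toLinearMap ∘ₗ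
    e.linearMapAt ℂ x, ?_, ?_⟩
  · rintro x ⟨hx, hcx⟩ v
    apply (e.linearEquivAt ℂ x hx).injective
    have h1 : ∀ y, c x y = ∑ i, ρ i y • (e.linearEquivAt ℂ x hx) (s i x) := fun y => hCw _ _
    rw [map_sum]
    simp only [map_smul]
    refine (h1 _).symm.trans ?_
    change (c x * Ring.inverse (c x)) (e.linearMapAt ℂ x v) = _
    rw [Ring.mul_inverse_cancel _ hcx, hlin x hx]
    rfl
  · rintro i t x ⟨hx, ⟨u, hu⟩⟩
    have h1 : ContMDiffAt (𝓡 d) 𝓘(ℝ, F →L[ℂ] F) ∞ (fun x => Ring.inverse (c x)) x := by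
      have h2 := contDiffAt_ringInverse ℝ (n := ∞) u
      rw [hu] at h2
      exact h2.contMDiffAt.comp x (hc x hx)
    have h3 : ContMDiffAt (𝓡 d) 𝓘(ℝ, F →L[ℝ] F) ∞
        (fun x => ContinuousLinearMap.restrictScalarsL ℂ F F ℝ ℝ (Ring.inverse (c x))) x :=
      (ContinuousLinearMap.restrictScalarsL ℂ F F ℝ ℝ).contDiff.contMDiff.contMDiffAt.comp x h1
    have h4 := h3.clm_apply (contMDiffAt_coord t x₀ hx)
    have h5 := ((ρ i).restrictScalars ℝ).contDiff.contMDiff.contMDiffAt.comp x h4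
    refine h5.congr_of_eventuallyEq ?_
    filter_upwards [e.open_baseSet.mem_nhds hx] with y hy
    change ρ i (Ring.inverse (c y) (e.linearMapAt ℂ y (t y))) = _
    rw [hlin y hy]
    rfl

variable [T2Space M] [SecondCountableTopology M]

variable (d F V) in
theorem exists_smoothFrame : Nonempty (SmoothFrame d F V) := by
  have : LocallyCompactSpace M := ChartedSpace.locallyCompactSpace (EuclideanSpace ℝ (Fin d)) M
  have : SigmaCompactSpace M := sigmaCompactSpace_of_locallyCompact_secondCountable
  obtain ⟨n, s, hs⟩ := exists_spanning d F V
  choose U hU β hβ hβs using fun x₀ => exists_local_dual s x₀ (hs x₀)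
  -- The unknown coefficients αᵢ are encoded by the matrix q = (αᵢ(sⱼ)), which lives in a fixed
  -- vector space. The conditions, that q u has the same combination as u and vanishes when that
  -- combination does, are convex, so local solutions can be glued by a partition of unity.
  let T : M → Set (Fin n → Fin n → ℂ) := fun x =>
    {q | ∀ u : Fin n → ℂ, ∑ i, (∑ j, q i j * u j) • s i x = ∑ j, u j • s j x ∧
      (∑ j, u j • s j x = 0 → ∀ i, ∑ j, q i j * u j = 0)}
  obtain ⟨q, hq⟩ := exists_contMDiffMap_forall_mem_convex_of_local (𝓡 d) (n := ⊤) (t := T)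
    (fun x p hp q hq a b ha hb hab u => by
      have h1 : ∀ i, ∑ j, (a • p + b • q) i j * u j =
          (a : ℂ) * ∑ j, p i j * u j + (b : ℂ) * ∑ j, q i j * u j := fun i => by
        simp [add_mul, Finset.sum_add_distrib, Finset.mul_sum, _root_.mul_assoc]
      have hab' : (a : ℂ) + b = 1 := by exact_mod_cast hab
      refine ⟨?_, fun h i => ?_⟩
      · simp only [h1, add_smul, mul_smul, Finset.sum_add_distrib, ← Finset.smul_sum]
        rw [(hp u).1, (hq u).1, ← add_smul, hab', one_smul]
      · rw [h1, (hp u).2 h, (hq u).2 h, mul_zero, mul_zero, add_zero])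
    (fun x₀ => ⟨U x₀, hU x₀, fun x i j => β x₀ i x (s j x), fun x hx =>
      (contMDiffAt_pi_space.2 fun i => contMDiffAt_pi_space.2 fun j =>
        hβs x₀ i (s j) x hx).contMDiffWithinAt, fun x hx u => by
      have h1 : ∀ i, ∑ j, β x₀ i x (s j x) * u j = β x₀ i x (∑ j, u j • s j x) := fun i => by
        simp [map_sum, mul_comm]
      simp only [h1, hβ x₀ x hx]
      exact ⟨trivial, fun h i => by rw [h, map_zero]⟩⟩)
  have hqs : ∀ i j, ContMDiff (𝓡 d) 𝓘(ℝ, ℂ) ∞ fun x => q x i j := fun i j =>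
    contMDiff_pi_space.1 (contMDiff_pi_space.1 q.contMDiff i) j
  let α : Fin n → ∀ x, Dual ℂ (V x) := fun i x => ∑ j, q x i j • β x j x
  have hα : ∀ i x v, α i x v = ∑ j, q x i j * β x j x v := fun i x v => by simp [α]
  -- αᵢ(v) may be computed from any coefficients of v. So near x₀ the single local dual at x₀ may be
  -- used, and smoothness follows.
  have hαu : ∀ i x (u : Fin n → ℂ), α i x (∑ j, u j • s j x) = ∑ j, q x i j * u j := by
    intro i x u
    rw [hα, ← sub_eq_zero, ← Finset.sum_sub_distrib]
    simp only [← mul_sub]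
    refine (hq x _).2 ?_ i
    simp only [sub_smul, Finset.sum_sub_distrib]
    rw [hβ x x (mem_of_mem_nhds (hU x)), sub_self]
  refine ⟨⟨n, s, α, fun i t x₀ => ?_, fun x v => ?_⟩⟩
  · have h1 : ContMDiffAt (𝓡 d) 𝓘(ℝ, ℂ) ∞ (fun x => ∑ j, q x i j * β x₀ j x (t x)) x₀ :=
      contMDiffAt_sum _ fun j _ => (hqs i j x₀).mul (hβs x₀ j t x₀ (mem_of_mem_nhds (hU x₀)))
    refine h1.congr_of_eventuallyEq ?_
    filter_upwards [hU x₀] with x hx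
    rw [← hαu, hβ x₀ x hx]
  · simp only [hα]
    rw [(hq x _).1, hβ x x (mem_of_mem_nhds (hU x))]

end Frames

/-! ### Parseval frames -/

section Parseval

set_option linter.unusedSectionVars false

open Module

variable {d : ℕ} {M : Type*} [TopologicalSpace M] [ChartedSpace (EuclideanSpace ℝ (Fin d)) M]

theorem contMDiff_conj {f : M → ℂ} (hf : ContMDiff (𝓡 d) 𝓘(ℝ, ℂ) ∞ f) :
    ContMDiff (𝓡 d) 𝓘(ℝ, ℂ) ∞ fun x => (starRingEnd ℂ) (f x) :=
  Complex.conjCLE.contDiff.contMDiff.comp hf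

/-- Gram–Schmidt orthonormalization of the standard basis for a smooth family of Hermitian inner
products. -/
theorem exists_orthonormal {n : ℕ} (g : M → (Fin n → ℂ) →ₗ⋆[ℂ] (Fin n → ℂ) →ₗ[ℂ] ℂ)
    (hconj : ∀ x u w, (starRingEnd ℂ) (g x u w) = g x w u)
    (hpos : ∀ x u, u ≠ 0 → 0 < (g x u u).re)
    (hsm : ∀ u w : M → Fin n → ℂ, (∀ i, ContMDiff (𝓡 d) 𝓘(ℝ, ℂ) ∞ fun x => u x i) →
      (∀ i, ContMDiff (𝓡 d) 𝓘(ℝ, ℂ) ∞ fun x => w x i) →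
      ContMDiff (𝓡 d) 𝓘(ℝ, ℂ) ∞ fun x => g x (u x) (w x)) :
    ∃ f : Fin n → M → Fin n → ℂ, (∀ i j, ContMDiff (𝓡 d) 𝓘(ℝ, ℂ) ∞ fun x => f i x j) ∧
      ∀ x i j, g x (f i x) (f j x) = if i = j then 1 else 0 := by
  have key : ∀ k ≤ n, ∃ f : ℕ → M → Fin n → ℂ,
      (∀ i < k, ∀ j, ContMDiff (𝓡 d) 𝓘(ℝ, ℂ) ∞ fun x => f i x j) ∧
      (∀ i < k, ∀ (j : Fin n) x, i < j → f i x j = 0) ∧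
      ∀ x, ∀ i < k, ∀ j < k, g x (f i x) (f j x) = if i = j then 1 else 0 := by
    intro k
    induction k with
    | zero => exact fun _ => ⟨fun _ _ => 0, by simp, by simp, by simp⟩
    | succ k ih =>
      intro hk
      obtain ⟨f, hf, htri, hort⟩ := ih (by omega)
      let κ : Fin n := ⟨k, hk⟩
      let ε : Fin n → ℂ := Pi.single κ 1
      let w : M → Fin n → ℂ := fun x => ε - ∑ i ∈ Finset.range k, g x (f i x) ε • f i x
      have hw : ∀ x j, w x j = ε j - ∑ i ∈ Finset.range k, g x (f i x) ε * f i x j := fun x j => by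
        simp [w]
      have hws : ∀ j, ContMDiff (𝓡 d) 𝓘(ℝ, ℂ) ∞ fun x => w x j := fun j x => by
        simp only [hw]
        exact contMDiffAt_const.sub (contMDiffAt_sum _ fun i hi =>
          (hsm (f i) (fun _ => ε) (hf i (Finset.mem_range.1 hi)) (fun _ => contMDiff_const) x).mul
            (hf i (Finset.mem_range.1 hi) j x))
      -- The earlier vectors have no component beyond their index, so the component of w along the
      -- new standard vector is 1.
      have hwk : ∀ x, w x ≠ 0 := fun x h0 => by
        have h1 := congrFun h0 κ
        rw [hw, Finset.sum_eq_zero fun i hi => by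
          rw [htri i (Finset.mem_range.1 hi) κ x (Finset.mem_range.1 hi), mul_zero]] at h1
        simp [ε] at h1
      have horw : ∀ x, ∀ i < k, g x (f i x) (w x) = 0 := fun x i hi => by
        simp only [w, map_sub, map_sum, map_smul]
        rw [Finset.sum_eq_single i (fun j hj hji => by
          rw [hort x i hi j (Finset.mem_range.1 hj), if_neg hji.symm, smul_zero])
          (fun h => absurd (Finset.mem_range.2 hi) h), hort x i hi i hi]
        simp
      have horw' : ∀ x, ∀ i < k, g x (w x) (f i x) = 0 := fun x i hi => by
        rw [← hconj, horw x i hi, map_zero]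
      let ν : M → ℝ := fun x => (g x (w x) (w x)).re
      have hν : ∀ x, 0 < ν x := fun x => hpos x _ (hwk x)
      have hνg : ∀ x, g x (w x) (w x) = (ν x : ℂ) := fun x =>
        (Complex.conj_eq_iff_re.1 (hconj x _ _)).symm
      let a : M → ℂ := fun x => (((Real.sqrt (ν x))⁻¹ : ℝ) : ℂ)
      have ha : ContMDiff (𝓡 d) 𝓘(ℝ, ℂ) ∞ a := fun x => by
        have h1 : ContMDiffAt (𝓡 d) 𝓘(ℝ, ℝ) ∞ ν x :=
          (Complex.reCLM.contDiff.contMDiff.comp (hsm w w hws hws)) x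
        have h2 : ContDiffAt ℝ ∞ (fun r : ℝ => (Real.sqrt r)⁻¹) (ν x) :=
          (Real.contDiffAt_sqrt (hν x).ne').inv (Real.sqrt_pos.2 (hν x)).ne'
        exact Complex.ofRealCLM.contDiff.contMDiff.contMDiffAt.comp x
          (h2.contMDiffAt.comp x h1)
      have haa : ∀ x, a x * a x * ν x = 1 := fun x => by
        have h1 : (Real.sqrt (ν x))⁻¹ * (Real.sqrt (ν x))⁻¹ * ν x = 1 := by
          rw [← mul_inv, Real.mul_self_sqrt (hν x).le, inv_mul_cancel₀ (hν x).ne']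
        simp only [a]
        exact_mod_cast h1
      have hac : ∀ x, (starRingEnd ℂ) (a x) = a x := fun x => Complex.conj_ofReal _
      let f' : ℕ → M → Fin n → ℂ := fun i => if i = k then fun x => a x • w x else f i
      have hf'k : f' k = fun x => a x • w x := if_pos rfl
      have hf'i : ∀ i < k, f' i = f i := fun i hi => if_neg hi.ne
      refine ⟨f', fun i hi j => ?_, fun i hi j x hij => ?_, fun x i hi j hj => ?_⟩
      · rcases Nat.lt_succ_iff_lt_or_eq.1 hi with hi | rfl
        · rw [hf'i i hi]; exact hf i hi j
        · rw [hf'k]; exact ha.mul (hws j)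
      · rcases Nat.lt_succ_iff_lt_or_eq.1 hi with hi | rfl
        · rw [hf'i i hi]; exact htri i hi j x hij
        · rw [hf'k]
          change a x * w x j = 0
          rw [hw, Finset.sum_eq_zero fun l hl => by
            rw [htri l (Finset.mem_range.1 hl) j x ((Finset.mem_range.1 hl).trans hij), mul_zero]]
          have : j ≠ κ := fun h => by rw [h] at hij; exact lt_irrefl _ hij
          simp [ε, this]
      · rcases Nat.lt_succ_iff_lt_or_eq.1 hi with hi | rfl <;>
          rcases Nat.lt_succ_iff_lt_or_eq.1 hj with hj | rfl
        · rw [hf'i i hi, hf'i j hj]; exact hort x i hi j hj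
        · rw [hf'i i hi, hf'k, if_neg hi.ne, map_smul, horw x i hi, smul_zero]
        · rw [hf'i j hj, hf'k, if_neg hj.ne', LinearMap.map_smulₛₗ, LinearMap.smul_apply,
            horw' x j hj, smul_zero]
        · rw [hf'k, if_pos rfl]
          beta_reduce
          rw [map_smul (g x (a x • w x)), LinearMap.map_smulₛₗ, LinearMap.smul_apply, hνg, hac,
            smul_eq_mul, smul_eq_mul, ← _root_.mul_assoc, haa]
  obtain ⟨f, hf, -, hort⟩ := key n le_rfl
  exact ⟨fun i => f i, fun i => hf i i.2, fun x i j => by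
    rw [hort x i i.2 j j.2]; simp only [Fin.ext_iff]⟩

/-- An orthonormal family of full length is a basis. -/
theorem sum_orthonormal {n : ℕ} (g : (Fin n → ℂ) →ₗ⋆[ℂ] (Fin n → ℂ) →ₗ[ℂ] ℂ)
    (f : Fin n → Fin n → ℂ) (hf : ∀ i j, g (f i) (f j) = if i = j then 1 else 0)
    (u : Fin n → ℂ) : ∑ i, g (f i) u • f i = u := by
  have hg : ∀ i u, g (f i) u = ∑ j, u j * g (f i) (Pi.single j 1) := fun i u => by
    conv_lhs => rw [pi_eq_sum_univ' u]
    rw [map_sum]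
    exact Finset.sum_congr rfl fun j _ => by rw [map_smul, smul_eq_mul]
  let P : Matrix (Fin n) (Fin n) ℂ := .of fun i j => g (f i) (Pi.single j 1)
  let Q : Matrix (Fin n) (Fin n) ℂ := .of fun j i => f i j
  -- Orthonormality is P Q = 1; for square matrices this gives Q P = 1, which is the expansion.
  have h1 : P * Q = 1 := by
    ext i l
    rw [Matrix.mul_apply, Matrix.one_apply, ← hf, hg]
    exact Finset.sum_congr rfl fun j _ => mul_comm _ _
  have h2 := congrFun (congrArg (fun R : Matrix (Fin n) (Fin n) ℂ => R.mulVec u)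
    (mul_eq_one_comm.1 h1))
  funext j
  have h3 := h2 j
  simp only [Matrix.one_mulVec, ← Matrix.mulVec_mulVec] at h3
  rw [← h3, Finset.sum_apply]
  refine Finset.sum_congr rfl fun i _ => ?_
  rw [Pi.smul_apply, smul_eq_mul, mul_comm, hg]
  change _ = f i j * ∑ l, _
  congr 1
  exact Finset.sum_congr rfl fun l _ => mul_comm _ _

variable {F : Type*} [NormedAddCommGroup F] [NormedSpace ℂ F]
  {V : M → Type*} [TopologicalSpace (TotalSpace F V)]
  [∀ x, AddCommGroup (V x)] [∀ x, Module ℂ (V x)] [∀ x, TopologicalSpace (V x)]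
  [FiberBundle F V] [VectorBundle ℂ F V] [VectorBundle ℝ F V]

/-- The linear combination of sections with smooth coefficients. -/
def SmoothFrame.comb (Fr : SmoothFrame d F V) (u : M → Fin Fr.n → ℂ)
    (hu : ∀ i, ContMDiff (𝓡 d) 𝓘(ℝ, ℂ) ∞ fun x => u x i) : Sect d F V :=
  ⟨fun x => ∑ i, u x i • Fr.s i x, fun x => ContMDiffAt.sum_section fun i _ =>
    smooth_smul (hu i x) ((Fr.s i).contMDiff x)⟩

/-- A frame whose coefficients are the inner products with its sections. -/
def SmoothFrame.IsParseval (Fr : SmoothFrame d F V) (h : HermitianMetric d F V) : Prop :=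
  ∀ i x v, Fr.α i x v = h.form x (Fr.s i x) v

/-- The frame makes E a direct summand of the trivial bundle, with projection σ and inclusion α.
Give the trivial bundle the metric that is h on α(E), uses the standard product on ker σ and makes
the two orthogonal. The images under σ of a global orthonormal frame f are as required: h(σ fᵢ, v)
is the inner product of fᵢ with α v, so the expansion of α v in the fᵢ maps to v. -/
theorem SmoothFrame.exists_isParseval (Fr : SmoothFrame d F V) (h : HermitianMetric d F V) :
    ∃ Fr' : SmoothFrame d F V, Fr'.IsParseval h := by
  let σ : ∀ x, (Fin Fr.n → ℂ) →ₗ[ℂ] V x := fun x => Fintype.linearCombination ℂ fun i => Fr.s i x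
  have hσ : ∀ x u, σ x u = ∑ i, u i • Fr.s i x := fun x u => Fintype.linearCombination_apply _ _ _
  let α : ∀ x, V x →ₗ[ℂ] (Fin Fr.n → ℂ) := fun x => LinearMap.pi fun i => Fr.α i x
  have hσα : ∀ x v, σ x (α x v) = v := fun x v => (hσ x _).trans (Fr.sum x v)
  -- The projection onto ker σ along α(E).
  let τ : ∀ x, (Fin Fr.n → ℂ) →ₗ[ℂ] (Fin Fr.n → ℂ) := fun x => LinearMap.id - α x ∘ₗ σ x
  have hτ : ∀ x u i, τ x u i = u i - Fr.α i x (σ x u) := fun _ _ _ => rfl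
  have hτα : ∀ x v, τ x (α x v) = 0 := fun x v => by
    change α x v - α x (σ x (α x v)) = 0
    rw [hσα, sub_self]
  let g : M → (Fin Fr.n → ℂ) →ₗ⋆[ℂ] (Fin Fr.n → ℂ) →ₗ[ℂ] ℂ := fun x =>
    LinearMap.mk₂'ₛₗ (starRingEnd ℂ) (RingHom.id ℂ) (fun u w => h.form x (σ x u) (σ x w) +
      ∑ i, (starRingEnd ℂ) (τ x u i) * τ x w i)
      (fun u u' w => by simp [add_mul, Finset.sum_add_distrib]; ring)
      (fun c u w => by simp [mul_add, Finset.mul_sum, _root_.mul_assoc])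
      (fun u w w' => by simp [mul_add, Finset.sum_add_distrib]; ring)
      (fun c u w => by
        simp only [map_smul, Pi.smul_apply, smul_eq_mul, RingHom.id_apply, mul_add, Finset.mul_sum]
        congr 1
        exact Finset.sum_congr rfl fun i _ => mul_left_comm _ _ _)
  have hg : ∀ x u w, g x u w = h.form x (σ x u) (σ x w) +
      ∑ i, (starRingEnd ℂ) (τ x u i) * τ x w i := fun _ _ _ => rfl
  obtain ⟨f, hf, hort⟩ := exists_orthonormal (d := d) g
    (fun x u w => by
      rw [hg, hg, map_add, h.conj_symm, map_sum]
      congr 1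
      exact Finset.sum_congr rfl fun i _ => by rw [map_mul, Complex.conj_conj, mul_comm])
    (fun x u hu => by
      rw [hg, Complex.add_re, Complex.re_sum]
      have h1 : ∀ i, ((starRingEnd ℂ) (τ x u i) * τ x u i).re = Complex.normSq (τ x u i) :=
        fun i => by rw [mul_comm, Complex.mul_conj, Complex.ofReal_re]
      simp only [h1]
      by_cases h0 : σ x u = 0
      · have h2 : ∀ i, τ x u i = u i := fun i => by rw [hτ, h0, map_zero, sub_zero]
        obtain ⟨i, hi⟩ := Function.ne_iff.1 hu
        simp only [h2, h0, map_zero, Complex.zero_re, zero_add]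
        exact Finset.sum_pos' (fun i _ => Complex.normSq_nonneg _)
          ⟨i, Finset.mem_univ _, Complex.normSq_pos.2 hi⟩
      · exact add_pos_of_pos_of_nonneg (h.pos x _ h0)
          (Finset.sum_nonneg fun i _ => Complex.normSq_nonneg _))
    (fun u w hu hw => by
      have h1 : ∀ (u : M → Fin Fr.n → ℂ) (hu : ∀ i, ContMDiff (𝓡 d) 𝓘(ℝ, ℂ) ∞ fun x => u x i) x,
          Fr.comb u hu x = σ x (u x) := fun u hu x => (hσ x _).symm
      have h2 : ∀ (u : M → Fin Fr.n → ℂ), (∀ i, ContMDiff (𝓡 d) 𝓘(ℝ, ℂ) ∞ fun x => u x i) → ∀ i,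
          ContMDiff (𝓡 d) 𝓘(ℝ, ℂ) ∞ fun x => τ x (u x) i := fun u hu i => by
        simp only [hτ, ← h1 u hu]
        exact (hu i).sub (Fr.smooth i _)
      simp only [hg, ← h1 u hu, ← h1 w hw]
      exact (h.smooth _ _).add fun x => contMDiffAt_sum _ fun i _ =>
        (contMDiff_conj (h2 u hu i) x).mul (h2 w hw i x))
  refine ⟨⟨Fr.n, fun i => Fr.comb (f i) (hf i), fun i x => h.form x (Fr.comb (f i) (hf i) x),
    fun i t => h.smooth _ t, fun x v => ?_⟩, fun i x v => rfl⟩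
  have h1 : ∀ i, Fr.comb (f i) (hf i) x = σ x (f i x) := fun i => (hσ x _).symm
  have h2 : ∀ i, h.form x (σ x (f i x)) v = g x (f i x) (α x v) := fun i => by
    rw [hg, hσα, hτα]; simp
  simp only [h1, h2, ← map_smul, ← map_sum]
  rw [sum_orthonormal (g x) (fun i => f i x) (hort x), hσα]

end Parseval

/-! ### The bimodule of sections -/

section SectionBimodule

set_option linter.unusedSectionVars false

open Module TopologicalSpace Van

/-- Vanishing on open sets, for an algebra or module of sections. -/
abbrev Van.ofEval {M : Type*} [TopologicalSpace M] {W : M → Type*} [∀ x, AddCommGroup (W x)]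
    {A : Type*} [AddCommGroup A] (ev : ∀ x, A →+ W x) : Van (Opens M) A where
  van U :=
    { carrier := {a | ∀ x ∈ U, ev x a = 0}
      add_mem' := fun ha hb x hx => by rw [map_add, ha x hx, hb x hx, add_zero]
      zero_mem' := fun x _ => map_zero _
      neg_mem' := fun ha x hx => by rw [map_neg, ha x hx, neg_zero] }

variable {d : ℕ} {M : Type*} [TopologicalSpace M] [ChartedSpace (EuclideanSpace ℝ (Fin d)) M]
  {F : Type*} [NormedAddCommGroup F] [NormedSpace ℂ F]
  {V : M → Type*} [TopologicalSpace (TotalSpace F V)]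
  [∀ x, AddCommGroup (V x)] [∀ x, Module ℂ (V x)] [∀ x, TopologicalSpace (V x)]
  [FiberBundle F V] [VectorBundle ℂ F V] [VectorBundle ℝ F V]

instance SmoothFn.instVan : Van (Opens M) (SmoothFn d M) := Van.ofEval (SmoothFn.ev d M)

instance EndSect.instVan : Van (Opens M) (EndSect d F V) := Van.ofEval (EndSect.ev d F V)

variable (d F V) in
/-- Evaluation of sections at a point. -/
def Sect.ev (x : M) : Sect d F V →+ V x where
  toFun s := s x
  map_zero' := rfl
  map_add' _ _ := rfl

instance Sect.instVan : Van (Opens M) (Sect d F V) := Van.ofEval (Sect.ev d F V)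

theorem SmoothFn.mem_van (U : Opens M) (a : SmoothFn d M) :
    a ∈ van U ↔ ∀ x ∈ U, SmoothFn.ev d M x a = 0 := Iff.rfl

theorem EndSect.mem_van (U : Opens M) (a : EndSect d F V) :
    a ∈ van U ↔ ∀ x ∈ U, EndSect.ev d F V x a = 0 := Iff.rfl

/-- Sections as a complex vector space. -/
instance Sect.instModuleComplex : Module ℂ (Sect d F V) :=
  Module.compHom _ (algebraMap ℂ (SmoothFn d M))

theorem Sect.smul_apply (f : SmoothFn d M) (s : Sect d F V) (x : M) : (f • s) x = f x • s x := rfl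

theorem Sect.sum_apply {ι : Type*} (T : Finset ι) (s : ι → Sect d F V) (x : M) :
    (∑ i ∈ T, s i) x = ∑ i ∈ T, s i x := map_sum (Sect.ev d F V x) s T

theorem SmoothFn.sum_apply {ι : Type*} (T : Finset ι) (f : ι → SmoothFn d M) (x : M) :
    (∑ i ∈ T, f i) x = ∑ i ∈ T, f i x := map_sum (SmoothFn.ev d M x) f T

/-- `Γ^∞(E)` as a module over `C^∞(M)` and over `Γ^∞(End E)`. -/
def sectBimod (hspan : ∀ x (v : V x), ∃ t : Sect d F V, t x = v) (hne : ∀ x, ∃ v : V x, v ≠ 0) :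
    Bimod ℂ (Opens M) (SmoothFn d M) (EndSect d F V) (Sect d F V) where
  aR := LinearMap.mk₂ ℂ (fun f s => f • s) (fun f g s => add_smul f g s)
    (fun c f s => by ext x; exact mul_smul c (f x) (s x)) (fun f s t => smul_add f s t)
    (fun c f s => by ext x; exact smul_comm (f x) c (s x))
  aS := LinearMap.mk₂ ℂ (fun L s => EndSect.toLin L s) (fun L S s => rfl) (fun c L s => rfl)
    (fun L s t => map_add _ s t) (fun c L s => by ext x; exact map_smul (L.1 x) c (s x))
  aR_mul f g s := by ext x; exact mul_smul (f x) (g x) (s x)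
  aS_mul L S s := rfl
  comm f L s := by ext x; exact (map_smul (L.1 x) (f x) (s x)).symm
  aR_loc U f s h x hx := by
    change f x • s x = 0
    rcases h with h | h
    · rw [show f x = 0 from h x hx, zero_smul]
    · rw [show s x = 0 from h x hx, smul_zero]
  aS_loc U L s h x hx := by
    change L.1 x (s x) = 0
    rcases h with h | h
    · rw [show L.1 x = 0 from h x hx, LinearMap.zero_apply]
    · rw [show s x = 0 from h x hx, map_zero]
  aR_faith f h := by
    ext x
    obtain ⟨v, hv⟩ := hne x
    obtain ⟨t, rfl⟩ := hspan x v
    exact (smul_eq_zero.1 (congrArg (fun s : Sect d F V => s x) (h t))).resolve_right hv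
  aS_faith L h := by
    ext x v
    obtain ⟨t, rfl⟩ := hspan x v
    exact congrArg (fun s : Sect d F V => s x) (h t)

namespace SmoothFrame

variable (Fr : SmoothFrame d F V)

/-- The coefficients of a section. -/
def coef (i : Fin Fr.n) : Sect d F V →ₗ[ℂ] SmoothFn d M where
  toFun t := ⟨fun x => Fr.α i x (t x), Fr.smooth i t⟩
  map_add' s t := by ext x; exact map_add (Fr.α i x) (s x) (t x)
  map_smul' c t := by ext x; exact map_smul (Fr.α i x) c (t x)

/-- The section `αᵢ ⊗ t` of the endomorphism bundle. -/
def rankOne (i : Fin Fr.n) : Sect d F V →ₗ[ℂ] EndSect d F V where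
  toFun t := ⟨fun x => (Fr.α i x).smulRight (t x), fun s x =>
    smooth_smul (Fr.smooth i s x) (t.contMDiff x)⟩
  map_add' s t := by ext x v; exact smul_add (Fr.α i x v) (s x) (t x)
  map_smul' c t := by ext x v; exact smul_comm (Fr.α i x v) c (t x)

include Fr in
theorem exists_sect (x : M) (v : V x) : ∃ t : Sect d F V, t x = v :=
  ⟨Fr.comb (fun _ i => Fr.α i x v) fun _ => contMDiff_const, Fr.sum x v⟩

variable (hspan : ∀ x (v : V x), ∃ t : Sect d F V, t x = v) (hne : ∀ x, ∃ v : V x, v ≠ 0)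

/-- The dual basis of the `C^∞(M)`-module of sections given by a frame. -/
def dualBasis : DualBasis (sectBimod hspan hne) where
  n := Fr.n
  x := Fr.s
  ξ := Fr.coef
  η := Fr.rankOne
  ξ_loc i U t ht x hx := by
    change Fr.α i x (t x) = 0
    rw [show t x = 0 from ht x hx, map_zero]
  η_loc i U t ht x hx := by
    change (Fr.α i x).smulRight (t x) = 0
    rw [show t x = 0 from ht x hx]; ext; simp
  compat i y z := rfl
  sum y := by
    ext x
    rw [Sect.sum_apply]
    exact Fr.sum x (y x)

/-- The trace of the identity. -/
theorem sum_α_s [FiniteDimensional ℂ F] (x : M) :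
    ∑ i, Fr.α i x (Fr.s i x) = (finrank ℂ F : ℂ) := by
  let e := (trivializationAt F V x).linearEquivAt ℂ x (mem_baseSet_trivializationAt F V x)
  have _ : FiniteDimensional ℂ (V x) := LinearEquiv.finiteDimensional e.symm
  rw [← e.finrank_eq, ← LinearMap.trace_id ℂ (V x)]
  have h : (LinearMap.id : V x →ₗ[ℂ] V x) = ∑ i, (Fr.α i x).smulRight (Fr.s i x) := by
    ext v
    rw [LinearMap.sum_apply]
    exact (Fr.sum x v).symm
  rw [h, map_sum]
  exact Finset.sum_congr rfl fun i _ => by simp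

/-- The dual basis of the `Γ^∞(End E)`-module of sections given by a frame; `c² dim E = 1`. -/
def dualBasisEnd [FiniteDimensional ℂ F] (c : ℂ) (hc : c * c * finrank ℂ F = 1) :
    DualBasis (sectBimod hspan hne).swap where
  n := Fr.n
  -- The normalization c² is divided evenly between the xᵢ and the ξᵢ. For real c this keeps the
  -- dual basis compatible with adjoints.
  x i := c • Fr.s i
  ξ i := c • Fr.rankOne i
  η i := c • Fr.coef i
  ξ_loc i U t ht x hx := by
    change c • (Fr.α i x).smulRight (t x) = 0
    rw [show t x = 0 from ht x hx]; ext; simp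
  η_loc i U t ht x hx := by
    change c * Fr.α i x (t x) = 0
    rw [show t x = 0 from ht x hx, map_zero, mul_zero]
  compat i y z := by
    ext x
    exact mul_smul c (Fr.α i x (y x)) (z x)
  sum y := by
    ext x
    rw [Sect.sum_apply]
    change ∑ i, c • Fr.α i x (c • Fr.s i x) • y x = y x
    simp only [map_smul, smul_eq_mul, smul_smul, ← Finset.sum_smul, ← _root_.mul_assoc]
    rw [← Finset.mul_sum, Fr.sum_α_s, hc, one_smul]

end SmoothFrame

end SectionBimodule

/-! ### Presentations and frames -/

section Presentations

set_option linter.unusedSectionVars false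

open Module TopologicalSpace Van

variable {d : ℕ} {M : Type*} [TopologicalSpace M] [ChartedSpace (EuclideanSpace ℝ (Fin d)) M]
  {F : Type*} [NormedAddCommGroup F] [NormedSpace ℂ F]
  {V : M → Type*} [TopologicalSpace (TotalSpace F V)]
  [∀ x, AddCommGroup (V x)] [∀ x, Module ℂ (V x)] [∀ x, TopologicalSpace (V x)]
  [FiberBundle F V] [VectorBundle ℂ F V] [VectorBundle ℝ F V]

namespace SmoothFrame

variable (Fr : SmoothFrame d F V)

theorem coef_smul (i : Fin Fr.n) (f : SmoothFn d M) (t : Sect d F V) :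
    Fr.coef i (f • t) = f * Fr.coef i t := by
  ext x; exact map_smul (Fr.α i x) (f x) (t x)

theorem sum_coef_smul (t : Sect d F V) : ∑ i, Fr.coef i t • Fr.s i = t := by
  ext x
  rw [Sect.sum_apply]
  exact Fr.sum x (t x)

/-- The presentation of the module of sections given by a frame. -/
def presentation : Presentation d F V where
  n := Fr.n
  P₀ := .of fun i j => Fr.coef i (Fr.s j)
  idem := by
    ext1 i j
    rw [Matrix.mul_apply]
    conv_rhs => rw [Matrix.of_apply, ← Fr.sum_coef_smul (Fr.s j), map_sum]
    exact Finset.sum_congr rfl fun l _ => by rw [coef_smul, mul_comm]; rfl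
  iso := by
    have key : ∀ u : Fin Fr.n → SmoothFn d M, (fun i => Fr.coef i (∑ j, u j • Fr.s j)) =
        (Matrix.of fun i j => Fr.coef i (Fr.s j)).mulVec u := fun u => funext fun i => by
      rw [map_sum]
      exact Finset.sum_congr rfl fun j _ => by rw [coef_smul, mul_comm]; rfl
    refine LinearEquiv.ofBijective
      (LinearMap.codRestrict (LinearMap.range (Matrix.of fun i j => Fr.coef i (Fr.s j)).mulVecLin)
        { toFun := fun t i => Fr.coef i t
          map_add' := fun s t => funext fun i => map_add _ _ _
          map_smul' := fun f t => funext fun i => Fr.coef_smul i f t }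
        fun t => ⟨fun i => Fr.coef i t, ?_⟩) ⟨fun s t h => ?_, ?_⟩
    · rw [Matrix.mulVecLin_apply, ← key]
      funext i
      rw [Fr.sum_coef_smul]; rfl
    · rw [← Fr.sum_coef_smul s, ← Fr.sum_coef_smul t]
      exact Finset.sum_congr rfl fun i _ =>
        congrArg (· • Fr.s i) (congrFun (congrArg Subtype.val h) i)
    · rintro ⟨_, u, rfl⟩
      exact ⟨∑ j, u j • Fr.s j, Subtype.ext (key u)⟩

theorem IsParseval.conj_α_s {Fr : SmoothFrame d F V} {h : HermitianMetric d F V}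
    (hF : Fr.IsParseval h) (i j : Fin Fr.n) (x : M) :
    (starRingEnd ℂ) (Fr.α i x (Fr.s j x)) = Fr.α j x (Fr.s i x) := by
  rw [hF, hF, h.conj_symm]

theorem IsParseval.isIsometric {Fr : SmoothFrame d F V} {h : HermitianMetric d F V}
    (hF : Fr.IsParseval h) : Fr.presentation.IsIsometric h := by
  refine ⟨fun i j => ?_, fun s t x => ?_⟩
  · ext x
    exact hF.conj_α_s j i x
  · change _ = ∑ i, (starRingEnd ℂ) (Fr.α i x (s x)) * Fr.α i x (t x)
    conv_lhs => rw [← Fr.sum x (t x)]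
    rw [map_sum]
    refine Finset.sum_congr rfl fun i _ => ?_
    rw [map_smul, smul_eq_mul, mul_comm, hF i x (s x), h.conj_symm]

end SmoothFrame

namespace Presentation

variable (p : Presentation d F V)

/-- The components of a section. -/
def comp (i : Fin p.n) : Sect d F V →ₗ[SmoothFn d M] SmoothFn d M :=
  LinearMap.proj i ∘ₗ (LinearMap.range p.P₀.mulVecLin).subtype ∘ₗ p.iso.toLinearMap

/-- The section given by a column of `P₀`. -/
def col (j : Fin p.n) : Sect d F V :=
  p.iso.symm (p.P₀.mulVecLin.rangeRestrict (Pi.single j 1))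

theorem comp_col (i j : Fin p.n) : p.comp i (p.col j) = p.P₀ i j := by
  change (p.iso (p.iso.symm _) : Fin p.n → SmoothFn d M) i = _
  rw [LinearEquiv.apply_symm_apply]
  change p.P₀.mulVec (Pi.single j 1) i = _
  simp

theorem mulVec_comp (t : Sect d F V) (i : Fin p.n) :
    ∑ j, p.P₀ i j * p.comp j t = p.comp i t := by
  obtain ⟨u, hu⟩ := (p.iso t).2
  have h : (fun j => p.comp j t) = p.P₀.mulVec u := hu.symm
  change p.P₀.mulVec (fun j => p.comp j t) i = _
  rw [h, Matrix.mulVec_mulVec, p.idem, ← h]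

theorem sum_comp_smul (t : Sect d F V) : ∑ i, p.comp i t • p.col i = t := by
  apply p.iso.injective
  refine Subtype.ext (funext fun i => ?_)
  change p.comp i (∑ j, p.comp j t • p.col j) = p.comp i t
  rw [map_sum, ← p.mulVec_comp t i]
  exact Finset.sum_congr rfl fun j _ => by rw [map_smul, p.comp_col, smul_eq_mul, mul_comm]

theorem matrix_apply (L : EndSect d F V) (i j : Fin p.n) :
    p.matrix L i j = p.comp i (EndSect.toLin L (p.col j)) := by
  rw [matrix, LinearMap.toMatrix'_apply]
  rfl

/-- The frame given by a presentation. -/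
def frame (Fr : SmoothFrame d F V) : SmoothFrame d F V :=
  -- A component is C^∞(M)-linear, hence depends on t only through its value at x. The auxiliary
  -- frame makes the fibrewise functional explicit.
  have key : ∀ i (t : Sect d F V) x,
      ∑ l, Fr.α l x (t x) * p.comp i (Fr.s l) x = p.comp i t x := fun i t x => by
    conv_rhs => rw [← Fr.sum_coef_smul t, map_sum, SmoothFn.sum_apply]
    exact Finset.sum_congr rfl fun l _ => by rw [map_smul]; rfl
  { n := p.n
    s := p.col
    α := fun i x => ∑ l, p.comp i (Fr.s l) x • Fr.α l x
    smooth := fun i t => by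
      refine (p.comp i t).contMDiff.congr fun x => ?_
      rw [← key, LinearMap.sum_apply]
      exact Finset.sum_congr rfl fun l _ => mul_comm _ _
    sum := fun x v => by
      obtain ⟨t, rfl⟩ := Fr.exists_sect x v
      conv_rhs => rw [← p.sum_comp_smul t, Sect.sum_apply]
      refine Finset.sum_congr rfl fun i _ => ?_
      rw [Sect.smul_apply, ← key, LinearMap.sum_apply]
      congr 1
      exact Finset.sum_congr rfl fun l _ => mul_comm _ _ }

theorem frame_coef (Fr : SmoothFrame d F V) (i : Fin p.n) (t : Sect d F V) :
    (p.frame Fr).coef i t = p.comp i t := by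
  ext x
  conv_rhs => rw [← Fr.sum_coef_smul t, map_sum, SmoothFn.sum_apply]
  refine (LinearMap.sum_apply _ _ _).trans (Finset.sum_congr rfl fun l _ => ?_)
  rw [map_smul]
  exact mul_comm _ _

/-- Since P₀ is a self-adjoint projection, the i-th component P₀ t = t is the inner product of the
i-th column of P₀ with t, and the isometry turns this into h. -/
theorem IsIsometric.isParseval {p : Presentation d F V} {h : HermitianMetric d F V}
    (hp : p.IsIsometric h) (Fr : SmoothFrame d F V) : (p.frame Fr).IsParseval h := by
  intro i x v
  obtain ⟨t, rfl⟩ := Fr.exists_sect x v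
  refine (congrArg (fun f : SmoothFn d M => f x) (p.frame_coef Fr i t)).trans ?_
  change _ = h.form x (p.col i x) (t x)
  rw [hp.2, ← p.mulVec_comp t i, SmoothFn.sum_apply]
  have key : ∀ i j : Fin p.n, p.P₀ i j x * p.comp j t x =
      (starRingEnd ℂ) (p.comp j (p.col i) x) * p.comp j t x := fun i j => by
    rw [p.comp_col, ← hp.1]
    rfl
  exact Finset.sum_congr rfl fun j _ => key i j

end Presentation

section Adjoint

variable [FiniteDimensional ℂ F] [IsManifold (𝓡 d) ∞ M] [T2Space M]
  [ContMDiffVectorBundle ∞ F V (𝓡 d)]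
variable (hspan : ∀ x (v : V x), ∃ t : Sect d F V, t x = v) (hne : ∀ x, ∃ v : V x, v ≠ 0)
variable {Fr : SmoothFrame d F V} {h : HermitianMetric d F V}

theorem SmoothFrame.IsParseval.isAdjoint (hF : Fr.IsParseval h) :
    (Fr.dualBasis hspan hne).IsAdjoint (SmoothFn.conj d M) h.adjoint where
  proj i j := by
    ext x
    exact hF.conj_α_s i j x
  adj L i j := by
    have key : ∀ i j x, Fr.α j x ((h.adjoint L).1 x (Fr.s i x)) =
        (starRingEnd ℂ) (Fr.α i x (L.1 x (Fr.s j x))) := fun i j x => by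
      rw [hF, hF, h.conj_symm, ← h.conj_symm, h.adjoint_spec, h.conj_symm]
    ext x
    exact key i j x

/-- The adjoint of v ↦ h(sⱼ, v) sᵢ is v ↦ h(sᵢ, v) sⱼ. The constant must be real to pass through
both slots of h in the same way. -/
theorem SmoothFrame.IsParseval.isAdjoint_end (hF : Fr.IsParseval h) {c : ℂ}
    (hc : c * c * finrank ℂ F = 1) (hcc : (starRingEnd ℂ) c = c) :
    (Fr.dualBasisEnd hspan hne c hc).IsAdjoint h.adjoint (SmoothFn.conj d M) := by
  have key : ∀ (f : SmoothFn d M) i j,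
      (c • Fr.rankOne j (SmoothFn.conj d M f • c • Fr.s i) : EndSect d F V) =
        h.adjoint (c • Fr.rankOne i (f • c • Fr.s j)) := fun f i j => by
    refine h.adjoint_unique fun x v w => ?_
    rw [h.adjoint_spec]
    change h.form x (c • Fr.α j x v • (starRingEnd ℂ) (f x) • c • Fr.s i x) w =
      h.form x v (c • Fr.α i x w • f x • c • Fr.s j x)
    simp only [LinearMap.map_smulₛₗ, LinearMap.smul_apply, map_smul, smul_eq_mul, hcc,
      Complex.conj_conj]
    rw [← hF i x w, ← h.conj_symm x (Fr.s j x) v, ← hF j x v]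
    ring
  constructor
  · intro i j
    have := key 1 i j
    rw [one_smul] at this
    have h1 : SmoothFn.conj d M 1 = 1 := by ext x; exact map_one (starRingEnd ℂ)
    rw [h1, one_smul] at this
    exact this.symm
  · exact key

theorem isInvol_conj : IsInvol ℂ (Opens M) (SmoothFn.conj d M) where
  mul f g := by
    ext x
    exact (map_mul (starRingEnd ℂ) (f x) (g x)).trans (mul_comm _ _)
  invol f := by ext x; exact Complex.conj_conj (f x)
  smul c f := by ext x; exact map_mul (starRingEnd ℂ) c (f x)
  loc U f hf x hx := by
    change (starRingEnd ℂ) (f x) = 0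
    rw [show f x = 0 from hf x hx, map_zero]

theorem isInvol_adjoint (h : HermitianMetric d F V) : IsInvol ℂ (Opens M) h.adjoint where
  mul L S := h.adjoint_unique fun x v w => by
    rw [h.adjoint_spec]
    change h.form x v (L.1 x (S.1 x w)) = h.form x ((h.adjoint S).1 x ((h.adjoint L).1 x v)) w
    rw [h.adjoint_spec, h.adjoint_spec]
  invol L := h.adjoint_unique fun x v w => by
    rw [h.adjoint_spec, ← h.conj_symm, h.adjoint_spec, h.conj_symm]
  smul c L := h.adjoint_unique fun x v w => by
    rw [h.adjoint_spec]
    change h.form x v (c • L.1 x w) = h.form x ((starRingEnd ℂ) c • (h.adjoint L).1 x v) w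
    rw [map_smul (h.form x v), LinearMap.map_smulₛₗ, LinearMap.smul_apply, h.adjoint_spec,
      Complex.conj_conj]
  loc U L hL x hx := by
    have h0 : L.1 x = 0 := hL x hx
    refine LinearMap.ext fun v => ?_
    by_contra hne
    refine (h.pos x _ hne).ne' ?_
    change (h.form x ((h.adjoint L).1 x v) ((h.adjoint L).1 x v)).re = 0
    rw [h.adjoint_spec, h0, LinearMap.zero_apply, map_zero, Complex.zero_re]

end Adjoint

end Presentations

/-! ### The induced deformation -/

section InducedDeformation

set_option linter.unusedSectionVars false

open Module TopologicalSpace Van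

/-! ### From columns and ⋆ to rows and the opposite product. -/

section Transpose

variable {A : Type*} [CommRing A] [Algebra ℂ A] {n : ℕ}

/-- The transpose of a matrix of power series, as a matrix of series. -/
def trSer (L : Matrix (Fin n) (Fin n) A⟦X⟧) : Matrix (Fin n) (Fin n) (Ser A) :=
  .of fun i j => toSer (L j i)

theorem trSer_apply (L : Matrix (Fin n) (Fin n) A⟦X⟧) (i j : Fin n) :
    trSer L i j = toSer (L j i) := rfl

theorem trSer_injective : Function.Injective (trSer : Matrix (Fin n) (Fin n) A⟦X⟧ → _) :=
  fun _ _ h => by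
    ext1 i j
    exact toSer_injective (congrFun (congrFun h j) i)

theorem trSer_surjective : Function.Surjective (trSer : Matrix (Fin n) (Fin n) A⟦X⟧ → _) :=
  fun Y => ⟨.of fun i j => ofSer (Y j i), by ext1 i j; exact toSer_ofSer _⟩

theorem toSer_sum {ι : Type*} (T : Finset ι) (f : ι → A⟦X⟧) :
    toSer (∑ i ∈ T, f i) = ∑ i ∈ T, toSer (f i) := by
  ext n; simp

/-- Transposition reverses a matrix product over a noncommutative ring only if the product of
entries is reversed too. With this, the statement's corner becomes the row formalism's. -/
theorem trSer_matStar (D : FormalProduct ℂ A) (L S : Matrix (Fin n) (Fin n) A⟦X⟧) :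
    trSer (D.matStar L S) = D.op.matMul (trSer S) (trSer L) := by
  ext1 i j
  rw [trSer_apply, FormalProduct.matStar, toSer_sum, FormalProduct.matMul_apply]
  exact Finset.sum_congr rfl fun l _ => by
    rw [FormalProduct.toSer_star, FormalProduct.mul_op]; rfl

theorem matStar_assoc (D : FormalProduct ℂ A) (L S R : Matrix (Fin n) (Fin n) A⟦X⟧) :
    D.matStar (D.matStar L S) R = D.matStar L (D.matStar S R) :=
  trSer_injective (by simp only [trSer_matStar, FormalProduct.matMul_assoc])

end Transpose

variable {d : ℕ} {M : Type*} [TopologicalSpace M] [ChartedSpace (EuclideanSpace ℝ (Fin d)) M]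
  {F : Type*} [NormedAddCommGroup F] [NormedSpace ℂ F]
  {V : M → Type*} [TopologicalSpace (TotalSpace F V)]
  [∀ x, AddCommGroup (V x)] [∀ x, Module ℂ (V x)] [∀ x, TopologicalSpace (V x)]
  [FiberBundle F V] [VectorBundle ℂ F V] [VectorBundle ℝ F V]

namespace Presentation

variable (p : Presentation d F V) {D : FormalProduct ℂ (SmoothFn d M)}
  (Fr : SmoothFrame d F V) (hspan : ∀ x (v : V x), ∃ t : Sect d F V, t x = v)
  (hne : ∀ x, ∃ v : V x, v ≠ 0)

theorem proj_dualBasis (i j : Fin p.n) :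
    ((p.frame Fr).dualBasis hspan hne).proj i j = p.P₀ j i :=
  (p.frame_coef Fr j (p.col i)).trans (p.comp_col j i)

theorem trSer_matrixSeries (L : (EndSect d F V)⟦X⟧) :
    trSer (p.matrixSeries L) = ((p.frame Fr).dualBasis hspan hne).toMat (toSer L) := by
  ext1 i j
  refine Ser.ext fun m => (PowerSeries.coeff_mk m fun r => p.matrix (PowerSeries.coeff r L) j i).trans
    ((p.matrix_apply _ _ _).trans (p.frame_coef Fr j _).symm)

theorem trSer_cornerMap (P : Matrix (Fin p.n) (Fin p.n) (SmoothFn d M)⟦X⟧)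
    (L : (EndSect d F V)⟦X⟧) :
    trSer (p.cornerMap D P L) =
      ((p.frame Fr).dualBasis hspan hne).corner D.op (trSer P) (toSer L) := by
  rw [cornerMap, matStar_assoc, trSer_matStar, trSer_matStar, p.trSer_matrixSeries Fr hspan hne]
  rfl

theorem exists_isDeformedIdempotent (D : FormalProduct ℂ (SmoothFn d M)) :
    ∃ P, p.IsDeformedIdempotent D P ∧ ((∀ i j, SmoothFn.conj d M (p.P₀ j i) = p.P₀ i j) →
      D.IsHermitian (SmoothFn.conj d M) → p.IsSelfAdjoint P) := by
  obtain ⟨Q, hQ, hQ0, hQs⟩ := D.op.exists_matMul_idempotent p.P₀.transpose (by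
    rw [← Matrix.transpose_mul, p.idem])
  obtain ⟨P, rfl⟩ := trSer_surjective Q
  refine ⟨P, ⟨trSer_injective ((trSer_matStar D P P).trans hQ), fun i j => hQ0 j i⟩,
    fun h0 h i j r => ?_⟩
  have h1 := hQs (Ser.mapAdd (SmoothFn.conj d M)) (Ser.mapAdd_X_smul _)
    (FormalProduct.isHermitian_iff.1 h.op)
    (fun i j => by rw [Ser.mapAdd_const, Matrix.transpose_apply, h0]; rfl) j i
  exact congrFun h1 r

/-- A deformed idempotent induces a local formal product. -/
theorem exists_induces (hD : IsLoc₂ (Opens M) fun f g => D.mul f g)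
    {P : Matrix (Fin p.n) (Fin p.n) (SmoothFn d M)⟦X⟧} (hP : p.IsDeformedIdempotent D P) :
    ∃ D₁ : FormalProduct ℂ (EndSect d F V), IsLoc₂ (Opens M) (fun f g => D₁.mul f g) ∧
      p.Induces D P D₁ ∧ (sectBimod hspan hne).Deforms D.op D₁ ∧
      ∀ st : EndSect d F V →+ EndSect d F V,
        ((p.frame Fr).dualBasis hspan hne).IsAdjoint (SmoothFn.conj d M) st →
        D.IsHermitian (SmoothFn.conj d M) → p.IsSelfAdjoint P → D₁.IsHermitian st := by
  let B := (p.frame Fr).dualBasis hspan hne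
  have hP1 : D.op.matMul (trSer P) (trSer P) = trSer P := by rw [← trSer_matStar, hP.1]
  have hP0 : ∀ i j, trSer P i j 0 = B.proj i j := fun i j =>
    (hP.2 j i).trans (p.proj_dualBasis Fr hspan hne i j).symm
  have hDo := FormalProduct.isLoc₂_op hD
  obtain ⟨D₁, l₁, hinj, hsurj, hm⟩ := B.exists_corner_mul hDo hP1 hP0
  have hc := p.trSer_cornerMap (D := D) Fr hspan hne P
  refine ⟨D₁, l₁, ⟨⟨fun L _ => ⟨_, rfl⟩, fun L _ S _ h => ?_, ?_⟩, fun L S => ?_⟩,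
    B.deforms_corner hDo hP1 hP0 hm, fun st hB hh hs => ?_⟩
  · exact toSer_injective (hinj ((hc L).symm.trans ((congrArg trSer h).trans (hc S))))
  · rintro _ ⟨L, rfl⟩
    obtain ⟨f, hf⟩ := hsurj (trSer L)
    have h2 : trSer (D.matStar (D.matStar P L) P) =
        D.op.matMul (D.op.matMul (trSer P) (trSer L)) (trSer P) := by
      rw [matStar_assoc, trSer_matStar, trSer_matStar]
    have h3 := hc (ofSer f)
    rw [toSer_ofSer] at h3
    exact ⟨ofSer f, trivial, trSer_injective (h3.trans (hf.trans h2.symm))⟩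
  · have h2 := hc (D₁.star L S)
    rw [FormalProduct.toSer_star] at h2
    refine trSer_injective (h2.trans ((hm _ _).trans ?_))
    rw [trSer_matStar, hc, hc]
    rfl
  · exact B.isHermitian_corner hinj hm hh.op
      (fun i j => Ser.ext fun r => hs j i r) hB.adj

end Presentation

end InducedDeformation

end StarProd

end

open StarProd
theorem mainTheorem2 {d : ℕ} {M : Type*} [TopologicalSpace M] [T2Space M]
    [SecondCountableTopology M] [ChartedSpace (EuclideanSpace ℝ (Fin d)) M] [IsManifold (𝓡 d) ∞ M]
    (F : Type*) [NormedAddCommGroup F] [NormedSpace ℂ F] [FiniteDimensional ℂ F] [Nontrivial F]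
    (V : M → Type*) [TopologicalSpace (TotalSpace F V)] [∀ x, AddCommGroup (V x)]
    [∀ x, Module ℂ (V x)] [∀ x, TopologicalSpace (V x)] [FiberBundle F V]
    [VectorBundle ℂ F V] [VectorBundle ℝ F V] [ContMDiffVectorBundle ∞ F V (𝓡 d)] :
    (Nonempty (Presentation d F V) ∧
      ∃ Φ : Def ℂ (SmoothFn.ev d M) → Def ℂ (EndSect.ev d F V), Function.Bijective Φ ∧
        ∀ (p : Presentation d F V) (D : LocalDef ℂ (SmoothFn.ev d M)),
          (∃ P, p.IsDeformedIdempotent D.toFormalProduct P) ∧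
          ∀ P, p.IsDeformedIdempotent D.toFormalProduct P →
            ∃ D₁ : FormalProduct ℂ (EndSect d F V),
              D₁.IsLocal (EndSect.ev d F V) ∧ p.Induces D.toFormalProduct P D₁ ∧
              ∃ D' : LocalDef ℂ (EndSect.ev d F V),
                EquivVia (localOps ℂ (EndSect.ev d F V)) D₁ D'.toFormalProduct ∧
                Φ D.cls = D'.cls) ∧
    ∀ h : HermitianMetric d F V,
      (∃ p : Presentation d F V, p.IsIsometric h) ∧
      ∃ Φ : HermDef ℂ (SmoothFn.ev d M) (SmoothFn.conj d M) →
          HermDef ℂ (EndSect.ev d F V) h.adjoint, Function.Bijective Φ ∧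
        ∀ p : Presentation d F V, p.IsIsometric h →
          ∀ D : HermLocalDef ℂ (SmoothFn.ev d M) (SmoothFn.conj d M),
          (∃ P, p.IsDeformedIdempotent D.toFormalProduct P ∧ p.IsSelfAdjoint P) ∧
          ∀ P, p.IsDeformedIdempotent D.toFormalProduct P → p.IsSelfAdjoint P →
            ∃ D₁ : FormalProduct ℂ (EndSect d F V),
              D₁.IsLocal (EndSect.ev d F V) ∧ D₁.IsHermitian h.adjoint ∧
              p.Induces D.toFormalProduct P D₁ ∧
              ∃ D' : HermLocalDef ℂ (EndSect.ev d F V) h.adjoint,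
                EquivVia (hermLocalOps ℂ (EndSect.ev d F V) h.adjoint) D₁ D'.toFormalProduct ∧
                Φ D.cls = D'.cls := by
  obtain ⟨Fr⟩ := exists_smoothFrame d F V
  have hspan := Fr.exists_sect
  have hne : ∀ x, ∃ v : V x, v ≠ 0 := fun x => by
    obtain ⟨y, hy⟩ := exists_ne (0 : F)
    let e := (trivializationAt F V x).linearEquivAt ℂ x (mem_baseSet_trivializationAt F V x)
    exact ⟨e.symm y, fun h0 => hy (by rw [← e.apply_symm_apply y, h0, map_zero])⟩
  let b := sectBimod hspan hne
  let _ : Invertible (2 : ℂ) := invertibleOfNonzero two_ne_zero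
  have hk : (0 : ℝ) < Module.finrank ℂ F := by exact_mod_cast Module.finrank_pos
  -- The trace of the identity is the rank, so 1/√rank normalizes the dual basis over Γ^∞(End E). It
  -- is chosen real for the sake of the adjoints.
  let c : ℂ := (((Real.sqrt (Module.finrank ℂ F))⁻¹ : ℝ) : ℂ)
  have hc : c * c * Module.finrank ℂ F = 1 := by
    have h1 : (Real.sqrt (Module.finrank ℂ F))⁻¹ * (Real.sqrt (Module.finrank ℂ F))⁻¹ *
        Module.finrank ℂ F = 1 := by
      rw [← mul_inv, Real.mul_self_sqrt hk.le, inv_mul_cancel₀ hk.ne']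
    simp only [c]
    exact_mod_cast h1
  have hv := SmoothFn.mem_van (d := d) (M := M)
  have hv' := EndSect.mem_van (d := d) (F := F) (V := V)
  refine ⟨⟨⟨Fr.presentation⟩, ?_⟩, fun h => ?_⟩
  · obtain ⟨Φ, hΦ, hD⟩ := exists_bijective_def (Fr.dualBasis hspan hne)
      (Fr.dualBasisEnd hspan hne c hc) hv hv'
    refine ⟨Φ, hΦ, fun p D => ⟨?_, fun P hP => ?_⟩⟩
    · obtain ⟨P, hP, -⟩ := p.exists_isDeformedIdempotent D.toFormalProduct
      exact ⟨P, hP⟩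
    -- Φ was constructed from the frame, D₁ from an arbitrary presentation and idempotent. They are
    -- compared through the relation `Deforms` for the same bimodule, which knows nothing of these
    -- choices.
    · obtain ⟨D₁, l₁, hI, hdef, -⟩ := p.exists_induces Fr hspan hne
        ((isLocal_iff hv _).1 D.isLocal) hP
      obtain ⟨D', l', hu, e⟩ := exists_unital_equiv l₁
      exact ⟨D₁, (isLocal_iff hv' _).2 l₁, hI, ⟨D', hu, (isLocal_iff hv' _).2 l'⟩,
        (equivVia_localOps_iff hv' _ _).2 e, hD D _ (hdef.congr_right e)⟩
  · obtain ⟨Fr', hF⟩ := Fr.exists_isParseval h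
    obtain ⟨Φ, hΦ, hD⟩ := exists_bijective_hermDef (Fr'.dualBasis hspan hne)
      (Fr'.dualBasisEnd hspan hne c hc) hv hv' isInvol_conj (isInvol_adjoint h)
      (hF.isAdjoint hspan hne) (hF.isAdjoint_end hspan hne hc (Complex.conj_ofReal _))
    refine ⟨⟨Fr'.presentation, hF.isIsometric⟩, Φ, hΦ, fun p hp D => ⟨?_, fun P hP hPs => ?_⟩⟩
    · obtain ⟨P, hP, hPs⟩ := p.exists_isDeformedIdempotent D.toFormalProduct
      exact ⟨P, hP, hPs hp.1 D.hermitian⟩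
    · obtain ⟨D₁, l₁, hI, hdef, hh⟩ := p.exists_induces Fr hspan hne
        ((isLocal_iff hv _).1 D.isLocal) hP
      -- An isometric presentation gives a Parseval frame of its own, whatever auxiliary frame is
      -- used to evaluate it; this makes the induced product Hermitian.
      have hh₁ := hh h.adjoint ((hp.isParseval Fr).isAdjoint hspan hne) D.hermitian hPs
      obtain ⟨D', l', hu, hh', e⟩ := exists_unital_hermEquiv (isInvol_adjoint h) l₁ hh₁
      exact ⟨D₁, (isLocal_iff hv' _).2 l₁, hh₁, hI, ⟨⟨D', hu, (isLocal_iff hv' _).2 l'⟩, hh'⟩,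
        (equivVia_hermLocalOps_iff hv' _ _ _).2 e, hD D _ (hdef.congr_right e.equivLoc)⟩
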